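/- Let $N\ge 3$, $2^*=\frac{2N}{N-2}$, $k\in\mathbb N$, $h_1,\dots,h_k\in C^1(\mathbb S^{N-1})$, and let $a_1,\dots,a_k\in\mathbb R^N$ be pairwise distinct. Let $\mathcal D^{1,2}(\mathbb R^N)$ be the closure of $C_c^\infty(\mathbb R^N)$ with respect to the norm $\|u\|=\big(\int_{\mathbb R^N}|\nabla u|^2\,dx\big)^{1/2}$ (realized as a space of functions in $L^{2^*}(\mathbb R^N)$ with gradient in $L^2$). For $u\in\mathcal D^{1,2}(\mathbb R^N)$ put $$\mathcal Q(u)=\int_{\mathbb R^N}|\nabla u|^2\,dx-\sum_{i=1}^k\int_{\mathbb R^N}\frac{h_i\big(\frac{x-a_i}{|x-a_i|}\big)}{|x-a_i|^2}\,u^2(x)\,dx ,$$ and define $$S=\inf_{u\ne0}\frac{\|u\|^2}{\|u\|_{L^{2^*}}^2},\qquad S(h)=\inf_{u\neq 0}\frac{\int_{\mathbb R^N}\big[|\nabla u|^2-\frac{h(x/|x|)}{|x|^2}u^2\big]dx}{\big(\int_{\mathbb R^N}|u|^{2^*}dx\big)^{2/2^*}},\qquad S(h_1,\dots,h_k)=\inf_{u\neq0}\frac{\mathcal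 Q(u)}{\big(\int_{\mathbb R^N}|u|^{2^*}dx\big)^{2/2^*}},$$ for $h\in C^1(\mathbb S^{N-1})$, the infima being over $u\in\mathcal D^{1,2}(\mathbb R^N)\setminus\{0\}$. (For $k=1$ the pole of $\mathcal Q$ is $a_1$ and that of $S(h)$ is the origin.) Let $$J(v)=\frac12\mathcal Q(v)-\frac{S(h_1,\dots,h_k)}{2^*}\int_{\mathbb R^N}|v|^{2^*}dx,\qquad v\in\mathcal D^{1,2}(\mathbb R^N).$$ Assume that $\mathcal Q$ is positive definite, i.e. $\inf_{u\ne0}\mathcal Q(u)/\|u\|^2>0$. Let $(u_n)\subset\mathcal D^{1,2}(\mathbb R^N)$ be a Palais–Smale sequence for $J$ at level $c\in\mathbb R$, i.e. $J(u_n)\to c$ and the Fréchet derivatives $J'(u_n)$ tend to $0$ in the dual space of $\mathcal D^{1,2}(\mathbb R^N)$. If $$c<\frac1N\,S(h_1,\dots,h_k)^{1-\frac N2}\Big(\min\big\{S,S(h_1),\dots,S(h_k),S\big(\textstyle\sum_{j=1}^kh_j\big)\big\}\Big)^{N/2},$$ then $(u_n)$ has a subsequence that converges strongly in $\mathcal D^{1,2}(\mathbb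 R^N)$. -/

import Mathlib

open MeasureTheory Filter Topology Metric
open scoped ContDiff Manifold ENNReal NNReal

noncomputable section

namespace MultiSing

/-- The Euclidean space `ℝ^N`. -/
abbrev Eucl (N : ℕ) : Type := EuclideanSpace ℝ (Fin N)

/-- The unit sphere `𝕊^{N-1}` of `ℝ^N`. -/
abbrev Sph (N : ℕ) : Type := sphere (0 : Eucl N) 1

/-- The critical Sobolev exponent `2^* = 2N/(N-2)`. -/
def crit (N : ℕ) : ℝ := 2 * (N : ℝ) / ((N : ℝ) - 2)

/-- The critical Sobolev exponent, as an exponent for Mathlib's `L^p` spaces. -/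
def critE (N : ℕ) : ℝ≥0∞ := ENNReal.ofReal (crit N)

section Space

variable (N : ℕ) [hN : Fact (3 ≤ N)]

/-- The dimension of `ℝ^N` in the form that the manifold structure of the sphere asks for. -/
instance finrank_fact : Fact (Module.finrank ℝ (Eucl N) = (N - 1) + 1) :=
  ⟨by have := hN.out; rw [finrank_euclideanSpace_fin]; omega⟩

theorem crit_inv : (crit N)⁻¹ = 2⁻¹ - (N : ℝ)⁻¹ := by
  have h3 : (3 : ℝ) ≤ N := by exact_mod_cast hN.out
  have h2 : (N : ℝ) - 2 ≠ 0 := by linarith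
  have h0 : (N : ℝ) ≠ 0 := by linarith
  unfold crit
  field_simp

theorem one_le_crit : 1 ≤ crit N := by
  have h3 : (3 : ℝ) ≤ N := by exact_mod_cast hN.out
  unfold crit
  rw [le_div_iff₀ (by linarith)]
  linarith

instance one_le_critE : Fact (1 ≤ critE N) :=
  ⟨by simpa [critE] using one_le_crit N⟩

/-- The pairs `(φ, ∇φ)` with `φ ∈ C_c^∞(ℝ^N)`, inside `L^{2^*}(ℝ^N) × L^2(ℝ^N; ℝ^N)`. -/
def testGraph :
    Submodule ℝ (Lp ℝ (critE N) (volume : Measure (Eucl N)) ×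
      Lp (Eucl N) 2 (volume : Measure (Eucl N))) where
  carrier := {p | ∃ φ : Eucl N → ℝ, ContDiff ℝ ∞ φ ∧ HasCompactSupport φ ∧
    p.1 =ᵐ[volume] φ ∧ p.2 =ᵐ[volume] gradient φ}
  zero_mem' := by
    refine ⟨0, contDiff_const, HasCompactSupport.zero, Lp.coeFn_zero _ _ _, ?_⟩
    filter_upwards [Lp.coeFn_zero (Eucl N) 2 (volume : Measure (Eucl N))] with x hx
    rw [Prod.snd_zero, hx]
    simp [gradient]
  add_mem' := by
    rintro p q ⟨φ, h1, h2, h3, h4⟩ ⟨ψ, g1, g2, g3, g4⟩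
    refine ⟨φ + ψ, h1.add g1, h2.add g2, ?_, ?_⟩
    · exact (Lp.coeFn_add _ _).trans (h3.add g3)
    · filter_upwards [Lp.coeFn_add p.2 q.2, h4, g4] with x hx e1 e2
      rw [Prod.snd_add, hx, Pi.add_apply, e1, e2]
      simp only [gradient]
      rw [fderiv_add (h1.differentiable (by simp) x) (g1.differentiable (by simp) x), map_add]
  smul_mem' := by
    rintro c p ⟨φ, h1, h2, h3, h4⟩
    refine ⟨c • φ, contDiff_const.smul h1, h2.smul_left (f := fun _ => c), ?_, ?_⟩
    · exact (Lp.coeFn_smul _ _).trans (h3.const_smul c)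
    · filter_upwards [Lp.coeFn_smul c p.2, h4] with x hx e1
      rw [Prod.smul_snd, hx, Pi.smul_apply, e1]
      simp only [gradient]
      rw [fderiv_const_smul (h1.differentiable (by simp) x)]
      simp

/-- The closure of `{(φ, ∇φ) : φ ∈ C_c^∞(ℝ^N)}` in `L^{2^*} × L^2`. -/
def d12Sub :
    Submodule ℝ (Lp ℝ (critE N) (volume : Measure (Eucl N)) ×
      Lp (Eucl N) 2 (volume : Measure (Eucl N))) :=
  (testGraph N).topologicalClosure

/-- The space `𝒟^{1,2}(ℝ^N)`: the closure of `C_c^∞(ℝ^N)` with respect to the norm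
`‖∇u‖_{L^2}`. By Sobolev's inequality a sequence of test functions which is Cauchy for this norm
converges in `L^{2^*}`, while its gradients converge in `L^2`; an element of the space is the
limit `u ∈ L^{2^*}` together with its gradient `∇u ∈ L^2`. -/
def D12 : Type := ↥(d12Sub N)

instance : AddCommGroup (D12 N) := inferInstanceAs (AddCommGroup ↥(d12Sub N))

instance : Module ℝ (D12 N) := inferInstanceAs (Module ℝ ↥(d12Sub N))

variable {N}

/-- The function in `L^{2^*}(ℝ^N)` underlying an element of `𝒟^{1,2}(ℝ^N)`. -/
def D12.fn (u : D12 N) : Lp ℝ (critE N) (volume : Measure (Eucl N)) := u.1.1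

/-- The gradient in `L^2(ℝ^N; ℝ^N)` of an element of `𝒟^{1,2}(ℝ^N)`. -/
def D12.grad (u : D12 N) : Lp (Eucl N) 2 (volume : Measure (Eucl N)) := u.1.2

variable (N)

/-- The gradient as a linear map. -/
def gradL : D12 N →ₗ[ℝ] Lp (Eucl N) 2 (volume : Measure (Eucl N)) where
  toFun u := u.grad
  map_add' _ _ := rfl
  map_smul' _ _ := rfl

/-- Sobolev's inequality, with some constant. -/
theorem exists_sobolev : ∃ C : ℝ, ∀ u : D12 N, ‖u.fn‖ ≤ C * ‖u.grad‖ := by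
  have h3 : 3 ≤ N := hN.out
  have hc := one_le_crit N
  refine ⟨SNormLESNormFDerivOfEqConst ℝ (volume : Measure (Eucl N)) 2, fun u => ?_⟩
  have key : ∀ p ∈ d12Sub N,
      ‖p.1‖ ≤ SNormLESNormFDerivOfEqConst ℝ (volume : Measure (Eucl N)) 2 * ‖p.2‖ := by
    intro p hp
    have hcl : IsClosed {p : Lp ℝ (critE N) (volume : Measure (Eucl N)) ×
        Lp (Eucl N) 2 (volume : Measure (Eucl N)) |
        ‖p.1‖ ≤ SNormLESNormFDerivOfEqConst ℝ (volume : Measure (Eucl N)) 2 * ‖p.2‖} :=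
      isClosed_le (by fun_prop) (by fun_prop)
    refine closure_minimal ?_ hcl hp
    rintro ⟨f, g⟩ ⟨φ, h1, h2, hf, hg⟩
    have hs := eLpNorm_le_eLpNorm_fderiv_of_eq (volume : Measure (Eucl N)) (u := φ)
      (p := 2) (p' := (crit N).toNNReal) (h1.of_le (by simp)) h2 (by norm_num)
      (by rw [finrank_euclideanSpace_fin]; omega)
      (by
        rw [finrank_euclideanSpace_fin, Real.coe_toNNReal _ (by linarith), crit_inv N]
        norm_num)
    have e1 : eLpNorm f (critE N) volume = eLpNorm φ (critE N) volume := eLpNorm_congr_ae hf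
    have e2 : eLpNorm g 2 volume = eLpNorm (fderiv ℝ φ) 2 volume := by
      rw [eLpNorm_congr_ae hg]
      refine eLpNorm_congr_norm_ae (Eventually.of_forall fun x => ?_)
      simp [gradient]
    have hs' : eLpNorm f (critE N) volume ≤
        (SNormLESNormFDerivOfEqConst ℝ (volume : Measure (Eucl N)) 2 : ℝ≥0∞) *
          eLpNorm g 2 volume := by
      rw [e1, e2]; exact_mod_cast hs
    have := ENNReal.toReal_mono
      (ENNReal.mul_ne_top ENNReal.coe_ne_top (Lp.eLpNorm_ne_top g)) hs'
    simpa [Lp.norm_def] using this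
  exact key u.1 u.2

theorem gradL_injective : Function.Injective (gradL N) := by
  rw [← LinearMap.ker_eq_bot, LinearMap.ker_eq_bot']
  intro u hu
  obtain ⟨C, hC⟩ := exists_sobolev N
  have hg : u.grad = 0 := hu
  have hf : u.fn = 0 := by
    have := hC u
    rw [hg, norm_zero, mul_zero] at this
    exact norm_le_zero_iff.1 this
  exact Subtype.ext (Prod.ext hf hg)

/-- The norm of `𝒟^{1,2}(ℝ^N)` is `‖u‖ = ‖∇u‖_{L^2}`. -/
instance : NormedAddCommGroup (D12 N) :=
  NormedAddCommGroup.induced (D12 N) (Lp (Eucl N) 2 (volume : Measure (Eucl N)))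
    (gradL N) (gradL_injective N)

instance : NormedSpace ℝ (D12 N) :=
  NormedSpace.induced ℝ (D12 N) (Lp (Eucl N) 2 (volume : Measure (Eucl N))) (gradL N)

end Space

section Functionals

variable {N : ℕ}

/-- The value `h(x/|x|)` of an angular function `h` on `𝕊^{N-1}`, for `x ≠ 0`
(and `0` at the irrelevant point `x = 0`). -/
def angular (h : Sph N → ℝ) (x : Eucl N) : ℝ :=
  open Classical in
  if hx : x = 0 then 0 else h ⟨‖x‖⁻¹ • x, by
    rw [mem_sphere_zero_iff_norm, norm_smul, norm_inv, norm_norm,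
      inv_mul_cancel₀ (norm_ne_zero_iff.2 hx)]⟩

variable [hN : Fact (3 ≤ N)]

/-- `∫ |∇u|^2 dx`. -/
def dirichlet (u : D12 N) : ℝ := ∫ x, ‖u.grad x‖ ^ 2

/-- `∫ h((x-a)/|x-a|) |x-a|^{-2} u(x)^2 dx`. -/
def poleTerm (h : Sph N → ℝ) (a : Eucl N) (u : D12 N) : ℝ :=
  ∫ x, angular h (x - a) / ‖x - a‖ ^ 2 * (u.fn x) ^ 2

/-- `∫ |u|^{2^*} dx`. -/
def critTerm (u : D12 N) : ℝ := ∫ x, |u.fn x| ^ crit N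

/-- The quadratic form `𝒬`. -/
def Q {k : ℕ} (h : Fin k → Sph N → ℝ) (a : Fin k → Eucl N) (u : D12 N) : ℝ :=
  dirichlet u - ∑ i, poleTerm (h i) (a i) u

/-- The number `μ(h_1,…,h_k,a_1,…,a_k)`, the infimum of `𝒬(u)/‖u‖²` over `u ≠ 0`. -/
def mu {k : ℕ} (h : Fin k → Sph N → ℝ) (a : Fin k → Eucl N) : ℝ :=
  ⨅ u : {u : D12 N // u ≠ 0}, Q h a u.1 / ‖u.1‖ ^ 2

/-- The number `S(h_1,…,h_k)`, the infimum of the Rayleigh quotient of `𝒬`. -/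
def SMulti {k : ℕ} (h : Fin k → Sph N → ℝ) (a : Fin k → Eucl N) : ℝ :=
  ⨅ u : {u : D12 N // u ≠ 0}, Q h a u.1 / (critTerm u.1) ^ (2 / crit N)

/-- The one-pole constant `S(h)`, with pole at the origin. -/
def SOne (h : Sph N → ℝ) : ℝ :=
  ⨅ u : {u : D12 N // u ≠ 0},
    (dirichlet u.1 - poleTerm h 0 u.1) / (critTerm u.1) ^ (2 / crit N)

variable (N) in
/-- The best constant `S` in Sobolev's inequality. -/
def SSob : ℝ :=
  ⨅ u : {u : D12 N // u ≠ 0}, ‖u.1‖ ^ 2 / ‖u.1.fn‖ ^ 2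

/-- The energy functional `J`. -/
def J {k : ℕ} (h : Fin k → Sph N → ℝ) (a : Fin k → Eucl N) (v : D12 N) : ℝ :=
  1 / 2 * dirichlet v - 1 / 2 * ∑ i, poleTerm (h i) (a i) v
    - SMulti h a / crit N * critTerm v

/-- `min {S, S(h_1), …, S(h_k), S(h_1 + ⋯ + h_k)}`; the set is finite and non-empty, so that its
infimum is its minimum. -/
def minLevel {k : ℕ} (h : Fin k → Sph N → ℝ) : ℝ :=
  sInf (insert (SSob N) (insert (SOne (∑ j, h j)) (Set.range fun i => SOne (h i))))

/-- `(u_n)` is a Palais–Smale sequence for `J` at level `c`: `J(u_n) → c`, and the Fréchet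
derivatives `J'(u_n)` tend to `0` in the dual space of `𝒟^{1,2}(ℝ^N)`. -/
def IsPalaisSmale {k : ℕ} (h : Fin k → Sph N → ℝ) (a : Fin k → Eucl N)
    (u : ℕ → D12 N) (c : ℝ) : Prop :=
  Tendsto (fun n => J h a (u n)) atTop (𝓝 c) ∧
    Tendsto (fun n => fderiv ℝ (J h a) (u n)) atTop (𝓝 (0 : D12 N →L[ℝ] ℝ))

end Functionals

end MultiSing

end

/-!
Positive definiteness bounds `(u_n)`, so along a subsequence it has a weak limit `u₀`; put
`w_n = u_n - u₀` and `Λ = S(h_1, …, h_k)`. By weak convergence the quadratic form splits, and since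
`w_n → 0` in `L^2` of every ball so does the critical term: `𝒬(w_n) → l := N c - 𝒬(u₀)` and
`∫ |w_n|^{2^*} → l / Λ`.

The potential is close to that of `h_i` near `a_i`, to that of `∑ h_j` near infinity, and is bounded
elsewhere. Hence, by a partition of unity, `m ‖w_n‖_{L^{2^*}}² ≤ 𝒬(w_n) + o(1)` with `m` the minimum
of the levels, that is, `m (l / Λ)^{2/2^*} ≤ l`. Unless `l = 0` this gives
`Λ^{1 - N/2} m^{N/2} ≤ l ≤ N c`, against the choice of `c`. If `l = 0`, positive definiteness turns
`𝒬(w_n) → 0` into strong convergence.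
-/

noncomputable section

namespace MultiSing

section DualPow

/-- The function `t ↦ |t| ^ (p - 2) * t`, which is the derivative of `|t| ^ p / p`. Composition
with it is the duality map of `L^p`. -/
def dualPow (p t : ℝ) : ℝ := |t| ^ (p - 2) * t

variable {p : ℝ}

theorem measurable_dualPow (p : ℝ) : Measurable (dualPow p) := by
  unfold dualPow
  fun_prop

theorem abs_dualPow_mul (p s t : ℝ) : |dualPow p s * t| = |s| ^ (p - 2) * |s| * |t| := by
  rw [dualPow, abs_mul, abs_mul, Real.abs_rpow_of_nonneg (abs_nonneg s), abs_abs]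

theorem dualPow_mul_self (hp : p ≠ 0) (t : ℝ) : dualPow p t * t = |t| ^ p := by
  rcases eq_or_ne t 0 with rfl | ht
  · simp [dualPow, Real.zero_rpow hp]
  · rw [dualPow, mul_assoc, ← sq, ← sq_abs, ← Real.rpow_natCast, ← Real.rpow_add (abs_pos.2 ht)]
    norm_num

theorem hasDerivAt_dualPow (hp : 2 ≤ p) (t : ℝ) :
    HasDerivAt (dualPow p) ((p - 1) * |t| ^ (p - 2)) t := by
  rcases eq_or_ne t 0 with rfl | ht
  · have hslope : Tendsto (fun s : ℝ => |s| ^ (p - 2)) (𝓝[≠] 0) (𝓝 (|0| ^ (p - 2))) :=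
      (continuous_abs.rpow_const fun _ => Or.inr (by linarith)).continuousAt.mono_left inf_le_left
    have hvalue : (p - 1) * |(0 : ℝ)| ^ (p - 2) = |0| ^ (p - 2) := by
      rcases hp.eq_or_lt with rfl | hp
      · norm_num
      · simp [Real.zero_rpow (by linarith : p - 2 ≠ 0)]
    rw [hasDerivAt_iff_tendsto_slope_zero, hvalue]
    refine hslope.congr' ?_
    filter_upwards [self_mem_nhdsWithin] with s hs
    have hs : s ≠ 0 := hs
    simp only [dualPow, zero_add, mul_zero, sub_zero, smul_eq_mul]
    field_simp
  · refine (((hasDerivAt_abs ht).rpow_const (Or.inl (abs_ne_zero.2 ht))).mul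
      (hasDerivAt_id t)).congr_deriv ?_
    have hsign : (SignType.sign t : ℝ) * t = |t| := sign_mul_self t
    have hpow : |t| ^ (p - 2 - 1) * |t| = |t| ^ (p - 2) := by
      rw [← Real.rpow_add_one (abs_ne_zero.2 ht), sub_add_cancel]
    simp only [id, mul_one]
    linear_combination (p - 2) * |t| ^ (p - 2 - 1) * hsign + (p - 2) * hpow

theorem abs_dualPow_sub_le (hp : 2 ≤ p) (x y : ℝ) :
    |dualPow p x - dualPow p y| ≤ (p - 1) * (|x| + |y|) ^ (p - 2) * |x - y| := by
  refine (convex_uIcc y x).norm_image_sub_le_of_norm_hasDerivWithin_le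
    (fun t _ => (hasDerivAt_dualPow hp t).hasDerivWithinAt) (fun t ht => ?_)
    Set.left_mem_uIcc Set.right_mem_uIcc
  have ht' : |t| ≤ |x| + |y| := by
    rcases Set.mem_uIcc.1 ht with h | h <;>
      exact abs_le.2 ⟨by linarith [neg_abs_le x, neg_abs_le y, abs_nonneg x, abs_nonneg y],
        by linarith [le_abs_self x, le_abs_self y, abs_nonneg x, abs_nonneg y]⟩
  rw [Real.norm_of_nonneg (mul_nonneg (by linarith) (by positivity))]
  gcongr
  linarith

theorem abs_abs_add_rpow_sub_le (hp : 2 ≤ p) (a b : ℝ) :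
    |(|a + b| ^ p - |a| ^ p - p * (dualPow p a * b))| ≤
      p * (p - 1) * ((2 * |a| + |b|) ^ (p - 2) * |b| * |b|) := by
  have hderiv (t : ℝ) : HasDerivAt (fun t : ℝ => |t| ^ p - p * (dualPow p a * (t - a)))
      (p * (dualPow p t - dualPow p a)) t := by
    refine ((hasDerivAt_abs_rpow t (by linarith)).sub
      ((((hasDerivAt_id t).sub_const a).const_mul _).const_mul _)).congr_deriv ?_
    unfold dualPow
    ring
  have hbound : ∀ t ∈ Set.uIcc a (a + b), ‖p * (dualPow p t - dualPow p a)‖ ≤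
      p * ((p - 1) * (2 * |a| + |b|) ^ (p - 2) * |b|) := fun t ht => by
    have hta : |t - a| ≤ |b| := by simpa using Set.abs_sub_left_of_mem_uIcc ht
    have ht' : |t| ≤ |a| + |b| := by linarith [abs_sub_abs_le_abs_sub t a]
    rw [norm_mul, Real.norm_eq_abs, Real.norm_eq_abs, abs_of_nonneg (by linarith : 0 ≤ p)]
    refine mul_le_mul_of_nonneg_left ((abs_dualPow_sub_le hp t a).trans ?_) (by linarith)
    exact mul_le_mul (mul_le_mul_of_nonneg_left (Real.rpow_le_rpow (by positivity) (by linarith)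
      (by linarith)) (by linarith)) hta (abs_nonneg _) (mul_nonneg (by linarith) (by positivity))
  have hmvt := (convex_uIcc a (a + b)).norm_image_sub_le_of_norm_hasDerivWithin_le
    (fun t _ => (hderiv t).hasDerivWithinAt) hbound Set.left_mem_uIcc Set.right_mem_uIcc
  simp only [Real.norm_eq_abs, add_sub_cancel_left, sub_self, mul_zero, sub_zero] at hmvt
  calc |(|a + b| ^ p - |a| ^ p - p * (dualPow p a * b))|
      = |(|a + b| ^ p - p * (dualPow p a * b) - |a| ^ p)| := by congr 1; ring
    _ ≤ _ := hmvt
    _ = _ := by ring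

end DualPow

section Holder

variable {α : Type*} [MeasurableSpace α] {μ : Measure α} {q : ℝ}

theorem lintegral_rpow_mul_mul_le (hq : 2 ≤ q) {f g k : α → ℝ≥0∞} (hf : AEMeasurable f μ)
    (hg : AEMeasurable g μ) (hk : AEMeasurable k μ) :
    ∫⁻ x, f x ^ (q - 2) * g x * k x ∂μ ≤
      ((∫⁻ x, f x ^ q ∂μ) ^ q⁻¹) ^ (q - 2) * (∫⁻ x, g x ^ q ∂μ) ^ q⁻¹ *
        (∫⁻ x, k x ^ q ∂μ) ^ q⁻¹ := by
  have hq0 : q ≠ 0 := by linarith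
  have hroot (t : ℝ≥0∞) : (t ^ q) ^ q⁻¹ = t := ENNReal.rpow_rpow_inv hq0 t
  have h := ENNReal.lintegral_prod_norm_pow_le (μ := μ) Finset.univ
    (f := ![fun x => f x ^ q, fun x => g x ^ q, fun x => k x ^ q])
    (p := ![q⁻¹ * (q - 2), q⁻¹, q⁻¹])
    (by simp only [Finset.mem_univ, forall_const, Fin.forall_fin_succ]
        exact ⟨hf.pow_const q, hg.pow_const q, hk.pow_const q, fun i => i.elim0⟩)
    (by simp only [Fin.sum_univ_three, Matrix.cons_val]; field_simp; ring)
    (by simp only [Finset.mem_univ, forall_const, Fin.forall_fin_succ]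
        have : 0 ≤ q⁻¹ := inv_nonneg.2 (by linarith)
        exact ⟨mul_nonneg this (by linarith), this, this, fun i => i.elim0⟩)
  simpa only [Fin.prod_univ_three, Matrix.cons_val, ENNReal.rpow_mul, hroot] using h

/-- Hölder's inequality, after the interpolation
`w = (w ^ q) ^ ((q - 2) / q ^ 2) * (w ^ 2) ^ (1 / q)`. -/
theorem lintegral_rpow_mul_le_interpolate (hq : 2 ≤ q) {f w : α → ℝ≥0∞} (hf : AEMeasurable f μ)
    (hw : AEMeasurable w μ) :
    ∫⁻ x, f x ^ (q - 2) * w x ∂μ ≤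
      (∫⁻ x, f x ^ q ∂μ) ^ ((q - 2) / q) * (∫⁻ x, w x ^ q ∂μ) ^ ((q - 2) / q ^ 2) *
        (∫⁻ x, w x ^ 2 ∂μ) ^ q⁻¹ * μ Set.univ ^ (2 / q ^ 2) := by
  have hq0 : 0 < q := by linarith
  have hsub : 0 ≤ q - 2 := by linarith
  have hroot (t : ℝ≥0∞) : (t ^ q) ^ ((q - 2) / q) = t ^ (q - 2) := by
    rw [← ENNReal.rpow_mul, mul_div_cancel₀ _ hq0.ne']
  have hsplit (t : ℝ≥0∞) : (t ^ q) ^ ((q - 2) / q ^ 2) * (t ^ 2) ^ q⁻¹ = t := by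
    rw [← ENNReal.rpow_two, ← ENNReal.rpow_mul, ← ENNReal.rpow_mul,
      ← ENNReal.rpow_add_of_nonneg _ _ (by positivity) (by positivity)]
    convert ENNReal.rpow_one t using 2
    field_simp
    ring
  have h := ENNReal.lintegral_prod_norm_pow_le (μ := μ) Finset.univ
    (f := ![fun x => f x ^ q, fun x => w x ^ q, fun x => w x ^ 2, fun _ => 1])
    (p := ![(q - 2) / q, (q - 2) / q ^ 2, q⁻¹, 2 / q ^ 2])
    (by simp only [Finset.mem_univ, forall_const, Fin.forall_fin_succ]
        exact ⟨hf.pow_const q, hw.pow_const q, hw.pow_const 2, aemeasurable_const,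
          fun i => i.elim0⟩)
    (by simp only [Fin.sum_univ_four, Matrix.cons_val]; field_simp; ring)
    (by simp only [Finset.mem_univ, forall_const, Fin.forall_fin_succ]
        exact ⟨div_nonneg hsub hq0.le, div_nonneg hsub (sq_nonneg q), inv_nonneg.2 hq0.le,
          div_nonneg zero_le_two (sq_nonneg q), fun i => i.elim0⟩)
  simpa only [Fin.prod_univ_four, Matrix.cons_val, hroot, ENNReal.one_rpow, mul_one, mul_assoc,
    hsplit, lintegral_one] using h

end Holder

section LpPower

variable {α E : Type*} [MeasurableSpace α] {μ : Measure α} [NormedAddCommGroup E] {p : ℝ≥0∞}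

theorem Lp_norm_rpow_toReal (hp₀ : p ≠ 0) (hp : p ≠ ⊤) (f : Lp E p μ) :
    ‖f‖ ^ p.toReal = ∫ x, ‖f x‖ ^ p.toReal ∂μ := by
  have h := lpNorm_eq_integral_norm_rpow_toReal hp₀ hp (Lp.aestronglyMeasurable f)
  rw [← toReal_eLpNorm (Lp.aestronglyMeasurable f), ← Lp.norm_def] at h
  rw [h, ← Real.rpow_mul (integral_nonneg fun x => by positivity),
    inv_mul_cancel₀ (ENNReal.toReal_ne_zero.2 ⟨hp₀, hp⟩), Real.rpow_one]

theorem Lp_enorm_eq_lintegral (hp₀ : p ≠ 0) (hp : p ≠ ⊤) (f : Lp E p μ) :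
    ‖f‖ₑ = (∫⁻ x, ‖f x‖ₑ ^ p.toReal ∂μ) ^ p.toReal⁻¹ := by
  rw [Lp.enorm_def, eLpNorm_eq_lintegral_rpow_enorm_toReal hp₀ hp, one_div]

theorem integrable_Lp_abs_rpow (hp₀ : p ≠ 0) (hp : p ≠ ⊤) (f : Lp ℝ p μ) :
    Integrable (fun x => |f x| ^ p.toReal) μ :=
  (Lp.memLp f).integrable_norm_rpow hp₀ hp

theorem ae_abs_add_abs_Lp (f g : Lp ℝ p μ) : ∀ᵐ x ∂μ, |(|f| + |g|) x| = |f x| + |g x| := by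
  filter_upwards [Lp.coeFn_add |f| |g|, Lp.coeFn_abs f, Lp.coeFn_abs g] with x h₁ h₂ h₃
  rw [h₁, Pi.add_apply, h₂, h₃, abs_of_nonneg (by positivity)]

theorem enorm_abs_rpow_mul_mul {q : ℝ} (hq : 2 ≤ q) (r s t : ℝ) :
    ‖|r| ^ (q - 2) * |s| * |t|‖ₑ = ‖r‖ₑ ^ (q - 2) * ‖s‖ₑ * ‖t‖ₑ := by
  simp [enorm_mul, Real.enorm_rpow_of_nonneg (abs_nonneg r) (sub_nonneg.2 hq)]

variable (hp₂ : 2 ≤ p) (hp : p ≠ ⊤)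
include hp₂ hp

theorem two_le_toReal : 2 ≤ p.toReal := by
  simpa using ENNReal.toReal_mono hp hp₂

theorem lintegral_enorm_Lp_rpow_mul_mul_le (f g k : Lp ℝ p μ) :
    ∫⁻ x, ‖|f x| ^ (p.toReal - 2) * |g x| * |k x|‖ₑ ∂μ ≤
      ‖f‖ₑ ^ (p.toReal - 2) * ‖g‖ₑ * ‖k‖ₑ := by
  have hp₀ : p ≠ 0 := (two_pos.trans_le hp₂).ne'
  simp only [enorm_abs_rpow_mul_mul (two_le_toReal hp₂ hp), Lp_enorm_eq_lintegral hp₀ hp]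
  exact lintegral_rpow_mul_mul_le (two_le_toReal hp₂ hp) (Lp.aestronglyMeasurable f).enorm
    (Lp.aestronglyMeasurable g).enorm (Lp.aestronglyMeasurable k).enorm

theorem integrable_Lp_rpow_mul_mul (f g k : Lp ℝ p μ) :
    Integrable (fun x => |f x| ^ (p.toReal - 2) * |g x| * |k x|) μ := by
  have hf := (Lp.aestronglyMeasurable f).aemeasurable
  have hg := (Lp.aestronglyMeasurable g).aemeasurable
  have hk := (Lp.aestronglyMeasurable k).aemeasurable
  refine ⟨AEMeasurable.aestronglyMeasurable (by fun_prop), ?_⟩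
  refine (lintegral_enorm_Lp_rpow_mul_mul_le hp₂ hp f g k).trans_lt ?_
  finiteness [sub_nonneg.2 (two_le_toReal hp₂ hp)]

theorem integral_Lp_rpow_mul_mul_le (f g k : Lp ℝ p μ) :
    ∫ x, |f x| ^ (p.toReal - 2) * |g x| * |k x| ∂μ ≤ ‖f‖ ^ (p.toReal - 2) * ‖g‖ * ‖k‖ := by
  refine (le_abs_self _).trans ?_
  rw [← Real.norm_eq_abs, ← toReal_enorm]
  have h := (enorm_integral_le_lintegral_enorm _).trans
    (lintegral_enorm_Lp_rpow_mul_mul_le hp₂ hp f g k)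
  refine (ENNReal.toReal_mono ?_ h).trans_eq (by
    rw [ENNReal.toReal_mul, ENNReal.toReal_mul, ← ENNReal.toReal_rpow]
    simp only [Lp.enorm_def, ← Lp.norm_def])
  finiteness [sub_nonneg.2 (two_le_toReal hp₂ hp)]

theorem integrable_dualPow_mul (f g : Lp ℝ p μ) :
    Integrable (fun x => dualPow p.toReal (f x) * g x) μ := by
  refine (integrable_Lp_rpow_mul_mul hp₂ hp f f g).mono' ?_
    (Eventually.of_forall fun x => (abs_dualPow_mul _ _ _).le)
  exact (((measurable_dualPow _).comp_aemeasurable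
    (Lp.aestronglyMeasurable f).aemeasurable).mul
      (Lp.aestronglyMeasurable g).aemeasurable).aestronglyMeasurable

variable [Fact (1 ≤ p)]

/-- The functional `g ↦ ∫ |f| ^ (p - 2) f g` on `L^p`, which is `1 / p` times the derivative of
`f ↦ ∫ |f| ^ p`. -/
def dualPowL (f : Lp ℝ p μ) : Lp ℝ p μ →L[ℝ] ℝ :=
  LinearMap.mkContinuous
    { toFun := fun g => ∫ x, dualPow p.toReal (f x) * g x ∂μ
      map_add' := fun g k => by
        rw [← integral_add (integrable_dualPow_mul hp₂ hp f g) (integrable_dualPow_mul hp₂ hp f k)]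
        refine integral_congr_ae ?_
        filter_upwards [Lp.coeFn_add g k] with x hx
        rw [hx, Pi.add_apply, mul_add]
      map_smul' := fun c g => by
        rw [RingHom.id_apply, smul_eq_mul, ← integral_const_mul]
        refine integral_congr_ae ?_
        filter_upwards [Lp.coeFn_smul c g] with x hx
        rw [hx, Pi.smul_apply, smul_eq_mul, mul_left_comm] }
    (‖f‖ ^ (p.toReal - 2) * ‖f‖) fun g => by
      refine (norm_integral_le_integral_norm _).trans ?_
      simp only [Real.norm_eq_abs, abs_dualPow_mul]
      exact integral_Lp_rpow_mul_mul_le hp₂ hp f f g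

theorem dualPowL_apply (f g : Lp ℝ p μ) :
    dualPowL hp₂ hp f g = ∫ x, dualPow p.toReal (f x) * g x ∂μ := rfl

theorem abs_integral_abs_rpow_sub_le (f g : Lp ℝ p μ) :
    |(∫ x, |(f + g) x| ^ p.toReal ∂μ) - (∫ x, |f x| ^ p.toReal ∂μ) -
        p.toReal * dualPowL hp₂ hp f g| ≤
      p.toReal * (p.toReal - 1) * (‖|(2 : ℝ) • f| + |g|‖ ^ (p.toReal - 2) * ‖g‖ * ‖g‖) := by
  have hq := two_le_toReal hp₂ hp
  have hp₀ : p ≠ 0 := (two_pos.trans_le hp₂).ne'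
  have iPow (f : Lp ℝ p μ) := integrable_Lp_abs_rpow hp₀ hp f
  have iDual := (integrable_dualPow_mul hp₂ hp f g).const_mul p.toReal
  have iDom := (integrable_Lp_rpow_mul_mul hp₂ hp (|(2 : ℝ) • f| + |g|) g g).const_mul
    (p.toReal * (p.toReal - 1))
  have iDiff : Integrable (fun x => |(f + g) x| ^ p.toReal - |f x| ^ p.toReal) μ :=
    (iPow _).sub (iPow f)
  rw [dualPowL_apply, ← integral_const_mul, ← integral_sub (iPow _) (iPow f),
    ← integral_sub iDiff iDual]
  calc ‖∫ x, |(f + g) x| ^ p.toReal - |f x| ^ p.toReal -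
        p.toReal * (dualPow p.toReal (f x) * g x) ∂μ‖
    _ ≤ ∫ x, p.toReal * (p.toReal - 1) *
        (|(|(2 : ℝ) • f| + |g|) x| ^ (p.toReal - 2) * |g x| * |g x|) ∂μ := by
        refine norm_integral_le_of_norm_le iDom ?_
        filter_upwards [Lp.coeFn_add f g, ae_abs_add_abs_Lp ((2 : ℝ) • f) g,
          Lp.coeFn_smul (2 : ℝ) f] with x hadd habs hsmul
        rw [habs, hadd, hsmul, Pi.add_apply, Pi.smul_apply, smul_eq_mul, abs_mul, abs_two]
        exact abs_abs_add_rpow_sub_le hq _ _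
    _ ≤ _ := by
        rw [integral_const_mul]
        gcongr
        · exact mul_nonneg (by linarith) (by linarith)
        · exact integral_Lp_rpow_mul_mul_le hp₂ hp _ g g

theorem hasFDerivAt_integral_abs_rpow (f : Lp ℝ p μ) :
    HasFDerivAt (fun f : Lp ℝ p μ => ∫ x, |f x| ^ p.toReal ∂μ)
      (p.toReal • dualPowL hp₂ hp f) f := by
  have hq := two_le_toReal hp₂ hp
  rw [hasFDerivAt_iff_isLittleO_nhds_zero]
  refine Asymptotics.IsBigO.trans_isLittleO (g := fun g : Lp ℝ p μ => ‖g‖ ^ 2) ?_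
    (Asymptotics.isLittleO_norm_pow_id one_lt_two)
  refine Asymptotics.IsBigO.of_bound
    (p.toReal * (p.toReal - 1) * (2 * ‖f‖ + 1) ^ (p.toReal - 2)) ?_
  filter_upwards [Metric.ball_mem_nhds (0 : Lp ℝ p μ) one_pos] with g hg
  have hsum : ‖|(2 : ℝ) • f| + |g|‖ ≤ 2 * ‖f‖ + 1 := by
    refine (norm_add_le _ _).trans ?_
    rw [norm_abs_eq_norm, norm_abs_eq_norm, norm_smul, Real.norm_ofNat]
    linarith [mem_ball_zero_iff.1 hg]
  rw [smul_apply, smul_eq_mul, norm_pow, norm_norm, mul_assoc _ _ (‖g‖ ^ 2), sq, ← mul_assoc _ ‖g‖]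
  refine (abs_integral_abs_rpow_sub_le hp₂ hp f g).trans ?_
  gcongr
  exact mul_nonneg (by linarith) (by linarith)

end LpPower

section WeakConvergence

theorem exists_weakly_convergent_subseq {H : Type*} [NormedAddCommGroup H]
    [InnerProductSpace ℝ H] [CompleteSpace H] [TopologicalSpace.SeparableSpace H] {v : ℕ → H}
    {C : ℝ} (hv : ∀ n, ‖v n‖ ≤ C) :
    ∃ (s : ℕ → ℕ) (v₀ : H), StrictMono s ∧
      ∀ f : H →L[ℝ] ℝ, Tendsto (fun n => f (v (s n))) atTop (𝓝 (f v₀)) := by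
  let dual := InnerProductSpace.toDual ℝ H
  obtain ⟨L, -, s, hs, hL⟩ := WeakDual.isSeqCompact_closedBall ℝ H (0 : StrongDual ℝ H) C
    (x := fun n => StrongDual.toWeakDual (dual (v n))) (fun n => by simpa [dual] using hv n)
  have hinner (x : H) (f : H →L[ℝ] ℝ) : f x = dual x (dual.symm f) := by
    rw [InnerProductSpace.toDual_apply_apply, real_inner_comm,
      InnerProductSpace.toDual_symm_apply]
  refine ⟨s, dual.symm (WeakDual.toStrongDual L), hs, fun f => ?_⟩
  simp only [hinner _ f, dual.apply_symm_apply]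
  exact ((WeakDual.eval_continuous (dual.symm f)).tendsto L).comp hL

end WeakConvergence

section CriticalExponent

variable (N : ℕ)

theorem critE_ne_top : critE N ≠ ⊤ := ENNReal.ofReal_ne_top

variable [hN : Fact (3 ≤ N)]

theorem three_le_cast : (3 : ℝ) ≤ N := by exact_mod_cast hN.out

theorem two_lt_crit : 2 < crit N := by
  have h3 := three_le_cast N
  rw [crit, lt_div_iff₀ (by linarith)]
  linarith

theorem crit_pos : 0 < crit N := two_pos.trans (two_lt_crit N)

theorem two_div_crit : 2 / crit N = 1 - 2 / N := by
  rw [div_eq_mul_inv, crit_inv]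
  ring

theorem critE_toReal : (critE N).toReal = crit N := ENNReal.toReal_ofReal (crit_pos N).le

theorem two_le_critE : 2 ≤ critE N := by
  simpa [critE] using ENNReal.ofReal_le_ofReal (two_lt_crit N).le

theorem critE_ne_zero : critE N ≠ 0 := (two_pos.trans_le (two_le_critE N)).ne'

end CriticalExponent

section TestFunctions

variable {N : ℕ}

/-- A test function, that is, an element of `C_c^∞(ℝ^N)`. -/
structure IsTest (φ : Eucl N → ℝ) : Prop where
  smooth : ContDiff ℝ ∞ φ
  hasCompactSupport : HasCompactSupport φ

namespace IsTest

variable {φ ψ : Eucl N → ℝ}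

theorem continuous (hφ : IsTest φ) : Continuous φ := hφ.smooth.continuous

theorem differentiable (hφ : IsTest φ) : Differentiable ℝ φ := hφ.smooth.differentiable (by simp)

theorem continuous_fderiv (hφ : IsTest φ) : Continuous (fderiv ℝ φ) :=
  hφ.smooth.continuous_fderiv (by simp)

theorem continuous_gradient (hφ : IsTest φ) : Continuous (gradient φ) :=
  (InnerProductSpace.toDual ℝ (Eucl N)).symm.continuous.comp hφ.continuous_fderiv

theorem hasCompactSupport_gradient (hφ : IsTest φ) : HasCompactSupport (gradient φ) :=
  (hφ.hasCompactSupport.fderiv (𝕜 := ℝ)).comp_left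
    (g := (InnerProductSpace.toDual ℝ (Eucl N)).symm) (map_zero _)

theorem memLp (hφ : IsTest φ) (p : ℝ≥0∞) : MemLp φ p volume :=
  hφ.continuous.memLp_of_hasCompactSupport hφ.hasCompactSupport

theorem memLp_gradient (hφ : IsTest φ) (p : ℝ≥0∞) : MemLp (gradient φ) p volume :=
  hφ.continuous_gradient.memLp_of_hasCompactSupport hφ.hasCompactSupport_gradient

theorem mul_smooth (hφ : IsTest φ) (hψ : ContDiff ℝ ∞ ψ) : IsTest (fun x => ψ x * φ x) :=
  ⟨hψ.mul hφ.smooth, hφ.hasCompactSupport.mul_left⟩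

theorem memLp_fderiv_apply (hφ : IsTest φ) (e : Eucl N) (p : ℝ≥0∞) :
    MemLp (fun x => fderiv ℝ φ x e) p volume :=
  (hφ.continuous_fderiv.clm_apply continuous_const).memLp_of_hasCompactSupport
    ((hφ.hasCompactSupport.fderiv (𝕜 := ℝ)).comp_left (g := fun L : Eucl N →L[ℝ] ℝ => L e) rfl)

theorem integral_mul_fderiv (hφ : IsTest φ) (hψ : IsTest ψ) (e : Eucl N) :
    ∫ x, ψ x * fderiv ℝ φ x e = -∫ x, fderiv ℝ ψ x e * φ x :=
  integral_mul_fderiv_eq_neg_fderiv_mul_of_integrable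
    ((hψ.memLp_fderiv_apply e 2).integrable_mul (hφ.memLp 2))
    ((hψ.memLp 2).integrable_mul (hφ.memLp_fderiv_apply e 2))
    ((hψ.memLp 2).integrable_mul (hφ.memLp 2))
    (fun x _ => hψ.differentiable x) fun x _ => hφ.differentiable x

end IsTest

end TestFunctions

section Space

variable {N : ℕ} [hN : Fact (3 ≤ N)]

/-- A test function as an element of `𝒟^{1,2}(ℝ^N)`. -/
def ofTest {φ : Eucl N → ℝ} (hφ : IsTest φ) : D12 N :=
  ⟨(MemLp.toLp φ (hφ.memLp (critE N)), MemLp.toLp (gradient φ) (hφ.memLp_gradient 2)),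
    subset_closure ⟨φ, hφ.smooth, hφ.hasCompactSupport, MemLp.coeFn_toLp (hφ.memLp (critE N)),
      MemLp.coeFn_toLp (hφ.memLp_gradient 2)⟩⟩

theorem ofTest_fn {φ : Eucl N → ℝ} (hφ : IsTest φ) : (ofTest hφ).fn =ᵐ[volume] φ :=
  MemLp.coeFn_toLp (hφ.memLp (critE N))

theorem ofTest_grad {φ : Eucl N → ℝ} (hφ : IsTest φ) :
    (ofTest hφ).grad =ᵐ[volume] gradient φ :=
  MemLp.coeFn_toLp (hφ.memLp_gradient 2)

variable (N) in
/-- The underlying function, as a continuous linear map into `L^{2^*}`. -/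
def fnL : D12 N →L[ℝ] Lp ℝ (critE N) (volume : Measure (Eucl N)) :=
  LinearMap.mkContinuousOfExistsBound
    { toFun := fun u => u.fn, map_add' := fun _ _ => rfl, map_smul' := fun _ _ => rfl }
    (exists_sobolev N)

@[simp]
theorem fnL_apply (u : D12 N) : fnL N u = u.fn := rfl

variable (N) in
/-- The gradient, as an isometric embedding into `L^2`. -/
def gradLI : D12 N →ₗᵢ[ℝ] Lp (Eucl N) 2 (volume : Measure (Eucl N)) := ⟨gradL N, fun _ => rfl⟩

theorem continuous_fn : Continuous (D12.fn : D12 N → _) := (fnL N).continuous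

theorem continuous_grad : Continuous (D12.grad : D12 N → _) := (gradLI N).continuous

theorem fn_add_ae (u v : D12 N) : (u + v).fn =ᵐ[volume] fun x => u.fn x + v.fn x :=
  Lp.coeFn_add u.fn v.fn

theorem fn_sub_ae (u v : D12 N) : (u - v).fn =ᵐ[volume] fun x => u.fn x - v.fn x :=
  Lp.coeFn_sub u.fn v.fn

theorem fn_smul_ae (c : ℝ) (u : D12 N) : (c • u).fn =ᵐ[volume] fun x => c * u.fn x :=
  Lp.coeFn_smul c u.fn

theorem aestronglyMeasurable_fn (u : D12 N) : AEStronglyMeasurable u.fn volume :=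
  Lp.aestronglyMeasurable _

theorem D12.induction_on_test {P : D12 N → Prop} (hclosed : IsClosed {u | P u})
    (htest : ∀ (φ : Eucl N → ℝ) (hφ : IsTest φ), P (ofTest hφ)) (u : D12 N) : P u := by
  obtain ⟨v, hv, hlim⟩ := mem_closure_iff_seq_limit.1 (show u.1 ∈ closure (testGraph N : Set _)
    from u.2)
  let w : ℕ → D12 N := fun n => ⟨v n, subset_closure (hv n)⟩
  have hw : Tendsto w atTop (𝓝 u) :=
    (gradLI N).isometry.isEmbedding.tendsto_nhds_iff.2 ((continuous_snd.tendsto _).comp hlim)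
  refine hclosed.mem_of_tendsto hw (Eventually.of_forall fun n => ?_)
  obtain ⟨φ, hsmooth, hcompact, hfn, hgrad⟩ := hv n
  have hφ : IsTest φ := ⟨hsmooth, hcompact⟩
  have hwn : w n = ofTest hφ := Subtype.ext (Prod.ext
    (Lp.ext (hfn.trans (ofTest_fn hφ).symm)) (Lp.ext (hgrad.trans (ofTest_grad hφ).symm)))
  rw [Set.mem_ofPred_eq, hwn]
  exact htest φ hφ

instance : InnerProductSpace ℝ (D12 N) where
  inner u v := inner ℝ u.grad v.grad
  norm_sq_eq_re_inner u := norm_sq_eq_re_inner (𝕜 := ℝ) u.grad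
  conj_inner_symm u v := inner_conj_symm u.grad v.grad
  add_left u v w := inner_add_left u.grad v.grad w.grad
  smul_left u v r := inner_smul_left u.grad v.grad r

instance : CompleteSpace (D12 N) := by
  refine Metric.complete_of_cauchySeq_tendsto fun v hv => ?_
  have hfn : CauchySeq fun n => (v n).fn := hv.map (fnL N).uniformContinuous
  have hgrad : CauchySeq fun n => (v n).grad := hv.map (gradLI N).isometry.uniformContinuous
  obtain ⟨f, hf⟩ := cauchySeq_tendsto_of_complete hfn
  obtain ⟨g, hg⟩ := cauchySeq_tendsto_of_complete hgrad
  have hmem : (f, g) ∈ d12Sub N :=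
    (Submodule.isClosed_topologicalClosure (testGraph N)).mem_of_tendsto (hf.prodMk_nhds hg)
      (Eventually.of_forall fun n => (v n).2)
  exact ⟨⟨(f, g), hmem⟩, (gradLI N).isometry.isEmbedding.tendsto_nhds_iff.2 hg⟩

instance : SecondCountableTopology (D12 N) :=
  haveI : Fact ((2 : ℝ≥0∞) ≠ ⊤) := ⟨ENNReal.ofNat_ne_top⟩
  (gradLI N).isometry.isEmbedding.toIsInducing.secondCountableTopology

theorem dirichlet_eq (u : D12 N) : dirichlet u = ‖u‖ ^ 2 := by
  change dirichlet u = ‖u.grad‖ ^ 2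
  rw [← real_inner_self_eq_norm_sq, L2.inner_def]
  simp only [dirichlet, real_inner_self_eq_norm_sq]

theorem ofTest_norm_sq {φ : Eucl N → ℝ} (hφ : IsTest φ) :
    ‖ofTest hφ‖ ^ 2 = ∫ x, ‖gradient φ x‖ ^ 2 := by
  rw [← dirichlet_eq]
  refine integral_congr_ae ?_
  filter_upwards [ofTest_grad hφ] with x hx
  rw [hx]

theorem integrable_abs_fn_rpow_crit (u : D12 N) : Integrable (fun x => |u.fn x| ^ crit N) := by
  simpa only [critE_toReal] using integrable_Lp_abs_rpow (critE_ne_zero N) (critE_ne_top N) u.fn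

theorem critTerm_eq (u : D12 N) : critTerm u = ‖u.fn‖ ^ crit N := by
  rw [← critE_toReal, Lp_norm_rpow_toReal (critE_ne_zero N) (critE_ne_top N), critE_toReal]
  rfl

theorem critTerm_rpow (u : D12 N) : critTerm u ^ (2 / crit N) = ‖u.fn‖ ^ 2 := by
  rw [critTerm_eq, ← Real.rpow_mul (norm_nonneg _), mul_div_cancel₀ _ (crit_pos N).ne',
    Real.rpow_two]

end Space

section WeakGradient

variable {N : ℕ} [hN : Fact (3 ≤ N)]

instance holderConjugate_critE : ENNReal.HolderConjugate (critE N) (1 - (critE N)⁻¹)⁻¹ :=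
  ENNReal.HolderConjugate.inv_one_sub_inv' (one_le_critE N).out

instance one_le_conj_critE : Fact (1 ≤ (1 - (critE N)⁻¹)⁻¹) := ⟨by simp⟩

/-- The functional `u ↦ ∫ g u` on `𝒟^{1,2}(ℝ^N)`, for `g` in the dual Lebesgue space. -/
def pairing {g : Eucl N → ℝ} (hg : MemLp g (1 - (critE N)⁻¹)⁻¹ volume) : D12 N →L[ℝ] ℝ :=
  ((ContinuousLinearMap.mul ℝ ℝ).lpPairing volume (1 - (critE N)⁻¹)⁻¹ (critE N)
    (hg.toLp g)).comp (fnL N)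

theorem pairing_apply {g : Eucl N → ℝ} (hg : MemLp g (1 - (critE N)⁻¹)⁻¹ volume) (u : D12 N) :
    pairing hg u = ∫ x, g x * u.fn x := by
  rw [pairing, ContinuousLinearMap.comp_apply, ContinuousLinearMap.lpPairing_eq_integral]
  refine integral_congr_ae ?_
  filter_upwards [hg.coeFn_toLp] with x hx
  rw [hx]
  rfl

theorem integral_test_mul_grad {ψ : Eucl N → ℝ} (hψ : IsTest ψ) (e : Eucl N) (u : D12 N) :
    ∫ x, ψ x * inner ℝ e (u.grad x) = -∫ x, fderiv ℝ ψ x e * u.fn x := by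
  have hψe : MemLp (fun x => ψ x • e) 2 (volume : Measure (Eucl N)) :=
    (hψ.continuous.smul continuous_const).memLp_of_hasCompactSupport
      (hψ.hasCompactSupport.smul_right (f' := fun _ => e))
  have hleft (u : D12 N) :
      ∫ x, ψ x * inner ℝ e (u.grad x) = inner ℝ (hψe.toLp _) u.grad := by
    rw [L2.inner_def]
    refine integral_congr_ae ?_
    filter_upwards [hψe.coeFn_toLp] with x hx
    rw [hx, real_inner_smul_left]
  have hright := pairing_apply (hψ.memLp_fderiv_apply e (1 - (critE N)⁻¹)⁻¹)
  induction u using D12.induction_on_test with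
  | hclosed =>
    simp only [hleft, ← hright]
    exact isClosed_eq (continuous_const.inner continuous_grad) (by fun_prop)
  | htest φ hφ =>
    have hgrad : ∫ x, ψ x * inner ℝ e ((ofTest hφ).grad x) = ∫ x, ψ x * fderiv ℝ φ x e := by
      refine integral_congr_ae ?_
      filter_upwards [ofTest_grad hφ] with x hx
      rw [hx, real_inner_comm, inner_gradient_left]
    have hfn : ∫ x, fderiv ℝ ψ x e * (ofTest hφ).fn x = ∫ x, fderiv ℝ ψ x e * φ x := by
      refine integral_congr_ae ?_
      filter_upwards [ofTest_fn hφ] with x hx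
      rw [hx]
    rw [hgrad, hfn, hφ.integral_mul_fderiv hψ]

theorem eq_zero_of_fn_eq_zero {u : D12 N} (hu : u.fn = 0) : u = 0 := by
  have hloc : LocallyIntegrable (fun x => u.grad x) (volume : Measure (Eucl N)) :=
    (Lp.memLp u.grad).locallyIntegrable (by norm_num)
  have hfn : u.fn =ᵐ[volume] 0 := hu ▸ Lp.coeFn_zero ℝ (critE N) volume
  have hgrad : u.grad =ᵐ[volume] 0 := by
    refine ae_eq_zero_of_integral_contDiff_smul_eq_zero hloc fun ψ hsmooth hcompact => ?_
    have hψ : IsTest ψ := ⟨hsmooth, hcompact⟩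
    refine ext_inner_left ℝ fun e => ?_
    rw [← integral_inner (hloc.integrable_smul_left_of_hasCompactSupport hψ.continuous hcompact),
      inner_zero_right]
    simp only [real_inner_smul_right]
    rw [integral_test_mul_grad hψ, neg_eq_zero]
    refine integral_eq_zero_of_ae ?_
    filter_upwards [hfn] with x hx
    rw [hx, Pi.zero_apply, mul_zero]
  exact (gradLI N).injective ((Lp.eq_zero_iff_ae_eq_zero.2 hgrad).trans (map_zero (gradLI N)).symm)

end WeakGradient

theorem lintegral_le_of_tendsto_ae {α : Type*} [MeasurableSpace α] {μ : Measure α}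
    {F : ℕ → α → ℝ≥0∞} {f : α → ℝ≥0∞} {b : ℕ → ℝ≥0∞} {B : ℝ≥0∞} (hF : ∀ n, AEMeasurable (F n) μ)
    (hf : ∀ᵐ x ∂μ, Tendsto (fun n => F n x) atTop (𝓝 (f x))) (hb : Tendsto b atTop (𝓝 B))
    (hFb : ∀ n, ∫⁻ x, F n x ∂μ ≤ b n) : ∫⁻ x, f x ∂μ ≤ B :=
  calc ∫⁻ x, f x ∂μ = ∫⁻ x, liminf (fun n => F n x) atTop ∂μ :=
        lintegral_congr_ae (hf.mono fun _ hx => hx.liminf_eq.symm)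
    _ ≤ liminf (fun n => ∫⁻ x, F n x ∂μ) atTop := lintegral_liminf_le' hF
    _ ≤ liminf b atTop := liminf_le_liminf (Eventually.of_forall hFb)
    _ = B := hb.liminf_eq

section Divergence

variable {N : ℕ}

/-- The divergence of a vector field on `ℝ^N`. -/
def divergence (F : Eucl N → Eucl N) (x : Eucl N) : ℝ :=
  ∑ i, fderiv ℝ F x (EuclideanSpace.single i 1) i

theorem sum_smul_single (x : Eucl N) : ∑ i, x i • EuclideanSpace.single i (1 : ℝ) = x := by
  simpa using (EuclideanSpace.basisFun (Fin N) ℝ).sum_repr x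

theorem divergence_smul_sub {w : Eucl N → ℝ} {a x : Eucl N} (hw : DifferentiableAt ℝ w x) :
    divergence (fun y => w y • (y - a)) x = N * w x + fderiv ℝ w x (x - a) := by
  have hderiv : HasFDerivAt (fun y => w y • (y - a))
      (w x • ContinuousLinearMap.id ℝ _ + (fderiv ℝ w x).smulRight (x - a)) x :=
    hw.hasFDerivAt.smul ((hasFDerivAt_id x).sub_const a)
  have hsum : fderiv ℝ w x (x - a) =
      ∑ i, (x - a) i * fderiv ℝ w x (EuclideanSpace.single i 1) := by
    conv_lhs => rw [← sum_smul_single (x - a), map_sum]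
    simp only [map_smul, smul_eq_mul]
  rw [divergence, hderiv.fderiv, hsum]
  simp [Finset.sum_add_distrib, mul_comm]

theorem integral_fderiv_apply {F : Eucl N → Eucl N} {ψ : Eucl N → ℝ} (hF : ContDiff ℝ 1 F)
    (hψ : IsTest ψ) : ∫ x, fderiv ℝ ψ x (F x) = -∫ x, divergence F x * ψ x := by
  let e (i : Fin N) : Eucl N := EuclideanSpace.single i 1
  have hcoord (i : Fin N) (x v : Eucl N) : fderiv ℝ (fun y => F y i) x v = fderiv ℝ F x v i := by
    have := (EuclideanSpace.proj i : Eucl N →L[ℝ] ℝ).hasFDerivAt.comp x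
      (hF.differentiable one_ne_zero x).hasFDerivAt
    exact congrArg (· v) this.fderiv
  have cF := hF.continuous
  have cψ := hψ.continuous
  have cdψ := hψ.continuous_fderiv
  have iF (i : Fin N) : Integrable fun x => fderiv ℝ F x (e i) i * ψ x :=
    Continuous.integrable_of_hasCompactSupport (by fun_prop) hψ.hasCompactSupport.mul_left
  have iψ (i : Fin N) : Integrable fun x => F x i * fderiv ℝ ψ x (e i) :=
    Continuous.integrable_of_hasCompactSupport (by fun_prop)
      (((hψ.hasCompactSupport.fderiv (𝕜 := ℝ)).comp_left
        (g := fun L : Eucl N →L[ℝ] ℝ => L (e i)) rfl).mul_left)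
  have hparts (i : Fin N) : ∫ x, F x i * fderiv ℝ ψ x (e i) =
      -∫ x, fderiv ℝ F x (e i) i * ψ x := by
    simp only [← hcoord]
    refine integral_mul_fderiv_eq_neg_fderiv_mul_of_integrable
      (by simpa only [hcoord] using iF i) (iψ i) ?_ (fun x _ => ?_) fun x _ => hψ.differentiable x
    · exact Continuous.integrable_of_hasCompactSupport (by fun_prop) hψ.hasCompactSupport.mul_left
    · exact (EuclideanSpace.proj i : Eucl N →L[ℝ] ℝ).differentiableAt.comp x
        (hF.differentiable one_ne_zero x)
  calc ∫ x, fderiv ℝ ψ x (F x) = ∫ x, ∑ i, F x i * fderiv ℝ ψ x (e i) := by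
        congr 1 with x
        conv_lhs => rw [← sum_smul_single (F x), map_sum]
        simp only [map_smul, smul_eq_mul, e]
    _ = -∫ x, ∑ i, fderiv ℝ F x (e i) i * ψ x := by
        rw [integral_finsetSum _ fun i _ => iψ i, integral_finsetSum _ fun i _ => iF i,
          ← Finset.sum_neg_distrib]
        exact Finset.sum_congr rfl fun i _ => hparts i
    _ = -∫ x, divergence F x * ψ x := by simp only [divergence, Finset.sum_mul, e]

/-- Integrate `0 ≤ |∇φ + φ F|²`. -/
theorem integral_divergence_sub_sq_mul_le {F : Eucl N → Eucl N} {φ : Eucl N → ℝ}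
    (hF : ContDiff ℝ 1 F) (hφ : IsTest φ) :
    ∫ x, (divergence F x - ‖F x‖ ^ 2) * φ x ^ 2 ≤ ∫ x, ‖gradient φ x‖ ^ 2 := by
  have hsq : IsTest fun x => φ x * φ x := hφ.mul_smooth hφ.smooth
  have hdsq (x v : Eucl N) :
      fderiv ℝ (fun x => φ x * φ x) x v = 2 * φ x * inner ℝ (gradient φ x) v := by
    rw [fderiv_fun_mul (hφ.differentiable x) (hφ.differentiable x), inner_gradient_left]
    simp only [add_apply, smul_apply, smul_eq_mul]
    ring
  have cF : Continuous F := hF.continuous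
  have cφ := hφ.continuous
  have cgrad := hφ.continuous_gradient
  have cdiv : Continuous (divergence F) := by unfold divergence; fun_prop
  have iF : Integrable fun x => ‖F x‖ ^ 2 * (φ x * φ x) :=
    Continuous.integrable_of_hasCompactSupport (by fun_prop) hsq.hasCompactSupport.mul_left
  have idiv : Integrable fun x => divergence F x * (φ x * φ x) :=
    Continuous.integrable_of_hasCompactSupport (by fun_prop) hsq.hasCompactSupport.mul_left
  have idsq : Integrable fun x => fderiv ℝ (fun x => φ x * φ x) x (F x) := by
    simp only [hdsq]
    exact Continuous.integrable_of_hasCompactSupport (by fun_prop)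
      (hφ.hasCompactSupport.mul_left.mul_right)
  have igrad : Integrable fun x => ‖gradient φ x‖ ^ 2 := (hφ.memLp_gradient 2).integrable_norm_pow
    two_ne_zero
  calc ∫ x, (divergence F x - ‖F x‖ ^ 2) * φ x ^ 2
      = ∫ x, (-fderiv ℝ (fun x => φ x * φ x) x (F x) - ‖F x‖ ^ 2 * (φ x * φ x)) := by
        rw [integral_sub (f := fun x => -fderiv ℝ (fun x => φ x * φ x) x (F x)) idsq.neg iF,
          integral_neg, integral_fderiv_apply hF hsq, neg_neg, ← integral_sub idiv iF]
        simp only [sub_mul, sq]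
    _ ≤ ∫ x, ‖gradient φ x‖ ^ 2 := by
        refine integral_mono (idsq.neg.sub iF) igrad fun x => ?_
        have hnonneg := sq_nonneg ‖gradient φ x + φ x • F x‖
        rw [norm_add_sq_real, norm_smul, mul_pow, Real.norm_eq_abs, sq_abs,
          real_inner_smul_right] at hnonneg
        change -fderiv ℝ (fun x => φ x * φ x) x (F x) - ‖F x‖ ^ 2 * (φ x * φ x) ≤ _
        rw [hdsq]
        linarith

end Divergence

section Hardy

variable {N : ℕ}

theorem contDiff_inv_norm_sub_sq_add (a : Eucl N) {ε : ℝ} (hε : 0 < ε) :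
    ContDiff ℝ 1 fun x : Eucl N => (‖x - a‖ ^ 2 + ε)⁻¹ :=
  (((contDiff_id.sub contDiff_const).norm_sq ℝ).add contDiff_const).inv fun x =>
    (add_pos_of_nonneg_of_pos (sq_nonneg ‖x - a‖) hε).ne'

theorem fderiv_inv_norm_sub_sq_add (a : Eucl N) {ε : ℝ} (hε : 0 < ε) (x : Eucl N) :
    fderiv ℝ (fun x => (‖x - a‖ ^ 2 + ε)⁻¹) x (x - a) =
      -2 * ‖x - a‖ ^ 2 * (‖x - a‖ ^ 2 + ε)⁻¹ ^ 2 := by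
  have hpos : ‖x - a‖ ^ 2 + ε ≠ 0 := (add_pos_of_nonneg_of_pos (sq_nonneg _) hε).ne'
  have hsq : HasFDerivAt (fun x => ‖x - a‖ ^ 2 + ε)
      (2 • (innerSL ℝ (x - a)).comp (ContinuousLinearMap.id ℝ _)) x :=
    (((hasFDerivAt_id x).sub_const a).norm_sq.add_const ε)
  have hinv := (hasDerivAt_inv hpos).comp_hasFDerivAt x hsq
  rw [show (fun x => (‖x - a‖ ^ 2 + ε)⁻¹) = Inv.inv ∘ fun x => ‖x - a‖ ^ 2 + ε from rfl,
    hinv.fderiv]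
  simp only [ContinuousLinearMap.comp_id, smul_apply, innerSL_apply_apply,
    real_inner_self_eq_norm_sq, nsmul_eq_mul, smul_eq_mul, Nat.cast_ofNat, inv_pow]
  ring

variable [hN : Fact (3 ≤ N)]

instance nontrivial_eucl : Nontrivial (Eucl N) :=
  have : Nontrivial (Fin N) := Fin.nontrivial_iff_two_le.2 (by have := hN.out; omega)
  inferInstance

/-- The vector field is `F = w (x - a) / 2`, for which `div F - |F|² ≥ w / 4` as `N ≥ 3`. -/
theorem hardy_regularized_test (a : Eucl N) {ε : ℝ} (hε : 0 < ε) {φ : Eucl N → ℝ}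
    (hφ : IsTest φ) : ∫ x, (‖x - a‖ ^ 2 + ε)⁻¹ * φ x ^ 2 ≤ 4 * ‖ofTest hφ‖ ^ 2 := by
  let w (x : Eucl N) : ℝ := (‖x - a‖ ^ 2 + ε)⁻¹
  let F (x : Eucl N) : Eucl N := (2⁻¹ * w x) • (x - a)
  have hw : ContDiff ℝ 1 w := contDiff_inv_norm_sub_sq_add a hε
  have hF : ContDiff ℝ 1 F := (contDiff_const.mul hw).smul (contDiff_id.sub contDiff_const)
  have hdiv (x : Eucl N) : divergence F x = N / 2 * w x - ‖x - a‖ ^ 2 * w x ^ 2 := by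
    have hwx := hw.differentiable one_ne_zero x
    rw [divergence_smul_sub (hwx.const_mul _), fderiv_const_mul hwx, smul_apply,
      fderiv_inv_norm_sub_sq_add a hε, smul_eq_mul]
    ring
  have hnorm (x : Eucl N) : ‖F x‖ ^ 2 = 4⁻¹ * (‖x - a‖ ^ 2 * w x ^ 2) := by
    rw [norm_smul, mul_pow, Real.norm_eq_abs, sq_abs]
    ring
  have hpoint (x : Eucl N) : w x ≤ 4 * (divergence F x - ‖F x‖ ^ 2) := by
    have hw0 : 0 ≤ w x := inv_nonneg.2 (by positivity)
    have hw1 : ‖x - a‖ ^ 2 * w x ≤ 1 := by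
      rw [← div_eq_mul_inv, div_le_one (by positivity)]
      linarith
    have hw2 := mul_le_mul_of_nonneg_right hw1 hw0
    have hNw := mul_le_mul_of_nonneg_right (three_le_cast N) hw0
    rw [hdiv, hnorm]
    linarith
  have cF := hF.continuous
  have cw := hw.continuous
  have cφ := hφ.continuous
  have cdiv : Continuous (divergence F) := by unfold divergence; fun_prop
  have hsupp : HasCompactSupport fun x => φ x ^ 2 :=
    hφ.hasCompactSupport.comp_left (g := (· ^ 2)) (zero_pow two_ne_zero)
  calc ∫ x, w x * φ x ^ 2 ≤ ∫ x, 4 * ((divergence F x - ‖F x‖ ^ 2) * φ x ^ 2) := by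
        refine integral_mono
          (Continuous.integrable_of_hasCompactSupport (by fun_prop) hsupp.mul_left)
          (Continuous.integrable_of_hasCompactSupport (by fun_prop) hsupp.mul_left.mul_left)
          fun x => ?_
        have := mul_le_mul_of_nonneg_right (hpoint x) (sq_nonneg (φ x))
        linarith
    _ ≤ 4 * ‖ofTest hφ‖ ^ 2 := by
        rw [integral_const_mul, ofTest_norm_sq]
        exact mul_le_mul_of_nonneg_left (integral_divergence_sub_sq_mul_le hF hφ) zero_le_four

theorem hardy_test (a : Eucl N) {φ : Eucl N → ℝ} (hφ : IsTest φ) :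
    ∫⁻ x, ‖(‖x - a‖ ^ 2)⁻¹‖ₑ * ‖φ x‖ₑ ^ 2 ≤ 4 * ‖ofTest hφ‖ₑ ^ 2 := by
  let ε (n : ℕ) : ℝ := 1 / ((n : ℝ) + 1)
  have hε (n : ℕ) : 0 < ε n := Nat.one_div_pos_of_nat
  have cw (n : ℕ) := (contDiff_inv_norm_sub_sq_add a (hε n)).continuous
  have cφ := hφ.continuous
  refine lintegral_le_of_tendsto_ae (F := fun n x => ‖(‖x - a‖ ^ 2 + ε n)⁻¹‖ₑ * ‖φ x‖ₑ ^ 2)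
    (fun n => ((cw n).enorm.measurable.mul (cφ.enorm.measurable.pow_const 2)).aemeasurable)
    ?_ tendsto_const_nhds fun n => ?_
  · filter_upwards [compl_mem_ae_iff.2 (measure_singleton a)] with x hx
    have hxa : ‖x - a‖ ^ 2 ≠ 0 := pow_ne_zero 2 (norm_ne_zero_iff.2 (sub_ne_zero.2 hx))
    have hlim : Tendsto (fun n => ‖x - a‖ ^ 2 + ε n) atTop (𝓝 (‖x - a‖ ^ 2)) := by
      simpa only [add_zero] using
        tendsto_one_div_add_atTop_nhds_zero_nat.const_add (‖x - a‖ ^ 2)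
    exact ENNReal.Tendsto.mul_const (hlim.inv₀ hxa).enorm (Or.inr (by finiteness))
  · have hinteg : Integrable fun x => (‖x - a‖ ^ 2 + ε n)⁻¹ * φ x ^ 2 := by
      have := cw n
      exact Continuous.integrable_of_hasCompactSupport (by fun_prop)
        (hφ.hasCompactSupport.comp_left (g := (· ^ 2)) (zero_pow two_ne_zero)).mul_left
    have hnonneg (x : Eucl N) : 0 ≤ (‖x - a‖ ^ 2 + ε n)⁻¹ * φ x ^ 2 := by
      have := hε n
      positivity
    calc ∫⁻ x, ‖(‖x - a‖ ^ 2 + ε n)⁻¹‖ₑ * ‖φ x‖ₑ ^ 2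
        = ENNReal.ofReal (∫ x, (‖x - a‖ ^ 2 + ε n)⁻¹ * φ x ^ 2) := by
          rw [ofReal_integral_eq_lintegral_ofReal hinteg (Eventually.of_forall hnonneg)]
          simp only [← Real.enorm_of_nonneg (hnonneg _), enorm_mul, enorm_pow]
      _ ≤ ENNReal.ofReal (4 * ‖ofTest hφ‖ ^ 2) :=
          ENNReal.ofReal_le_ofReal (hardy_regularized_test a (hε n) hφ)
      _ = 4 * ‖ofTest hφ‖ₑ ^ 2 := by
          rw [ENNReal.ofReal_mul zero_le_four, ENNReal.ofReal_pow (norm_nonneg _),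
            ofReal_norm, ENNReal.ofReal_ofNat]

theorem lintegral_mul_sq_le_of_test {W : Eucl N → ℝ≥0∞} (hW : AEMeasurable W) {C : ℝ≥0}
    (htest : ∀ (φ : Eucl N → ℝ) (hφ : IsTest φ),
      ∫⁻ x, W x * ‖φ x‖ₑ ^ 2 ≤ C * ‖ofTest hφ‖ₑ ^ 2) (hW' : ∀ᵐ x, W x ≠ ⊤)
    (u : D12 N) : ∫⁻ x, W x * ‖u.fn x‖ₑ ^ 2 ≤ C * ‖u‖ₑ ^ 2 := by
  induction u using D12.induction_on_test with
  | hclosed =>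
    refine IsSeqClosed.isClosed fun v u hv hlim => ?_
    obtain ⟨s, hs, hae⟩ := (tendstoInMeasure_of_tendsto_Lp
      ((continuous_fn.tendsto u).comp hlim)).exists_seq_tendsto_ae
    refine lintegral_le_of_tendsto_ae (F := fun n x => W x * ‖(v (s n)).fn x‖ₑ ^ 2)
      (b := fun n => C * ‖v (s n)‖ₑ ^ 2)
      (fun n => hW.mul ((aestronglyMeasurable_fn _).enorm.pow_const 2)) ?_ ?_ fun n => hv (s n)
    · filter_upwards [hae, hW'] with x hx hWx
      exact ENNReal.Tendsto.const_mul (ENNReal.Tendsto.pow hx.enorm) (Or.inr hWx)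
    · exact ENNReal.Tendsto.const_mul (ENNReal.Tendsto.pow (hlim.comp hs.tendsto_atTop).enorm)
        (Or.inr ENNReal.coe_ne_top)
  | htest φ hφ =>
    refine (lintegral_congr_ae ?_).trans_le (htest φ hφ)
    filter_upwards [ofTest_fn hφ] with x hx
    rw [hx]

end Hardy

section HardyPot

variable {N : ℕ} [hN : Fact (3 ≤ N)]

/-- A potential `V` whose quadratic form `∫ V u²` is bounded on `𝒟^{1,2}(ℝ^N)`. -/
structure HardyPot (V : Eucl N → ℝ) : Prop where
  aestronglyMeasurable : AEStronglyMeasurable V volume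
  exists_lintegral_le : ∃ C : ℝ≥0, ∀ u : D12 N,
    ∫⁻ x, ‖V x‖ₑ * ‖u.fn x‖ₑ ^ 2 ≤ C * ‖u‖ₑ ^ 2

/-- The quadratic form `∫ V u²`. -/
def potTerm (V : Eucl N → ℝ) (u : D12 N) : ℝ := ∫ x, V x * u.fn x ^ 2

theorem hardyPot_inv_sq (a : Eucl N) : HardyPot (fun x : Eucl N => (‖x - a‖ ^ 2)⁻¹) where
  aestronglyMeasurable := Measurable.aestronglyMeasurable (by fun_prop)
  exists_lintegral_le := ⟨4, fun u => lintegral_mul_sq_le_of_test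
    (Measurable.aemeasurable (by fun_prop)) (fun _ hφ => hardy_test a hφ)
    (Eventually.of_forall fun _ => enorm_ne_top) u⟩

namespace HardyPot

variable {V W : Eucl N → ℝ}

theorem mono (hW : HardyPot W) (hV : AEStronglyMeasurable V volume) {M : ℝ}
    (hVW : ∀ᵐ x, |V x| ≤ M * |W x|) : HardyPot V := by
  obtain ⟨C, hC⟩ := hW.exists_lintegral_le
  refine ⟨hV, ‖M‖₊ * C, fun u => ?_⟩
  calc ∫⁻ x, ‖V x‖ₑ * ‖u.fn x‖ₑ ^ 2
      ≤ ∫⁻ x, ‖M‖ₑ * (‖W x‖ₑ * ‖u.fn x‖ₑ ^ 2) := by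
        refine lintegral_mono_ae ?_
        filter_upwards [hVW] with x hx
        rw [← mul_assoc, ← enorm_mul]
        gcongr
        rw [enorm_le_iff_norm_le, norm_mul]
        exact hx.trans (mul_le_mul_of_nonneg_right (le_abs_self M) (abs_nonneg _))
    _ = ‖M‖ₑ * ∫⁻ x, ‖W x‖ₑ * ‖u.fn x‖ₑ ^ 2 := lintegral_const_mul' _ _ enorm_ne_top
    _ ≤ ‖M‖ₑ * (C * ‖u‖ₑ ^ 2) := by gcongr; exact hC u
    _ = _ := by rw [← mul_assoc, enorm_eq_nnnorm M, ENNReal.coe_mul]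

theorem add (hV : HardyPot V) (hW : HardyPot W) : HardyPot (fun x => V x + W x) := by
  obtain ⟨C, hC⟩ := hV.exists_lintegral_le
  obtain ⟨D, hD⟩ := hW.exists_lintegral_le
  refine ⟨hV.aestronglyMeasurable.add hW.aestronglyMeasurable, C + D, fun u => ?_⟩
  calc ∫⁻ x, ‖V x + W x‖ₑ * ‖u.fn x‖ₑ ^ 2
      ≤ ∫⁻ x, (‖V x‖ₑ * ‖u.fn x‖ₑ ^ 2 + ‖W x‖ₑ * ‖u.fn x‖ₑ ^ 2) := by
        simp only [← add_mul]
        gcongr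
        exact enorm_add_le _ _
    _ = (∫⁻ x, ‖V x‖ₑ * ‖u.fn x‖ₑ ^ 2) + ∫⁻ x, ‖W x‖ₑ * ‖u.fn x‖ₑ ^ 2 :=
        lintegral_add_left' (hV.aestronglyMeasurable.enorm.mul
          ((aestronglyMeasurable_fn u).enorm.pow_const 2)) _
    _ ≤ C * ‖u‖ₑ ^ 2 + D * ‖u‖ₑ ^ 2 := add_le_add (hC u) (hD u)
    _ = _ := by rw [ENNReal.coe_add, add_mul]

theorem zero : HardyPot (fun _ : Eucl N => (0 : ℝ)) :=
  ⟨aestronglyMeasurable_const, 0, fun u => by simp⟩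

theorem sum {ι : Type*} (s : Finset ι) {V : ι → Eucl N → ℝ} (hV : ∀ i ∈ s, HardyPot (V i)) :
    HardyPot (fun x => ∑ i ∈ s, V i x) := by
  classical
  induction s using Finset.induction_on with
  | empty => simpa using zero
  | insert i s hi ih =>
    simp only [Finset.sum_insert hi]
    exact (hV i (Finset.mem_insert_self i s)).add
      (ih fun j hj => hV j (Finset.mem_insert_of_mem hj))

theorem indicator (hV : HardyPot V) {s : Set (Eucl N)} (hs : MeasurableSet s) :
    HardyPot (s.indicator V) :=
  hV.mono (hV.aestronglyMeasurable.indicator hs) (M := 1) (Eventually.of_forall fun x => by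
    rw [one_mul]
    exact norm_indicator_le_norm_self V x)

theorem lintegral_enorm_mul_le (hV : AEStronglyMeasurable V volume) {C : ℝ≥0}
    (hC : ∀ u : D12 N, ∫⁻ x, ‖V x‖ₑ * ‖u.fn x‖ₑ ^ 2 ≤ C * ‖u‖ₑ ^ 2) (u v : D12 N) :
    ∫⁻ x, ‖V x * (u.fn x * v.fn x)‖ₑ ≤ C * ‖u‖ₑ * ‖v‖ₑ := by
  have hsqrt (t : ℝ≥0∞) : (t ^ (1 / 2 : ℝ)) ^ 2 = t := by
    rw [← ENNReal.rpow_two, ← ENNReal.rpow_mul]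
    norm_num
  have hsq (t : ℝ≥0∞) : (t ^ 2) ^ (1 / 2 : ℝ) = t := by
    rw [← ENNReal.rpow_two, ← ENNReal.rpow_mul]
    norm_num
  have hmeas (u : D12 N) : AEMeasurable (fun x => ‖V x‖ₑ ^ (1 / 2 : ℝ) * ‖u.fn x‖ₑ) :=
    (hV.enorm.pow_const _).mul (aestronglyMeasurable_fn u).enorm
  have hbound (u : D12 N) : (∫⁻ x, (‖V x‖ₑ ^ (1 / 2 : ℝ) * ‖u.fn x‖ₑ) ^ (2 : ℝ)) ^ (1 / 2 : ℝ) ≤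
      (C : ℝ≥0∞) ^ (1 / 2 : ℝ) * ‖u‖ₑ := by
    simp only [ENNReal.rpow_two, mul_pow, hsqrt]
    refine (ENNReal.rpow_le_rpow (hC u) (by norm_num)).trans_eq ?_
    rw [ENNReal.mul_rpow_of_nonneg _ _ (by norm_num), hsq]
  calc ∫⁻ x, ‖V x * (u.fn x * v.fn x)‖ₑ
      = ∫⁻ x, ‖V x‖ₑ ^ (1 / 2 : ℝ) * ‖u.fn x‖ₑ * (‖V x‖ₑ ^ (1 / 2 : ℝ) * ‖v.fn x‖ₑ) := by
        congr 1 with x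
        rw [mul_mul_mul_comm, ← sq, hsqrt, enorm_mul, enorm_mul]
    _ ≤ _ := ENNReal.lintegral_mul_le_Lp_mul_Lq _ Real.HolderConjugate.two_two (hmeas u) (hmeas v)
    _ ≤ (C : ℝ≥0∞) ^ (1 / 2 : ℝ) * ‖u‖ₑ * ((C : ℝ≥0∞) ^ (1 / 2 : ℝ) * ‖v‖ₑ) :=
        mul_le_mul' (hbound u) (hbound v)
    _ = C * ‖u‖ₑ * ‖v‖ₑ := by rw [mul_mul_mul_comm, ← sq, hsqrt, mul_assoc]

theorem integrable_mul (hV : HardyPot V) (u v : D12 N) :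
    Integrable (fun x => V x * (u.fn x * v.fn x)) := by
  obtain ⟨C, hC⟩ := hV.exists_lintegral_le
  refine ⟨hV.aestronglyMeasurable.mul
    ((aestronglyMeasurable_fn u).mul (aestronglyMeasurable_fn v)), ?_⟩
  refine (lintegral_enorm_mul_le hV.aestronglyMeasurable hC u v).trans_lt ?_
  finiteness

theorem integrable_mul_sq (hV : HardyPot V) (u : D12 N) :
    Integrable (fun x => V x * u.fn x ^ 2) := by
  simpa only [sq] using hV.integrable_mul u u

/-- The symmetric bilinear form `∫ V u v`. -/
def bilin (hV : HardyPot V) : D12 N →L[ℝ] D12 N →L[ℝ] ℝ :=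
  LinearMap.mkContinuous₂
    (LinearMap.mk₂ ℝ (fun u v => ∫ x, V x * (u.fn x * v.fn x))
      (fun u u' v => by
        rw [← integral_add (hV.integrable_mul u v) (hV.integrable_mul u' v)]
        refine integral_congr_ae ?_
        filter_upwards [fn_add_ae u u'] with x hx
        rw [hx]
        ring)
      (fun c u v => by
        rw [smul_eq_mul, ← integral_const_mul]
        refine integral_congr_ae ?_
        filter_upwards [fn_smul_ae c u] with x hx
        rw [hx]
        ring)
      (fun u v v' => by
        rw [← integral_add (hV.integrable_mul u v) (hV.integrable_mul u v')]
        refine integral_congr_ae ?_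
        filter_upwards [fn_add_ae v v'] with x hx
        rw [hx]
        ring)
      (fun c u v => by
        rw [smul_eq_mul, ← integral_const_mul]
        refine integral_congr_ae ?_
        filter_upwards [fn_smul_ae c v] with x hx
        rw [hx]
        ring))
    hV.exists_lintegral_le.choose fun u v => by
      have h := (enorm_integral_le_lintegral_enorm _).trans
        (lintegral_enorm_mul_le hV.aestronglyMeasurable hV.exists_lintegral_le.choose_spec u v)
      simpa only [toReal_enorm, ENNReal.toReal_mul, ENNReal.coe_toReal, LinearMap.mk₂_apply]
        using ENNReal.toReal_mono (by finiteness) h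

theorem bilin_apply (hV : HardyPot V) (u v : D12 N) :
    hV.bilin u v = ∫ x, V x * (u.fn x * v.fn x) := rfl

theorem bilin_self (hV : HardyPot V) (u : D12 N) : hV.bilin u u = potTerm V u := by
  simp only [bilin_apply, potTerm, sq]

theorem continuous_potTerm (hV : HardyPot V) : Continuous (potTerm V) := by
  simp only [funext fun u => (hV.bilin_self u).symm]
  fun_prop

theorem exists_abs_potTerm_le (hV : HardyPot V) :
    ∃ C : ℝ, 0 ≤ C ∧ ∀ u : D12 N, |potTerm V u| ≤ C * ‖u‖ ^ 2 :=
  ⟨‖hV.bilin‖, hV.bilin.opNorm_nonneg, fun u => by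
    rw [← hV.bilin_self, sq, ← mul_assoc]
    exact hV.bilin.le_opNorm₂ u u⟩

end HardyPot

theorem potTerm_sum {ι : Type*} (s : Finset ι) {V : ι → Eucl N → ℝ}
    (hV : ∀ i ∈ s, HardyPot (V i)) (u : D12 N) :
    potTerm (fun x => ∑ i ∈ s, V i x) u = ∑ i ∈ s, potTerm (V i) u := by
  simp only [potTerm, Finset.sum_mul]
  exact integral_finsetSum _ fun i hi => (hV i hi).integrable_mul_sq u

end HardyPot

section Angular

variable {N : ℕ} {h : Sph N → ℝ}

theorem inv_norm_smul_mem_sphere {x : Eucl N} (hx : x ≠ 0) :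
    ‖x‖⁻¹ • x ∈ sphere (0 : Eucl N) 1 := by
  rw [mem_sphere_zero_iff_norm, norm_smul, norm_inv, norm_norm,
    inv_mul_cancel₀ (norm_ne_zero_iff.2 hx)]

theorem angular_of_ne {x : Eucl N} (hx : x ≠ 0) :
    angular h x = h ⟨‖x‖⁻¹ • x, inv_norm_smul_mem_sphere hx⟩ := dif_neg hx

@[simp]
theorem angular_zero : angular h 0 = 0 := dif_pos rfl

theorem angular_smul {t : ℝ} (ht : 0 < t) (x : Eucl N) : angular h (t • x) = angular h x := by
  obtain rfl | hx := eq_or_ne x 0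
  · rw [smul_zero]
  · rw [angular_of_ne hx, angular_of_ne (smul_ne_zero ht.ne' hx)]
    congr 2
    rw [norm_smul, Real.norm_of_nonneg ht.le, smul_smul, mul_inv_rev, mul_assoc,
      inv_mul_cancel₀ ht.ne', mul_one]

theorem angular_sum {ι : Type*} (s : Finset ι) (h : ι → Sph N → ℝ) (x : Eucl N) :
    angular (∑ i ∈ s, h i) x = ∑ i ∈ s, angular (h i) x := by
  obtain rfl | hx := eq_or_ne x 0
  · simp only [angular_zero, Finset.sum_const_zero]
  · simp only [angular_of_ne hx, Finset.sum_apply]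

variable (hc : Continuous h)
include hc

theorem continuousOn_angular : ContinuousOn (angular h) {0}ᶜ := by
  rw [continuousOn_iff_continuous_domRestrict]
  refine (hc.comp (Continuous.subtype_mk ?_ fun x : ({0}ᶜ : Set (Eucl N)) =>
    inv_norm_smul_mem_sphere x.2)).congr fun x => (angular_of_ne x.2).symm
  exact (continuous_subtype_val.norm.inv₀ fun x => norm_ne_zero_iff.2 x.2).smul
    continuous_subtype_val

theorem measurable_angular : Measurable (angular h) :=
  measurable_of_continuousOn_compl_singleton 0 (continuousOn_angular hc)

theorem exists_abs_angular_le : ∃ M : ℝ, 0 ≤ M ∧ ∀ x, |angular h x| ≤ M := by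
  obtain ⟨C, hC⟩ := isCompact_univ.exists_bound_of_continuousOn hc.continuousOn
  refine ⟨|C|, abs_nonneg C, fun x => ?_⟩
  obtain rfl | hx := eq_or_ne x 0
  · simp only [angular_zero, abs_zero, abs_nonneg]
  · rw [angular_of_ne hx]
    exact (hC _ (Set.mem_univ _)).trans (le_abs_self C)

end Angular

section Poles

variable {N : ℕ}

/-- The singular potential `h((x-a)/|x-a|) / |x-a|²` with pole `a`. -/
def polePot (h : Sph N → ℝ) (a x : Eucl N) : ℝ := angular h (x - a) / ‖x - a‖ ^ 2

/-- The sum of the singular potentials with poles `a₁, …, a_k`, which is the potential of `𝒬`. -/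
def totalPot {k : ℕ} (h : Fin k → Sph N → ℝ) (a : Fin k → Eucl N) (x : Eucl N) : ℝ :=
  ∑ i, polePot (h i) (a i) x

theorem measurable_polePot {h : Sph N → ℝ} (hc : Continuous h) (a : Eucl N) :
    Measurable (polePot h a) := by
  have := measurable_angular hc
  unfold polePot
  fun_prop

theorem exists_abs_polePot_le {h : Sph N → ℝ} (hc : Continuous h) :
    ∃ M : ℝ, 0 ≤ M ∧ ∀ a x, |polePot h a x| ≤ M * (‖x - a‖ ^ 2)⁻¹ := by
  obtain ⟨M, hM, hb⟩ := exists_abs_angular_le hc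
  refine ⟨M, hM, fun a x => ?_⟩
  rw [polePot, abs_div, abs_pow, abs_norm, div_eq_mul_inv]
  gcongr
  exact hb _

variable [hN : Fact (3 ≤ N)]

theorem hardyPot_polePot {h : Sph N → ℝ} (hc : Continuous h) (a : Eucl N) :
    HardyPot (polePot h a) := by
  obtain ⟨M, -, hb⟩ := exists_abs_polePot_le hc
  refine (hardyPot_inv_sq a).mono (measurable_polePot hc a).aestronglyMeasurable (M := M)
    (Eventually.of_forall fun x => ?_)
  rw [abs_inv, abs_pow, abs_norm]
  exact hb a x

theorem hardyPot_indicator_closedBall (R : ℝ) :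
    HardyPot ((closedBall (0 : Eucl N) R).indicator fun _ => (1 : ℝ)) := by
  refine (hardyPot_inv_sq 0).mono
    (aestronglyMeasurable_const.indicator measurableSet_closedBall) (M := R ^ 2) ?_
  filter_upwards [compl_mem_ae_iff.2 (measure_singleton (0 : Eucl N))] with x hx
  rw [sub_zero, abs_inv, abs_pow, abs_norm]
  by_cases hR : x ∈ closedBall (0 : Eucl N) R
  · rw [Set.indicator_of_mem hR, abs_one, ← div_eq_mul_inv, one_le_div₀ (by
      have := norm_pos_iff.2 hx
      positivity)]
    gcongr
    exact mem_closedBall_zero_iff.1 hR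
  · rw [Set.indicator_of_notMem hR, abs_zero]
    positivity

theorem hardyPot_totalPot {k : ℕ} {h : Fin k → Sph N → ℝ} (hc : ∀ i, Continuous (h i))
    (a : Fin k → Eucl N) : HardyPot (totalPot h a) :=
  HardyPot.sum _ fun i _ => hardyPot_polePot (hc i) (a i)

theorem poleTerm_eq (h : Sph N → ℝ) (a : Eucl N) (u : D12 N) :
    poleTerm h a u = potTerm (polePot h a) u := rfl

theorem Q_eq {k : ℕ} {h : Fin k → Sph N → ℝ} (hc : ∀ i, Continuous (h i))
    (a : Fin k → Eucl N) (u : D12 N) : Q h a u = ‖u‖ ^ 2 - potTerm (totalPot h a) u := by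
  unfold Q totalPot
  rw [potTerm_sum _ fun i _ => hardyPot_polePot (hc i) (a i), dirichlet_eq]
  rfl

end Poles

section Derivative

variable {N : ℕ} [hN : Fact (3 ≤ N)]

/-- The symmetric bilinear form `∫ (∇u · ∇v - V u v)`. -/
def HardyPot.form {V : Eucl N → ℝ} (hV : HardyPot V) : D12 N →L[ℝ] D12 N →L[ℝ] ℝ :=
  let ip : D12 N →L[ℝ] D12 N →L[ℝ] ℝ := innerSL ℝ
  ip - hV.bilin

theorem HardyPot.form_apply {V : Eucl N → ℝ} (hV : HardyPot V) (u v : D12 N) :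
    hV.form u v = inner ℝ u v - hV.bilin u v := rfl

theorem HardyPot.form_comm {V : Eucl N → ℝ} (hV : HardyPot V) (u v : D12 N) :
    hV.form u v = hV.form v u := by
  simp only [form_apply, bilin_apply, real_inner_comm, mul_comm]

theorem HardyPot.form_self {V : Eucl N → ℝ} (hV : HardyPot V) (u : D12 N) :
    hV.form u u = ‖u‖ ^ 2 - potTerm V u := by
  rw [form_apply, real_inner_self_eq_norm_sq, hV.bilin_self]

theorem hasFDerivAt_critTerm (u : D12 N) :
    HasFDerivAt critTerm
      (crit N • (dualPowL (two_le_critE N) (critE_ne_top N) u.fn).comp (fnL N)) u := by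
  have h := (hasFDerivAt_integral_abs_rpow (two_le_critE N) (critE_ne_top N) u.fn).comp u
    (fnL N).hasFDerivAt
  simp only [critE_toReal, ContinuousLinearMap.smul_comp] at h
  exact h

theorem fderiv_J_apply {k : ℕ} {h : Fin k → Sph N → ℝ} (hc : ∀ i, Continuous (h i))
    (a : Fin k → Eucl N) (u v : D12 N) :
    fderiv ℝ (J h a) u v = (hardyPot_totalPot hc a).form u v -
      SMulti h a * ∫ x, dualPow (crit N) (u.fn x) * v.fn x := by
  let B := (hardyPot_totalPot hc a).form
  have hJ : J h a = fun u => 1 / 2 * B u u - SMulti h a / crit N * critTerm u := by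
    ext u
    rw [HardyPot.form_self, ← Q_eq hc, J, Q]
    ring
  have hB := B.hasFDerivAt_of_bilinear (hasFDerivAt_id u) (hasFDerivAt_id u)
  have hderiv := (hB.const_mul (1 / 2)).sub
    ((hasFDerivAt_critTerm u).const_mul (SMulti h a / crit N))
  simp only [Pi.sub_def, id] at hderiv
  rw [hJ, hderiv.fderiv]
  simp only [sub_apply, smul_apply, add_apply, smul_eq_mul, ContinuousLinearMap.precompR_apply,
    ContinuousLinearMap.compL_apply, ContinuousLinearMap.comp_apply,
    ContinuousLinearMap.precompL_apply, ContinuousLinearMap.id_apply, B,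
    HardyPot.form_comm _ v u, dualPowL_apply, critE_toReal, fnL_apply]
  have := (crit_pos N).ne'
  field_simp
  ring

end Derivative

section Translation

theorem eLpNorm_two_sq {α E : Type*} [MeasurableSpace α] [NormedAddCommGroup E] {ν : Measure α}
    (f : α → E) : eLpNorm f 2 ν ^ 2 = ∫⁻ x, ‖f x‖ₑ ^ 2 ∂ν := by
  simpa using eLpNorm_nnreal_pow_eq_lintegral (f := f) (μ := ν) (p := 2) two_ne_zero

theorem enorm_integral_sq_le {α E : Type*} [MeasurableSpace α] [NormedAddCommGroup E]
    [NormedSpace ℝ E] {ν : Measure α} [IsProbabilityMeasure ν] {f : α → E}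
    (hf : AEStronglyMeasurable f ν) : ‖∫ x, f x ∂ν‖ₑ ^ 2 ≤ ∫⁻ x, ‖f x‖ₑ ^ 2 ∂ν := by
  rw [← eLpNorm_two_sq]
  gcongr
  calc ‖∫ x, f x ∂ν‖ₑ ≤ ∫⁻ x, ‖f x‖ₑ ∂ν := enorm_integral_le_lintegral_enorm f
    _ = eLpNorm f 1 ν := eLpNorm_one_eq_lintegral_enorm.symm
    _ ≤ eLpNorm f 2 ν := eLpNorm_le_eLpNorm_of_exponent_le one_le_two hf

variable {N : ℕ}

theorem IsTest.enorm_translate_sub_sq_le {φ : Eucl N → ℝ} (hφ : IsTest φ) (x y : Eucl N) :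
    ‖φ (x + y) - φ x‖ₑ ^ 2 ≤
      ∫⁻ t in Set.Ioc (0 : ℝ) 1, ‖y‖ₑ ^ 2 * ‖gradient φ (x + t • y)‖ₑ ^ 2 := by
  have : IsProbabilityMeasure (volume.restrict (Set.Ioc (0 : ℝ) 1)) := ⟨by simp⟩
  have hline (t : ℝ) : HasDerivAt (fun t : ℝ => x + t • y) y t := by
    simpa using ((hasDerivAt_id t).smul_const y).const_add x
  have hcont : Continuous fun t : ℝ => fderiv ℝ φ (x + t • y) y :=
    (hφ.continuous_fderiv.comp (by fun_prop)).clm_apply continuous_const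
  have hftc : φ (x + y) - φ x = ∫ t in Set.Ioc (0 : ℝ) 1, fderiv ℝ φ (x + t • y) y := by
    rw [← intervalIntegral.integral_of_le zero_le_one,
      intervalIntegral.integral_eq_sub_of_hasDerivAt
        (fun t _ => (hφ.differentiable _).hasFDerivAt.comp_hasDerivAt t (hline t))
        (hcont.intervalIntegrable 0 1)]
    simp only [Function.comp_apply, one_smul, zero_smul, add_zero]
  rw [hftc]
  refine (enorm_integral_sq_le hcont.aestronglyMeasurable).trans (lintegral_mono fun t => ?_)
  rw [← mul_pow]
  gcongr
  rw [← inner_gradient_left, mul_comm]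
  simp only [enorm_eq_nnnorm]
  exact_mod_cast nnnorm_inner_le_nnnorm (𝕜 := ℝ) (gradient φ (x + t • y)) y

variable [hN : Fact (3 ≤ N)]

theorem IsTest.enorm_ofTest_sq {φ : Eucl N → ℝ} (hφ : IsTest φ) :
    ‖ofTest hφ‖ₑ ^ 2 = ∫⁻ x, ‖gradient φ x‖ₑ ^ 2 := by
  rw [← eLpNorm_two_sq, ← eLpNorm_congr_ae (ofTest_grad hφ), ← Lp.enorm_def]
  rfl

theorem IsTest.lintegral_translate_sub_sq_le {φ : Eucl N → ℝ} (hφ : IsTest φ) (y : Eucl N) :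
    ∫⁻ x, ‖φ (x + y) - φ x‖ₑ ^ 2 ≤ ‖y‖ₑ ^ 2 * ‖ofTest hφ‖ₑ ^ 2 := by
  have hmeas : Measurable fun z : Eucl N × ℝ => ‖y‖ₑ ^ 2 * ‖gradient φ (z.1 + z.2 • y)‖ₑ ^ 2 :=
    ((hφ.continuous_gradient.comp (by fun_prop)).enorm.measurable.pow_const 2).const_mul _
  calc ∫⁻ x, ‖φ (x + y) - φ x‖ₑ ^ 2
      ≤ ∫⁻ x, ∫⁻ t in Set.Ioc (0 : ℝ) 1, ‖y‖ₑ ^ 2 * ‖gradient φ (x + t • y)‖ₑ ^ 2 :=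
        lintegral_mono fun x => hφ.enorm_translate_sub_sq_le x y
    _ = ∫⁻ t in Set.Ioc (0 : ℝ) 1, ∫⁻ x, ‖y‖ₑ ^ 2 * ‖gradient φ (x + t • y)‖ₑ ^ 2 :=
        lintegral_lintegral_swap hmeas.aemeasurable
    _ = ∫⁻ _ in Set.Ioc (0 : ℝ) 1, ‖y‖ₑ ^ 2 * ‖ofTest hφ‖ₑ ^ 2 := by
        refine lintegral_congr fun t => ?_
        rw [lintegral_const_mul' _ _ (by finiteness),
          lintegral_add_right_eq_self (fun x => ‖gradient φ x‖ₑ ^ 2), hφ.enorm_ofTest_sq]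
    _ = ‖y‖ₑ ^ 2 * ‖ofTest hφ‖ₑ ^ 2 := by
        rw [setLIntegral_const, Real.volume_Ioc, sub_zero, ENNReal.ofReal_one, mul_one]

theorem lintegral_translate_sub_sq_le (u : D12 N) (y : Eucl N) :
    ∫⁻ x, ‖u.fn (x + y) - u.fn x‖ₑ ^ 2 ≤ ‖y‖ₑ ^ 2 * ‖u‖ₑ ^ 2 := by
  have hshift : Measure.QuasiMeasurePreserving (fun x : Eucl N => x + y) volume volume :=
    (measurePreserving_add_right volume y).quasiMeasurePreserving
  induction u using D12.induction_on_test with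
  | hclosed =>
    refine IsSeqClosed.isClosed fun v u hv hlim => ?_
    obtain ⟨s, hs, hae⟩ := (tendstoInMeasure_of_tendsto_Lp
      ((continuous_fn.tendsto u).comp hlim)).exists_seq_tendsto_ae
    refine lintegral_le_of_tendsto_ae
      (F := fun n x => ‖(v (s n)).fn (x + y) - (v (s n)).fn x‖ₑ ^ 2)
      (b := fun n => ‖y‖ₑ ^ 2 * ‖v (s n)‖ₑ ^ 2) (fun n => ?_) ?_ ?_ fun n => hv (s n)
    · exact (((aestronglyMeasurable_fn _).comp_quasiMeasurePreserving hshift).sub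
        (aestronglyMeasurable_fn _)).enorm.pow_const 2
    · filter_upwards [hae, hshift.ae hae] with x hx hxy
      exact ENNReal.Tendsto.pow (hxy.sub hx).enorm
    · exact ENNReal.Tendsto.const_mul (ENNReal.Tendsto.pow (hlim.comp hs.tendsto_atTop).enorm)
        (Or.inr (by finiteness))
  | htest φ hφ =>
    refine (lintegral_congr_ae ?_).trans_le (hφ.lintegral_translate_sub_sq_le y)
    filter_upwards [ofTest_fn hφ, hshift.ae (ofTest_fn hφ)] with x hx hxy
    rw [hx, hxy]

end Translation

section Averaging

variable {N : ℕ} {ε : ℝ} {f : Eucl N → ℝ} {p : ℝ≥0∞}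

/-- The mean of `f` over the ball of radius `ε` about `x`. -/
def ballAvg (ε : ℝ) (f : Eucl N → ℝ) (x : Eucl N) : ℝ :=
  ∫ y, f (x + y) ∂ProbabilityTheory.cond volume (ball (0 : Eucl N) ε)

theorem isProbabilityMeasure_cond_ball (hε : 0 < ε) :
    IsProbabilityMeasure (ProbabilityTheory.cond volume (ball (0 : Eucl N) ε)) :=
  ProbabilityTheory.cond_isProbabilityMeasure_of_finite (measure_ball_pos _ _ hε).ne'
    measure_ball_lt_top.ne

theorem stronglyMeasurable_ballAvg (hf : StronglyMeasurable f) :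
    StronglyMeasurable (ballAvg ε f) :=
  StronglyMeasurable.integral_prod_right (f := fun x y => f (x + y))
    (hf.comp_measurable measurable_add)

theorem ballAvg_eq (ε : ℝ) (f : Eucl N → ℝ) (x : Eucl N) :
    ballAvg ε f x =
      ∫ y, (ball x ε).indicator (fun _ => (volume (ball (0 : Eucl N) ε)).toReal⁻¹) y * f y := by
  have hball : ball (0 : Eucl N) ε = (fun y => x + y) ⁻¹' ball x ε := by
    ext y
    simp only [Set.mem_preimage, mem_ball, dist_zero_right, dist_self_add_left]
  rw [ballAvg, ProbabilityTheory.cond, integral_smul_measure, ENNReal.toReal_inv, smul_eq_mul,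
    ← integral_const_mul, hball]
  rw [(measurePreserving_add_left volume x).setIntegral_preimage_emb
    (measurableEmbedding_addLeft x) (fun y => _ * f y), ← hball,
    ← integral_indicator measurableSet_ball]
  simp only [Set.indicator_mul_left]

theorem memLp_comp_add_left_cond (hε : 0 < ε) (hf : MemLp f p volume) (x : Eucl N) :
    MemLp (fun y => f (x + y)) p (ProbabilityTheory.cond volume (ball (0 : Eucl N) ε)) :=
  ((hf.comp_measurePreserving (measurePreserving_add_left volume x)).restrict _).smul_measure
    (ENNReal.inv_ne_top.2 (measure_ball_pos _ _ hε).ne')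

theorem enorm_ballAvg_le [hp : Fact (1 ≤ p)] (hp' : p ≠ ⊤) (hε : 0 < ε) (hf : MemLp f p volume)
    (x : Eucl N) :
    ‖ballAvg ε f x‖ₑ ≤
      (volume (ball (0 : Eucl N) ε))⁻¹ ^ p.toReal⁻¹ * eLpNorm f p volume := by
  have := isProbabilityMeasure_cond_ball (N := N) hε
  have hx := measurePreserving_add_left volume x
  calc ‖ballAvg ε f x‖ₑ
      ≤ eLpNorm (fun y => f (x + y)) 1 (ProbabilityTheory.cond volume (ball (0 : Eucl N) ε)) :=
        (enorm_integral_le_lintegral_enorm _).trans_eq eLpNorm_one_eq_lintegral_enorm.symm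
    _ ≤ eLpNorm (fun y => f (x + y)) p (ProbabilityTheory.cond volume (ball (0 : Eucl N) ε)) :=
        eLpNorm_le_eLpNorm_of_exponent_le hp.out (memLp_comp_add_left_cond hε hf x).1
    _ = (volume (ball (0 : Eucl N) ε))⁻¹ ^ p.toReal⁻¹ *
          eLpNorm (fun y => f (x + y)) p (volume.restrict (ball (0 : Eucl N) ε)) := by
        rw [ProbabilityTheory.cond, eLpNorm_smul_measure_of_ne_top hp', one_div, smul_eq_mul,
          ENNReal.toReal_inv]
    _ ≤ (volume (ball (0 : Eucl N) ε))⁻¹ ^ p.toReal⁻¹ * eLpNorm f p volume := by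
        rw [← eLpNorm_comp_measurePreserving hf.1 hx]
        gcongr
        exact eLpNorm_restrict_le _ _ _ _

theorem memLp_indicator_ball (x : Eucl N) (ε c : ℝ) (p : ℝ≥0∞) :
    MemLp ((ball x ε).indicator fun _ => c) p volume :=
  memLp_indicator_const _ measurableSet_ball _ (Or.inr measure_ball_lt_top.ne)

variable [hN : Fact (3 ≤ N)]

theorem lintegral_ballAvg_sub_sq_le (hε : 0 < ε) (u : D12 N) :
    ∫⁻ x, ‖ballAvg ε u.fn x - u.fn x‖ₑ ^ 2 ≤ ‖ε‖ₑ ^ 2 * ‖u‖ₑ ^ 2 := by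
  let ν := ProbabilityTheory.cond volume (ball (0 : Eucl N) ε)
  have hν : IsProbabilityMeasure ν := isProbabilityMeasure_cond_ball hε
  have hmeas : StronglyMeasurable fun z : Eucl N × Eucl N => u.fn (z.1 + z.2) - u.fn z.1 :=
    ((Lp.stronglyMeasurable u.fn).comp_measurable measurable_add).sub
      ((Lp.stronglyMeasurable u.fn).comp_measurable measurable_fst)
  calc ∫⁻ x, ‖ballAvg ε u.fn x - u.fn x‖ₑ ^ 2
      ≤ ∫⁻ x, (∫⁻ y, ‖u.fn (x + y) - u.fn x‖ₑ ^ 2 ∂ν) := lintegral_mono fun x => by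
        have hinteg : Integrable (fun y => u.fn (x + y)) ν :=
          (memLp_comp_add_left_cond hε (Lp.memLp u.fn) x).integrable (one_le_critE N).out
        have hsub : ballAvg ε u.fn x - u.fn x = ∫ y, (u.fn (x + y) - u.fn x) ∂ν := by
          rw [integral_sub hinteg (integrable_const _), integral_const, probReal_univ, one_smul]
          rfl
        rw [hsub]
        exact enorm_integral_sq_le (hinteg.1.sub aestronglyMeasurable_const)
    _ = ∫⁻ y, (∫⁻ x, ‖u.fn (x + y) - u.fn x‖ₑ ^ 2) ∂ν :=
        lintegral_lintegral_swap (hmeas.enorm.pow_const 2).aemeasurable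
    _ ≤ ∫⁻ _, ‖ε‖ₑ ^ 2 * ‖u‖ₑ ^ 2 ∂ν := by
        refine lintegral_mono_ae ?_
        filter_upwards [ProbabilityTheory.ae_cond_mem measurableSet_ball] with y hy
        refine (lintegral_translate_sub_sq_le u y).trans ?_
        gcongr
        rw [enorm_le_iff_norm_le, Real.norm_of_nonneg hε.le]
        exact (mem_ball_zero_iff.1 hy).le
    _ = ‖ε‖ₑ ^ 2 * ‖u‖ₑ ^ 2 := by rw [lintegral_const, measure_univ, mul_one]

theorem tendsto_ballAvg_zero {w : ℕ → D12 N}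
    (hw : ∀ f : D12 N →L[ℝ] ℝ, Tendsto (fun n => f (w n)) atTop (𝓝 0)) (ε : ℝ) (x : Eucl N) :
    Tendsto (fun n => ballAvg ε (w n).fn x) atTop (𝓝 0) := by
  simp only [ballAvg_eq, ← pairing_apply (memLp_indicator_ball x ε _ _)]
  exact hw _

end Averaging

section LocalCompactness

variable {N : ℕ} [hN : Fact (3 ≤ N)]

/-- The local mass `∫_{|x| ≤ R} u²`. -/
def ballTerm (R : ℝ) (u : D12 N) : ℝ := ∫ x in closedBall 0 R, u.fn x ^ 2

theorem ballTerm_nonneg (R : ℝ) (u : D12 N) : 0 ≤ ballTerm R u :=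
  integral_nonneg fun _ => sq_nonneg _

theorem ballTerm_eq_potTerm (R : ℝ) (u : D12 N) :
    ballTerm R u = potTerm ((closedBall 0 R).indicator fun _ => 1) u := by
  rw [ballTerm, potTerm, ← integral_indicator measurableSet_closedBall]
  classical
  simp only [Set.indicator_apply, ite_mul, one_mul, zero_mul]

theorem integrableOn_fn_sq (R : ℝ) (u : D12 N) :
    IntegrableOn (fun x => u.fn x ^ 2) (closedBall 0 R) := by
  have := (hardyPot_indicator_closedBall (N := N) R).integrable_mul_sq u
  refine (integrable_indicator_iff measurableSet_closedBall).1 (this.congr ?_)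
  classical
  refine Eventually.of_forall fun x => ?_
  simp only [Set.indicator_apply, ite_mul, one_mul, zero_mul]

theorem ofReal_ballTerm (R : ℝ) (u : D12 N) :
    ENNReal.ofReal (ballTerm R u) = ∫⁻ x in closedBall 0 R, ‖u.fn x‖ₑ ^ 2 := by
  rw [ballTerm, ofReal_integral_eq_lintegral_ofReal (integrableOn_fn_sq R u)
    (Eventually.of_forall fun _ => sq_nonneg _)]
  simp only [← Real.enorm_of_nonneg (sq_nonneg _), enorm_pow]

theorem tendsto_setLIntegral_ballAvg_sq {w : ℕ → D12 N} {K : ℝ} (hK : ∀ n, ‖w n‖ ≤ K)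
    (hw : ∀ f : D12 N →L[ℝ] ℝ, Tendsto (fun n => f (w n)) atTop (𝓝 0)) {ε : ℝ} (hε : 0 < ε)
    (R : ℝ) :
    Tendsto (fun n => ∫⁻ x in closedBall 0 R, ‖ballAvg ε (w n).fn x‖ₑ ^ 2) atTop (𝓝 0) := by
  let c := (volume (ball (0 : Eucl N) ε))⁻¹ ^ (critE N).toReal⁻¹ * (‖fnL N‖ₑ * ‖K‖ₑ)
  have hc : c ≠ ⊤ := ENNReal.mul_ne_top
    (ENNReal.rpow_ne_top_of_nonneg (by positivity)
      (ENNReal.inv_ne_top.2 (measure_ball_pos _ _ hε).ne')) (by finiteness)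
  have hbound (n : ℕ) (x : Eucl N) : ‖ballAvg ε (w n).fn x‖ₑ ^ 2 ≤ c ^ 2 := by
    refine pow_le_pow_left' ?_ 2
    refine (enorm_ballAvg_le (critE_ne_top N) hε (Lp.memLp _) x).trans ?_
    rw [← Lp.enorm_def, ← fnL_apply]
    refine mul_le_mul_right ?_ _
    refine ((fnL N).le_opENorm (w n)).trans ?_
    gcongr
    exact enorm_le_iff_norm_le.2 ((hK n).trans (le_abs_self K))
  have hlim (x : Eucl N) : Tendsto (fun n => ‖ballAvg ε (w n).fn x‖ₑ ^ 2) atTop (𝓝 0) := by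
    have := ENNReal.Tendsto.pow (n := 2) (tendsto_ballAvg_zero hw ε x).enorm
    rwa [enorm_zero, zero_pow two_ne_zero] at this
  rw [← lintegral_zero (μ := volume.restrict (closedBall (0 : Eucl N) R))]
  refine tendsto_lintegral_of_dominated_convergence (fun _ => c ^ 2) (fun n => ?_)
    (fun n => Eventually.of_forall (hbound n)) ?_ (Eventually.of_forall hlim)
  · exact (stronglyMeasurable_ballAvg (Lp.stronglyMeasurable _)).measurable.enorm.pow_const 2
  · rw [setLIntegral_const]
    exact ENNReal.mul_ne_top (ENNReal.pow_ne_top hc) measure_closedBall_lt_top.ne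

theorem ofReal_ballTerm_le {ε : ℝ} (hε : 0 < ε) (R : ℝ) (u : D12 N) :
    ENNReal.ofReal (ballTerm R u) ≤
      2 * (‖ε‖ₑ ^ 2 * ‖u‖ₑ ^ 2) + 2 * ∫⁻ x in closedBall 0 R, ‖ballAvg ε u.fn x‖ₑ ^ 2 := by
  have hmeas : AEMeasurable (fun x => ‖ballAvg ε u.fn x - u.fn x‖ₑ ^ 2)
      (volume.restrict (closedBall 0 R)) :=
    ((stronglyMeasurable_ballAvg (Lp.stronglyMeasurable _)).sub
      (Lp.stronglyMeasurable _)).enorm.pow_const 2 |>.aemeasurable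
  calc ENNReal.ofReal (ballTerm R u)
      ≤ ∫⁻ x in closedBall 0 R,
          (2 * ‖ballAvg ε u.fn x - u.fn x‖ₑ ^ 2 + 2 * ‖ballAvg ε u.fn x‖ₑ ^ 2) := by
        rw [ofReal_ballTerm]
        refine lintegral_mono fun x => ?_
        simp only [← enorm_pow, Real.enorm_of_nonneg (sq_nonneg _),
          ← ENNReal.ofReal_ofNat 2, ← ENNReal.ofReal_mul zero_le_two]
        rw [← ENNReal.ofReal_add (by positivity) (by positivity)]
        refine ENNReal.ofReal_le_ofReal ?_
        nlinarith [sq_nonneg (u.fn x - 2 * ballAvg ε u.fn x)]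
    _ = 2 * (∫⁻ x in closedBall 0 R, ‖ballAvg ε u.fn x - u.fn x‖ₑ ^ 2) +
          2 * ∫⁻ x in closedBall 0 R, ‖ballAvg ε u.fn x‖ₑ ^ 2 := by
        rw [lintegral_add_left' (hmeas.const_mul 2), lintegral_const_mul' _ _ (by finiteness),
          lintegral_const_mul' _ _ (by finiteness)]
    _ ≤ _ := by
        gcongr
        exact (setLIntegral_le_lintegral _ _).trans (lintegral_ballAvg_sub_sq_le hε u)

theorem tendsto_ballTerm {w : ℕ → D12 N} {K : ℝ} (hK : ∀ n, ‖w n‖ ≤ K)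
    (hw : ∀ f : D12 N →L[ℝ] ℝ, Tendsto (fun n => f (w n)) atTop (𝓝 0)) (R : ℝ) :
    Tendsto (fun n => ballTerm R (w n)) atTop (𝓝 0) := by
  suffices h : Tendsto (fun n => ENNReal.ofReal (ballTerm R (w n))) atTop (𝓝 0) by
    simpa only [Function.comp_def, ENNReal.toReal_ofReal (ballTerm_nonneg R _),
      ENNReal.toReal_zero] using (ENNReal.tendsto_toReal ENNReal.zero_ne_top).comp h
  refine ENNReal.tendsto_nhds_zero.2 fun δ hδ => ?_
  have hsmall : Tendsto (fun ε : ℝ => 2 * (‖ε‖ₑ ^ 2 * ‖K‖ₑ ^ 2)) (𝓝[>] 0) (𝓝 0) := by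
    have hε : Tendsto (fun ε : ℝ => ‖ε‖ₑ ^ 2) (𝓝[>] 0) (𝓝 0) := by
      simpa using ENNReal.Tendsto.pow (n := 2)
        (tendsto_id.mono_left (nhdsWithin_le_nhds (a := (0 : ℝ)) (s := Set.Ioi 0))).enorm
    simpa using ENNReal.Tendsto.const_mul (a := 2)
      (ENNReal.Tendsto.mul_const (b := ‖K‖ₑ ^ 2) hε (Or.inr (by finiteness)))
      (Or.inr (by finiteness))
  obtain ⟨ε, hε, hε₀⟩ := ((ENNReal.tendsto_nhds_zero.1 hsmall _ (ENNReal.half_pos hδ.ne')).and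
    self_mem_nhdsWithin).exists
  have havg := ENNReal.Tendsto.const_mul (a := 2)
    (tendsto_setLIntegral_ballAvg_sq hK hw (Set.mem_Ioi.1 hε₀) R) (Or.inr (by finiteness))
  rw [mul_zero] at havg
  filter_upwards [ENNReal.tendsto_nhds_zero.1 havg _ (ENNReal.half_pos hδ.ne')] with n hn
  refine (ofReal_ballTerm_le hε₀ R (w n)).trans ((add_le_add ?_ hn).trans_eq (ENNReal.add_halves δ))
  refine le_trans ?_ hε
  gcongr
  exact enorm_le_iff_norm_le.2 ((hK n).trans (le_abs_self K))

end LocalCompactness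

section NonlinearSplitting

theorem lintegral_enorm_Lp_rpow_mul_mul_le_of_support {α : Type*} [MeasurableSpace α]
    {μ : Measure α} {p : ℝ≥0∞} (hp₂ : 2 ≤ p) (hp : p ≠ ⊤) (F w : Lp ℝ p μ) {φ : α → ℝ} {M : ℝ}
    (hM : ∀ x, |φ x| ≤ M) {s : Set α} (hs : MeasurableSet s) (hφ : ∀ x ∉ s, φ x = 0) :
    ∫⁻ x, ‖|F x| ^ (p.toReal - 2) * |φ x| * |w x|‖ₑ ∂μ ≤
      ‖M‖ₑ * (‖F‖ₑ ^ (p.toReal - 2) * ‖w‖ₑ ^ ((p.toReal - 2) / p.toReal) *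
        (∫⁻ x in s, ‖w x‖ₑ ^ 2 ∂μ) ^ p.toReal⁻¹ * μ s ^ (2 / p.toReal ^ 2)) := by
  have hq := two_le_toReal hp₂ hp
  have hroot (f : Lp ℝ p μ) (t : ℝ) :
      ‖f‖ₑ ^ t = (∫⁻ x, ‖f x‖ₑ ^ p.toReal ∂μ) ^ (t / p.toReal) := by
    rw [Lp_enorm_eq_lintegral (two_pos.trans_le hp₂).ne' hp, ← ENNReal.rpow_mul, inv_mul_eq_div]
  calc ∫⁻ x, ‖|F x| ^ (p.toReal - 2) * |φ x| * |w x|‖ₑ ∂μ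
    _ ≤ ∫⁻ x in s, ‖M‖ₑ * (‖F x‖ₑ ^ (p.toReal - 2) * ‖w x‖ₑ) ∂μ := by
        rw [← lintegral_indicator hs]
        refine lintegral_mono fun x => ?_
        by_cases hx : x ∈ s
        · rw [Set.indicator_of_mem hx, enorm_abs_rpow_mul_mul hq, mul_left_comm, mul_assoc]
          gcongr
          exact enorm_le_iff_norm_le.2 ((hM x).trans (le_abs_self M))
        · simp [hφ x hx]
    _ = ‖M‖ₑ * ∫⁻ x in s, ‖F x‖ₑ ^ (p.toReal - 2) * ‖w x‖ₑ ∂μ :=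
        lintegral_const_mul' _ _ enorm_ne_top
    _ ≤ _ := by
        refine mul_le_mul_right ?_ _
        refine (lintegral_rpow_mul_le_interpolate hq (Lp.aestronglyMeasurable F).restrict.enorm
          (Lp.aestronglyMeasurable w).restrict.enorm).trans ?_
        rw [Measure.restrict_apply_univ, hroot F, hroot w, div_div, ← sq]
        gcongr <;> exact Measure.restrict_le_self

variable {N : ℕ} [hN : Fact (3 ≤ N)]

theorem tendsto_integral_rpow_mul_ofTest {F : ℕ → Lp ℝ (critE N) (volume : Measure (Eucl N))}
    {w : ℕ → D12 N} {A : ℝ} (hF : ∀ n, ‖F n‖ ≤ A) (hw : ∀ n, ‖(w n).fn‖ ≤ A)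
    (hball : ∀ R, Tendsto (fun n => ballTerm R (w n)) atTop (𝓝 0)) {φ : Eucl N → ℝ}
    (hφ : IsTest φ) :
    Tendsto (fun n => ∫ x, |F n x| ^ (crit N - 2) * |(ofTest hφ).fn x| * |(w n).fn x|)
      atTop (𝓝 0) := by
  obtain ⟨R, hR⟩ := hφ.hasCompactSupport.isCompact.isBounded.subset_closedBall 0
  obtain ⟨M, hM⟩ := hφ.hasCompactSupport.exists_bound_of_continuous hφ.continuous
  have hq : 0 < crit N - 2 := sub_pos.2 (two_lt_crit N)
  have hq₀ : 0 < crit N := crit_pos N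
  have hbound (n : ℕ) :
      ‖∫ x, |F n x| ^ (crit N - 2) * |(ofTest hφ).fn x| * |(w n).fn x|‖ₑ ≤
        ‖M‖ₑ * (‖A‖ₑ ^ (crit N - 2) * ‖A‖ₑ ^ ((crit N - 2) / crit N) *
          ENNReal.ofReal (ballTerm R (w n)) ^ (crit N)⁻¹ *
            volume (closedBall (0 : Eucl N) R) ^ (2 / crit N ^ 2)) := by
    have hcongr : ∫ x, |F n x| ^ (crit N - 2) * |(ofTest hφ).fn x| * |(w n).fn x| =
        ∫ x, |F n x| ^ (crit N - 2) * |φ x| * |(w n).fn x| := by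
      refine integral_congr_ae ?_
      filter_upwards [ofTest_fn hφ] with x hx
      rw [hx]
    have h := lintegral_enorm_Lp_rpow_mul_mul_le_of_support (two_le_critE N) (critE_ne_top N)
      (F n) (w n).fn hM measurableSet_closedBall
      fun x hx => image_eq_zero_of_notMem_tsupport fun h => hx (hR h)
    rw [critE_toReal, ← ofReal_ballTerm] at h
    rw [hcongr]
    refine (enorm_integral_le_lintegral_enorm _).trans (h.trans ?_)
    gcongr
    exacts [enorm_le_iff_norm_le.2 ((hF n).trans (le_abs_self A)),
      enorm_le_iff_norm_le.2 ((hw n).trans (le_abs_self A))]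
  have hlim : Tendsto (fun n => ENNReal.ofReal (ballTerm R (w n)) ^ (crit N)⁻¹) atTop (𝓝 0) := by
    simpa [ENNReal.zero_rpow_of_pos (inv_pos.2 hq₀)] using
      (ENNReal.tendsto_ofReal (hball R)).ennrpow_const (crit N)⁻¹
  have hvol : volume (closedBall (0 : Eucl N) R) ≠ ⊤ := measure_closedBall_lt_top.ne
  have hlim := ENNReal.Tendsto.const_mul (a := ‖M‖ₑ) (ENNReal.Tendsto.mul_const
    (b := volume (closedBall (0 : Eucl N) R) ^ (2 / crit N ^ 2)) (ENNReal.Tendsto.const_mul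
      (a := ‖A‖ₑ ^ (crit N - 2) * ‖A‖ₑ ^ ((crit N - 2) / crit N)) hlim
        (Or.inr (by finiteness [div_pos hq hq₀]))) (Or.inr (by finiteness)))
          (Or.inr enorm_ne_top)
  simp only [mul_zero, zero_mul] at hlim
  exact tendsto_zero_iff_enorm_tendsto_zero.2 (tendsto_of_tendsto_of_tendsto_of_le_of_le
    tendsto_const_nhds hlim (fun _ => zero_le) hbound)

theorem integral_rpow_mul_abs_fn_le {A : ℝ} {F G : Lp ℝ (critE N) (volume : Measure (Eucl N))}
    (hF : ‖F‖ ≤ A) (hG : ‖G‖ ≤ A) (u v : D12 N) :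
    ∫ x, |F x| ^ (crit N - 2) * |u.fn x| * |G x| ≤
      (∫ x, |F x| ^ (crit N - 2) * |v.fn x| * |G x|) +
        A ^ (crit N - 2) * ‖fnL N‖ * A * dist u v := by
  have hinteg (u : D12 N) :
      Integrable (fun x => |F x| ^ (crit N - 2) * |u.fn x| * |G x|) volume := by
    simpa only [critE_toReal] using
      integrable_Lp_rpow_mul_mul (two_le_critE N) (critE_ne_top N) F u.fn G
  have hA : 0 ≤ A := (norm_nonneg F).trans hF
  have hq := two_lt_crit N
  have hle : ∫ x, |F x| ^ (crit N - 2) * |(u - v).fn x| * |G x| ≤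
      A ^ (crit N - 2) * ‖fnL N‖ * A * dist u v := by
    have h := integral_Lp_rpow_mul_mul_le (two_le_critE N) (critE_ne_top N) F (u - v).fn G
    rw [critE_toReal] at h
    calc _ ≤ ‖F‖ ^ (crit N - 2) * ‖(u - v).fn‖ * ‖G‖ := h
      _ ≤ A ^ (crit N - 2) * (‖fnL N‖ * ‖u - v‖) * A := by
        gcongr
        exact (fnL N).le_opNorm (u - v)
      _ = _ := by rw [dist_eq_norm]; ring
  refine le_trans ?_ (add_le_add_right hle _)
  rw [← integral_add (hinteg v) (hinteg (u - v))]
  refine integral_mono_ae (hinteg u) ((hinteg v).add (hinteg (u - v))) ?_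
  filter_upwards [fn_sub_ae u v] with x hx
  rw [hx, ← add_mul, ← mul_add]
  gcongr
  simpa using abs_add_le (v.fn x) (u.fn x - v.fn x)

theorem tendsto_integral_rpow_mul_mul {F : ℕ → Lp ℝ (critE N) (volume : Measure (Eucl N))}
    {w : ℕ → D12 N} {A : ℝ} (hF : ∀ n, ‖F n‖ ≤ A) (hw : ∀ n, ‖(w n).fn‖ ≤ A)
    (hball : ∀ R, Tendsto (fun n => ballTerm R (w n)) atTop (𝓝 0)) (u : D12 N) :
    Tendsto (fun n => ∫ x, |F n x| ^ (crit N - 2) * |u.fn x| * |(w n).fn x|) atTop (𝓝 0) := by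
  induction u using D12.induction_on_test with
  | hclosed =>
    have hlip (n : ℕ) := LipschitzWith.of_le_add_mul' (A ^ (crit N - 2) * ‖fnL N‖ * A)
      (integral_rpow_mul_abs_fn_le (hF n) (hw n))
    exact (LipschitzWith.uniformEquicontinuous _ _ hlip).equicontinuous.isClosed_setOfPred_tendsto
      continuous_const
  | htest φ hφ => exact tendsto_integral_rpow_mul_ofTest hF hw hball hφ

theorem norm_integral_dualPow_add_sub_critTerm_le (u v : D12 N) :
    ‖(∫ x, dualPow (crit N) ((u + v).fn x) * v.fn x) - critTerm v‖ ≤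
      (crit N - 1) * ∫ x, |(|(u + v).fn| + |v.fn|) x| ^ (crit N - 2) * |u.fn x| * |v.fn x| := by
  have hinteg := integrable_Lp_rpow_mul_mul (two_le_critE N) (critE_ne_top N)
    (|(u + v).fn| + |v.fn|) u.fn v.fn
  have hdual := integrable_dualPow_mul (two_le_critE N) (critE_ne_top N) (u + v).fn v.fn
  rw [critE_toReal] at hinteg hdual
  rw [critTerm, ← integral_sub hdual (integrable_abs_fn_rpow_crit v), ← integral_const_mul]
  refine norm_integral_le_of_norm_le (hinteg.const_mul _) ?_
  filter_upwards [ae_abs_add_abs_Lp (u + v).fn v.fn, fn_add_ae u v] with x hF hadd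
  have hu : (u + v).fn x - v.fn x = u.fn x := by rw [hadd]; ring
  have hmvt := abs_dualPow_sub_le (two_lt_crit N).le ((u + v).fn x) (v.fn x)
  rw [hu] at hmvt
  rw [hF, ← dualPow_mul_self (crit_pos N).ne' (v.fn x), ← sub_mul, norm_mul, Real.norm_eq_abs,
    Real.norm_eq_abs]
  exact (mul_le_mul_of_nonneg_right hmvt (abs_nonneg _)).trans_eq (by ring)

theorem tendsto_dualPow_sub_critTerm (u₀ : D12 N) {w : ℕ → D12 N} {K : ℝ} (hK : ∀ n, ‖w n‖ ≤ K)
    (hball : ∀ R, Tendsto (fun n => ballTerm R (w n)) atTop (𝓝 0)) :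
    Tendsto (fun n => (∫ x, dualPow (crit N) ((u₀ + w n).fn x) * (w n).fn x) - critTerm (w n))
      atTop (𝓝 0) := by
  have hw (n : ℕ) : ‖(w n).fn‖ ≤ ‖fnL N‖ * K :=
    ((fnL N).le_opNorm (w n)).trans (by gcongr; exact hK n)
  have hu (n : ℕ) : ‖(u₀ + w n).fn‖ ≤ ‖u₀.fn‖ + ‖fnL N‖ * K :=
    (norm_add_le u₀.fn (w n).fn).trans (by gcongr; exact hw n)
  have hlim := (tendsto_integral_rpow_mul_mul (A := ‖u₀.fn‖ + ‖fnL N‖ * K + ‖fnL N‖ * K)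
    (F := fun n => |(u₀ + w n).fn| + |(w n).fn|) (fun n => ?_)
      (fun n => (hw n).trans ?_) hball u₀).const_mul (crit N - 1)
  · rw [mul_zero] at hlim
    exact squeeze_zero_norm (fun n => norm_integral_dualPow_add_sub_critTerm_le u₀ (w n)) hlim
  · refine (norm_add_le _ _).trans ?_
    rw [norm_abs_eq_norm, norm_abs_eq_norm]
    exact add_le_add (hu n) (hw n)
  · linarith [(norm_nonneg _).trans (hu n)]

end NonlinearSplitting

section Dilation

variable {N : ℕ}

theorem integral_comp_affine (f : Eucl N → ℝ) {t : ℝ} (ht : 0 < t) (a : Eucl N) :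
    ∫ x, f x = t ^ N * ∫ y, f (t • y + a) := by
  have h := Measure.integral_comp_smul (volume : Measure (Eucl N)) (fun x => f (x + a)) t
  rw [integral_add_right_eq_self f a, finrank_euclideanSpace_fin,
    abs_of_pos (by positivity), smul_eq_mul] at h
  rw [h, mul_inv_cancel_left₀ (by positivity)]

/-- The function `φ` concentrated at scale `t` around `a`. It is not normalised: its Dirichlet
integral is `t ^ (N - 2)` times that of `φ`. -/
def dilate (t : ℝ) (a : Eucl N) (φ : Eucl N → ℝ) (x : Eucl N) : ℝ := φ (t⁻¹ • (x - a))

theorem inv_smul_smul_add_sub {t : ℝ} (ht : t ≠ 0) (a y : Eucl N) :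
    t⁻¹ • (t • y + a - a) = y := by
  rw [add_sub_cancel_right, inv_smul_smul₀ ht]

theorem dilate_smul_add {t : ℝ} (ht : t ≠ 0) (a : Eucl N) (φ : Eucl N → ℝ) (y : Eucl N) :
    dilate t a φ (t • y + a) = φ y := by
  rw [dilate, inv_smul_smul_add_sub ht]

theorem IsTest.dilate {φ : Eucl N → ℝ} (hφ : IsTest φ) {t : ℝ} (ht : t ≠ 0) (a : Eucl N) :
    IsTest (dilate t a φ) where
  smooth := by
    have := hφ.smooth
    unfold MultiSing.dilate
    fun_prop
  hasCompactSupport := hφ.hasCompactSupport.comp_homeomorph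
    ((Homeomorph.subRight a).trans (Homeomorph.smulOfNeZero t⁻¹ (inv_ne_zero ht)))

theorem gradient_dilate {φ : Eucl N → ℝ} (hφ : IsTest φ) {t : ℝ} (ht : t ≠ 0) (a y : Eucl N) :
    gradient (dilate t a φ) (t • y + a) = t⁻¹ • gradient φ y := by
  have haff : HasFDerivAt (fun x : Eucl N => t⁻¹ • (x - a))
      (t⁻¹ • ContinuousLinearMap.id ℝ (Eucl N)) (t • y + a) :=
    ((hasFDerivAt_id _).sub_const a).const_smul t⁻¹
  have hφy : HasFDerivAt φ (fderiv ℝ φ y) (t⁻¹ • (t • y + a - a)) := by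
    rw [inv_smul_smul_add_sub ht]
    exact (hφ.differentiable y).hasFDerivAt
  have hcomp : HasFDerivAt (dilate t a φ) _ _ := hφy.comp (t • y + a) haff
  refine ext_inner_right ℝ fun v => ?_
  simp only [inner_gradient_left, hcomp.fderiv, real_inner_smul_left,
    ContinuousLinearMap.comp_apply, smul_apply, ContinuousLinearMap.id_apply, map_smul,
    smul_eq_mul]

theorem polePot_smul_add (h : Sph N → ℝ) {t : ℝ} (ht : 0 < t) (a b y : Eucl N) :
    polePot h b (t • y + a) = (t ^ 2)⁻¹ * polePot h (t⁻¹ • (b - a)) y := by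
  have hsub : t • y + a - b = t • (y - t⁻¹ • (b - a)) := by
    rw [smul_sub, smul_inv_smul₀ ht.ne']
    abel
  rw [polePot, polePot, hsub, angular_smul ht, norm_smul, Real.norm_of_nonneg ht.le, mul_pow,
    div_eq_mul_inv, div_eq_mul_inv, mul_inv]
  ring

theorem polePot_sum {ι : Type*} (s : Finset ι) (h : ι → Sph N → ℝ) (b x : Eucl N) :
    polePot (∑ j ∈ s, h j) b x = ∑ j ∈ s, polePot (h j) b x := by
  simp only [polePot, angular_sum, Finset.sum_div]

variable [hN : Fact (3 ≤ N)]

theorem potTerm_ofTest (V : Eucl N → ℝ) {φ : Eucl N → ℝ} (hφ : IsTest φ) :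
    potTerm V (ofTest hφ) = ∫ x, V x * φ x ^ 2 := by
  refine integral_congr_ae ?_
  filter_upwards [ofTest_fn hφ] with x hx
  rw [hx]

theorem critTerm_ofTest {φ : Eucl N → ℝ} (hφ : IsTest φ) :
    critTerm (ofTest hφ) = ∫ x, |φ x| ^ crit N := by
  refine integral_congr_ae ?_
  filter_upwards [ofTest_fn hφ] with x hx
  rw [hx]

theorem norm_sq_dilate {φ : Eucl N → ℝ} (hφ : IsTest φ) {t : ℝ} (ht : 0 < t) (a : Eucl N) :
    ‖ofTest (hφ.dilate ht.ne' a)‖ ^ 2 = t ^ N * (t ^ 2)⁻¹ * ‖ofTest hφ‖ ^ 2 := by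
  rw [ofTest_norm_sq, ofTest_norm_sq, integral_comp_affine _ ht a,
    mul_assoc (t ^ N), ← integral_const_mul (t ^ 2)⁻¹]
  simp only [gradient_dilate hφ ht.ne', norm_smul, norm_inv, Real.norm_of_nonneg ht.le, mul_pow,
    inv_pow]

theorem potTerm_dilate (h : Sph N → ℝ) {φ : Eucl N → ℝ} (hφ : IsTest φ) {t : ℝ} (ht : 0 < t)
    (a b : Eucl N) : potTerm (polePot h b) (ofTest (hφ.dilate ht.ne' a)) =
      t ^ N * (t ^ 2)⁻¹ * potTerm (polePot h (t⁻¹ • (b - a))) (ofTest hφ) := by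
  rw [potTerm_ofTest, potTerm_ofTest, integral_comp_affine _ ht a,
    mul_assoc (t ^ N), ← integral_const_mul (t ^ 2)⁻¹]
  simp only [polePot_smul_add h ht, dilate_smul_add ht.ne', mul_assoc]

theorem norm_fn_translate {φ : Eucl N → ℝ} (hφ : IsTest φ) (a : Eucl N) :
    ‖(ofTest (hφ.dilate one_ne_zero a)).fn‖ ^ 2 = ‖(ofTest hφ).fn‖ ^ 2 := by
  rw [← critTerm_rpow, ← critTerm_rpow, critTerm_ofTest, critTerm_ofTest,
    integral_comp_affine _ one_pos a]
  simp only [dilate_smul_add one_ne_zero, one_pow, one_mul]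

end Dilation

section MovingPoles

variable {N : ℕ} [hN : Fact (3 ≤ N)]

namespace HardyPot

variable {V : Eucl N → ℝ}

theorem integrable_mul_test_sq (hV : HardyPot V) {φ : Eucl N → ℝ} (hφ : IsTest φ) :
    Integrable fun x => V x * φ x ^ 2 := by
  refine (hV.integrable_mul_sq (ofTest hφ)).congr ?_
  filter_upwards [ofTest_fn hφ] with x hx
  rw [hx]

theorem locallyIntegrable (hV : HardyPot V) : LocallyIntegrable V := fun x => by
  let f : ContDiffBump x := ⟨1, 2, one_pos, one_lt_two⟩
  have hf : IsTest f := ⟨f.contDiff, f.hasCompactSupport⟩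
  refine ⟨closedBall x 1, closedBall_mem_nhds x one_pos,
    (hV.integrable_mul_test_sq hf).integrableOn.congr_fun (fun y hy => ?_)
      measurableSet_closedBall⟩
  simp only [f.one_of_mem_closedBall hy, one_pow, mul_one]

theorem continuous_potTerm_translate (hV : HardyPot V) {φ : Eucl N → ℝ} (hφ : IsTest φ) :
    Continuous fun b => potTerm (fun x => V (x - b)) (ofTest hφ) := by
  have cφ := hφ.continuous
  have hsupp : HasCompactSupport fun z => φ (-z) ^ 2 :=
    (hφ.hasCompactSupport.comp_homeomorph (Homeomorph.neg _)).comp_left (g := (· ^ 2))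
      (zero_pow two_ne_zero)
  have hconv := hsupp.continuous_convolution_right (ContinuousLinearMap.mul ℝ ℝ)
    hV.locallyIntegrable (by fun_prop)
  refine (hconv.comp continuous_neg).congr fun b => ?_
  rw [potTerm_ofTest, ← integral_add_right_eq_self _ b, Function.comp_apply, convolution_mul]
  simp only [add_sub_cancel_right, neg_sub, sub_neg_eq_add]

end HardyPot

theorem tendsto_potTerm_cobounded {h : Sph N → ℝ} (hc : Continuous h) {φ : Eucl N → ℝ}
    (hφ : IsTest φ) :
    Tendsto (fun b => potTerm (polePot h b) (ofTest hφ)) (Bornology.cobounded _) (𝓝 0) := by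
  obtain ⟨M, hM, hbd⟩ := exists_abs_polePot_le hc
  obtain ⟨R, hR⟩ := hφ.hasCompactSupport.isCompact.isBounded.subset_closedBall 0
  have cφ := hφ.continuous
  have hsq : Integrable fun x => φ x ^ 2 :=
    Continuous.integrable_of_hasCompactSupport (by fun_prop)
      (hφ.hasCompactSupport.comp_left (g := (· ^ 2)) (zero_pow two_ne_zero))
  have hlim : Tendsto (fun b : Eucl N => (M * ((‖b‖ - R) ^ 2)⁻¹) * ∫ x, φ x ^ 2)
      (Bornology.cobounded _) (𝓝 0) := by
    have hpow : Tendsto (fun b : Eucl N => (‖b‖ - R) ^ 2) (Bornology.cobounded _) atTop :=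
      (tendsto_pow_atTop two_ne_zero).comp
        (tendsto_atTop_add_const_right _ (-R) tendsto_norm_cobounded_atTop)
    simpa only [Pi.inv_apply, mul_zero, zero_mul] using
      (hpow.inv_tendsto_atTop.const_mul M).mul_const (∫ x, φ x ^ 2)
  refine squeeze_zero_norm' ?_ hlim
  filter_upwards [tendsto_norm_cobounded_atTop.eventually_gt_atTop R] with b hb
  rw [potTerm_ofTest, ← integral_const_mul]
  refine norm_integral_le_of_norm_le (hsq.const_mul _) (Eventually.of_forall fun x => ?_)
  rw [norm_mul, norm_pow, Real.norm_eq_abs, Real.norm_eq_abs, sq_abs]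
  by_cases hx : φ x = 0
  · simp [hx]
  have hxR : ‖x‖ ≤ R := mem_closedBall_zero_iff.1 (hR (subset_tsupport _ hx))
  have hdist : ‖b‖ - R ≤ ‖x - b‖ := by
    have := norm_sub_norm_le b x
    rw [norm_sub_rev] at this
    linarith
  have : 0 < ‖b‖ - R := sub_pos.2 hb
  gcongr
  refine (hbd b x).trans ?_
  gcongr

end MovingPoles

section Constants

theorem iInf_div_mul_le {ι : Type*} {F G : ι → ℝ}
    (hbdd : BddBelow (Set.range fun i => F i / G i)) {i : ι} (hG : 0 < G i) :
    (⨅ i, F i / G i) * G i ≤ F i :=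
  (le_div_iff₀ hG).1 (ciInf_le hbdd i)

variable {N : ℕ} [hN : Fact (3 ≤ N)]

theorem D12.fn_zero : (0 : D12 N).fn = 0 := rfl

theorem potTerm_zero (V : Eucl N → ℝ) : potTerm V (0 : D12 N) = 0 := by
  refine integral_eq_zero_of_ae ?_
  filter_upwards [Lp.coeFn_zero ℝ (critE N) (volume : Measure (Eucl N))] with x hx
  rw [D12.fn_zero, hx, Pi.zero_apply, zero_pow two_ne_zero, mul_zero]

theorem norm_fn_sq_pos {u : D12 N} (hu : u ≠ 0) : 0 < ‖u.fn‖ ^ 2 :=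
  pow_pos (norm_pos_iff.2 fun h => hu (eq_zero_of_fn_eq_zero h)) 2

theorem SSob_nonneg : 0 ≤ SSob N := Real.iInf_nonneg fun _ => by positivity

theorem SSob_mul_le (u : D12 N) : SSob N * ‖u.fn‖ ^ 2 ≤ ‖u‖ ^ 2 := by
  obtain rfl | hu := eq_or_ne u 0
  · simp [D12.fn_zero]
  · exact iInf_div_mul_le (F := fun u : {u : D12 N // u ≠ 0} => ‖u.1‖ ^ 2)
      (i := ⟨u, hu⟩) ⟨0, by rintro _ ⟨u, rfl⟩; positivity⟩ (norm_fn_sq_pos hu)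

theorem SOne_eq (g : Sph N → ℝ) : SOne g = ⨅ u : {u : D12 N // u ≠ 0},
    (‖u.1‖ ^ 2 - potTerm (polePot g 0) u.1) / ‖u.1.fn‖ ^ 2 := by
  simp only [SOne, critTerm_rpow, dirichlet_eq, poleTerm_eq]

section OnePole

variable {g : Sph N → ℝ} (hg : ∀ u : D12 N, potTerm (polePot g 0) u ≤ ‖u‖ ^ 2)
include hg

theorem SOne_nonneg : 0 ≤ SOne g := by
  rw [SOne_eq]
  exact Real.iInf_nonneg fun u => div_nonneg (sub_nonneg.2 (hg u)) (sq_nonneg _)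

theorem SOne_mul_le (u : D12 N) : SOne g * ‖u.fn‖ ^ 2 ≤ ‖u‖ ^ 2 - potTerm (polePot g 0) u := by
  obtain rfl | hu := eq_or_ne u 0
  · simp [D12.fn_zero, potTerm_zero]
  · rw [SOne_eq]
    exact iInf_div_mul_le
      (F := fun u : {u : D12 N // u ≠ 0} => ‖u.1‖ ^ 2 - potTerm (polePot g 0) u.1)
      (i := ⟨u, hu⟩)
      ⟨0, by rintro _ ⟨u, rfl⟩; exact div_nonneg (sub_nonneg.2 (hg u)) (sq_nonneg _)⟩
      (norm_fn_sq_pos hu)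

end OnePole

section PositiveForm

variable {k : ℕ} {h : Fin k → Sph N → ℝ} {a : Fin k → Eucl N} (hpos : 0 < mu h a)
include hpos

theorem mu_mul_le_Q (u : D12 N) : mu h a * ‖u‖ ^ 2 ≤ Q h a u := by
  obtain rfl | hu := eq_or_ne u 0
  · simp [Q, dirichlet_eq, poleTerm_eq, potTerm_zero]
  · refine iInf_div_mul_le (F := fun u : {u : D12 N // u ≠ 0} => Q h a u.1) (i := ⟨u, hu⟩) ?_
      (pow_pos (norm_pos_iff.2 hu) 2)
    by_contra hunbdd
    exact hpos.ne' (Real.sInf_of_not_bddBelow hunbdd)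

theorem Q_nonneg (u : D12 N) : 0 ≤ Q h a u :=
  (mul_nonneg hpos.le (sq_nonneg _)).trans (mu_mul_le_Q hpos u)

theorem SMulti_pos : 0 < SMulti h a := by
  have hne : Nonempty {u : D12 N // u ≠ 0} := by
    by_contra hempty
    rw [not_nonempty_iff] at hempty
    exact hpos.ne' (Real.iInf_of_isEmpty _)
  let C := 1 + ‖fnL N‖
  have : 0 < C := by positivity
  refine (by positivity : 0 < mu h a / C ^ 2).trans_le (le_ciInf fun u => ?_)
  have hsob : ‖u.1.fn‖ ≤ C * ‖u.1‖ := ((fnL N).le_opNorm u.1).trans (by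
    gcongr
    exact le_add_of_nonneg_left zero_le_one)
  rw [critTerm_rpow, le_div_iff₀ (norm_fn_sq_pos u.2)]
  calc mu h a / C ^ 2 * ‖u.1.fn‖ ^ 2 ≤ mu h a / C ^ 2 * (C * ‖u.1‖) ^ 2 := by gcongr
    _ = mu h a * ‖u.1‖ ^ 2 := by rw [mul_pow, ← mul_assoc, div_mul_cancel₀ _ (by positivity)]
    _ ≤ Q h a u.1 := mu_mul_le_Q hpos u.1

/-- Evaluating `𝒬` on a test function concentrated at scale `s⁻¹` around `b` moves the poles to
`s (a_i - b)`. -/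
theorem sum_potTerm_le {φ : Eucl N → ℝ} (hφ : IsTest φ) {s : ℝ} (hs : 0 < s) (b : Eucl N) :
    ∑ i, potTerm (polePot (h i) (s • (a i - b))) (ofTest hφ) ≤ ‖ofTest hφ‖ ^ 2 := by
  have hQ := Q_nonneg hpos (ofTest (hφ.dilate (inv_pos.2 hs).ne' b))
  simp only [Q, dirichlet_eq, poleTerm_eq, potTerm_dilate _ hφ (inv_pos.2 hs),
    norm_sq_dilate hφ (inv_pos.2 hs), ← Finset.mul_sum, ← mul_sub, inv_inv] at hQ
  exact sub_nonneg.1 (nonneg_of_mul_nonneg_right hQ (by positivity))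

end PositiveForm

theorem HardyPot.potTerm_le_of_test {V : Eucl N → ℝ} (hV : HardyPot V)
    (htest : ∀ (φ : Eucl N → ℝ) (hφ : IsTest φ), potTerm V (ofTest hφ) ≤ ‖ofTest hφ‖ ^ 2)
    (u : D12 N) : potTerm V u ≤ ‖u‖ ^ 2 := by
  induction u using D12.induction_on_test with
  | hclosed => exact isClosed_le hV.continuous_potTerm (by fun_prop)
  | htest φ hφ => exact htest φ hφ

section MinLevel

variable {k : ℕ} {h : Fin k → Sph N → ℝ} {a : Fin k → Eucl N} (hc : ∀ i, Continuous (h i))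
include hc

theorem potTerm_le_of_concentration (ha : Function.Injective a) (hpos : 0 < mu h a) (i : Fin k)
    (u : D12 N) : potTerm (polePot (h i) 0) u ≤ ‖u‖ ^ 2 := by
  refine (hardyPot_polePot (hc i) 0).potTerm_le_of_test (fun φ hφ => ?_) u
  have hlim : Tendsto
      (fun s : ℝ => ∑ j, potTerm (polePot (h j) (s • (a j - a i))) (ofTest hφ)) atTop
      (𝓝 (∑ j, if j = i then potTerm (polePot (h i) 0) (ofTest hφ) else 0)) := by
    refine tendsto_finsetSum _ fun j _ => ?_
    split_ifs with hj
    · simp only [hj, sub_self, smul_zero, tendsto_const_nhds]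
    · refine (tendsto_potTerm_cobounded (hc j) hφ).comp
        (tendsto_norm_atTop_iff_cobounded.1 ?_)
      have hne : 0 < ‖a j - a i‖ := norm_pos_iff.2 (sub_ne_zero.2 fun haj => hj (ha haj))
      simpa only [norm_smul, Real.norm_eq_abs] using tendsto_abs_atTop_atTop.atTop_mul_const hne
  rw [Finset.sum_ite_eq' Finset.univ i, if_pos (Finset.mem_univ i)] at hlim
  refine le_of_tendsto hlim ?_
  filter_upwards [eventually_gt_atTop 0] with s hs using sum_potTerm_le hpos hφ hs (a i)

theorem hardyPot_polePot_sum (b : Eucl N) : HardyPot (polePot (∑ j, h j) b) := by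
  rw [funext (polePot_sum Finset.univ h b)]
  exact HardyPot.sum _ fun j _ => hardyPot_polePot (hc j) b

theorem potTerm_sum_le_of_spreading (hpos : 0 < mu h a) (u : D12 N) :
    potTerm (polePot (∑ j, h j) 0) u ≤ ‖u‖ ^ 2 := by
  refine (hardyPot_polePot_sum hc 0).potTerm_le_of_test (fun φ hφ => ?_) u
  rw [funext (polePot_sum Finset.univ h 0), potTerm_sum _ fun j _ => hardyPot_polePot (hc j) 0]
  have hcont : Continuous fun s : ℝ =>
      ∑ j, potTerm (polePot (h j) (s • (a j - 0))) (ofTest hφ) := by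
    refine continuous_finsetSum _ fun j _ => ?_
    have htrans := (hardyPot_polePot (hc j) 0).continuous_potTerm_translate hφ
    simp only [polePot, sub_zero] at htrans
    exact htrans.comp (by fun_prop : Continuous fun s : ℝ => s • (a j - 0))
  have hlim := hcont.continuousWithinAt (s := Set.Ioi 0) (x := 0)
  simp only [ContinuousWithinAt, zero_smul] at hlim
  refine le_of_tendsto hlim ?_
  filter_upwards [self_mem_nhdsWithin] with s hs using sum_potTerm_le hpos hφ hs 0

omit hc

theorem bddBelow_levels (h : Fin k → Sph N → ℝ) :
    BddBelow (insert (SSob N) (insert (SOne (∑ j, h j)) (Set.range fun i => SOne (h i)))) :=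
  (((Set.finite_range _).insert _).insert _).bddBelow

theorem minLevel_le_SSob (h : Fin k → Sph N → ℝ) : minLevel h ≤ SSob N :=
  csInf_le (bddBelow_levels h) (Set.mem_insert _ _)

theorem minLevel_le_SOne_sum (h : Fin k → Sph N → ℝ) : minLevel h ≤ SOne (∑ j, h j) :=
  csInf_le (bddBelow_levels h) (Set.mem_insert_of_mem _ (Set.mem_insert _ _))

theorem minLevel_le_SOne (h : Fin k → Sph N → ℝ) (i : Fin k) : minLevel h ≤ SOne (h i) :=
  csInf_le (bddBelow_levels h) (Set.mem_insert_of_mem _ (Set.mem_insert_of_mem _ ⟨i, rfl⟩))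

theorem minLevel_nonneg (hc : ∀ i, Continuous (h i)) (ha : Function.Injective a)
    (hpos : 0 < mu h a) : 0 ≤ minLevel h := by
  refine Real.sInf_nonneg ?_
  rintro _ (rfl | rfl | ⟨i, rfl⟩)
  · exact SSob_nonneg
  · exact SOne_nonneg (potTerm_sum_le_of_spreading hc hpos)
  · exact SOne_nonneg (potTerm_le_of_concentration hc ha hpos i)

end MinLevel

end Constants

section PolePerturbation

variable {N : ℕ}

/-- `V ≤ W` on `A`, up to a bounded function of compact support and an arbitrarily small multiple
of `|x|⁻²`. One parameter `R` bounds both the size and the support of the former, so that several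
such comparisons hold with the same `R`. -/
def LEModLocal (V W : Eucl N → ℝ) (A : Set (Eucl N)) : Prop :=
  ∀ ε > 0, ∀ᶠ R in atTop, ∀ x ∈ A,
    V x ≤ W x + R * (closedBall 0 R).indicator (fun _ => (1 : ℝ)) x + ε * (‖x‖ ^ 2)⁻¹

namespace LEModLocal

variable {V W : Eucl N → ℝ} {A B : Set (Eucl N)}

theorem mono_set (h : LEModLocal V W B) (hAB : A ⊆ B) : LEModLocal V W A := fun ε hε =>
  (h ε hε).mono fun _ hR x hx => hR x (hAB hx)

theorem of_exists (h : ∀ ε > 0, ∃ C R : ℝ, ∀ x ∈ A,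
    V x ≤ W x + C * (closedBall 0 R).indicator (fun _ => (1 : ℝ)) x + ε * (‖x‖ ^ 2)⁻¹) :
    LEModLocal V W A := fun ε hε => by
  obtain ⟨C, R, hCR⟩ := h ε hε
  filter_upwards [eventually_ge_atTop C, eventually_ge_atTop R, eventually_ge_atTop 0]
    with S hC hR hS x hx
  refine (hCR x hx).trans ?_
  have hind : (closedBall 0 R).indicator (fun _ => (1 : ℝ)) x ≤
      (closedBall 0 S).indicator (fun _ => (1 : ℝ)) x :=
    Set.indicator_le_indicator_of_subset (closedBall_subset_closedBall hR)
      (fun _ => zero_le_one) x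
  have : 0 ≤ (closedBall 0 R).indicator (fun _ => (1 : ℝ)) x :=
    Set.indicator_nonneg (fun _ _ => zero_le_one) x
  gcongr

theorem of_le_add_indicator {C R : ℝ} (h : ∀ x ∈ A,
    V x ≤ W x + C * (closedBall 0 R).indicator (fun _ => (1 : ℝ)) x) : LEModLocal V W A :=
  of_exists fun ε hε => ⟨C, R, fun x hx => (h x hx).trans (le_add_of_nonneg_right (by positivity))⟩

theorem sum {ι : Type*} {s : Finset ι} {V W : ι → Eucl N → ℝ}
    (h : ∀ i ∈ s, LEModLocal (V i) (W i) A) :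
    LEModLocal (fun x => ∑ i ∈ s, V i x) (fun x => ∑ i ∈ s, W i x) A := by
  refine of_exists fun ε hε => ?_
  have hδ : 0 < ε / (s.card + 1) := by positivity
  obtain ⟨R, hR⟩ := ((s.eventually_all).2 fun i hi => h i hi _ hδ).exists
  refine ⟨s.card * R, R, fun x hx => ?_⟩
  have hcard : s.card * (ε / (s.card + 1)) ≤ ε := by
    rw [← mul_div_assoc, div_le_iff₀ (by positivity)]
    linarith
  calc ∑ i ∈ s, V i x
      ≤ ∑ i ∈ s, (W i x + R * (closedBall 0 R).indicator (fun _ => (1 : ℝ)) x +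
          ε / (s.card + 1) * (‖x‖ ^ 2)⁻¹) := Finset.sum_le_sum fun i hi => hR i hi x hx
    _ = ∑ i ∈ s, W i x + s.card * R * (closedBall 0 R).indicator (fun _ => (1 : ℝ)) x +
          s.card * (ε / (s.card + 1)) * (‖x‖ ^ 2)⁻¹ := by
        simp only [Finset.sum_add_distrib, Finset.sum_const, nsmul_eq_mul, mul_assoc]
    _ ≤ _ := by gcongr

end LEModLocal

theorem exists_abs_polePot_le_of_le_norm_sub {h : Sph N → ℝ} (hc : Continuous h) {r : ℝ}
    (hr : 0 < r) : ∃ C : ℝ, 0 ≤ C ∧ ∀ a x, r ≤ ‖x - a‖ → |polePot h a x| ≤ C := by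
  obtain ⟨M, hM, hb⟩ := exists_abs_polePot_le hc
  refine ⟨M * (r ^ 2)⁻¹, by positivity, fun a x hx => (hb a x).trans ?_⟩
  gcongr

theorem polePot_eq_inv_norm_sq_mul (h : Sph N → ℝ) (b : Eucl N) {x : Eucl N} (hx : x ≠ 0) :
    polePot h b x = (‖x‖ ^ 2)⁻¹ * polePot h (‖x‖⁻¹ • b) (‖x‖⁻¹ • x) := by
  conv_lhs => rw [← smul_inv_smul₀ (norm_ne_zero_iff.2 hx) x, ← add_zero (‖x‖ • _)]
  rw [polePot_smul_add h (norm_pos_iff.2 hx), sub_zero]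

theorem exists_abs_polePot_sub_polePot_le {h : Sph N → ℝ} (hc : Continuous h) (b : Eucl N)
    {ε : ℝ} (hε : 0 < ε) : ∃ R : ℝ, 0 ≤ R ∧ ∀ x, R < ‖x‖ →
      |polePot h b x - polePot h 0 x| ≤ ε * (‖x‖ ^ 2)⁻¹ := by
  have hcont (z : Eucl N) (hz : z ∈ sphere (0 : Eucl N) 1) : ContinuousAt (polePot h 0) z := by
    have hz0 : z ≠ 0 := ne_zero_of_mem_unit_sphere ⟨z, hz⟩
    unfold polePot
    simp only [sub_zero]
    exact ((continuousOn_angular hc).continuousAt (isOpen_compl_singleton.mem_nhds hz0)).div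
      (by fun_prop) (by positivity)
  obtain ⟨δ, hδ, hunif⟩ := Metric.mem_uniformity_dist.1
    ((isCompact_sphere (0 : Eucl N) 1).uniformContinuousAt_of_continuousAt _ hcont
      (Metric.dist_mem_uniformity hε))
  refine ⟨‖b‖ / δ, by positivity, fun x hx => ?_⟩
  have hx0 : 0 < ‖x‖ := (by positivity : 0 ≤ ‖b‖ / δ).trans_lt hx
  have hdist : dist (‖x‖⁻¹ • x) (‖x‖⁻¹ • x - ‖x‖⁻¹ • b) < δ := by
    rwa [dist_eq_norm, sub_sub_cancel, norm_smul, norm_inv, norm_norm, inv_mul_lt_iff₀ hx0,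
      ← div_lt_iff₀ hδ]
  have hclose : dist (polePot h 0 (‖x‖⁻¹ • x)) (polePot h 0 (‖x‖⁻¹ • x - ‖x‖⁻¹ • b)) < ε :=
    hunif hdist (inv_norm_smul_mem_sphere (norm_pos_iff.1 hx0))
  rw [Real.dist_eq, abs_sub_comm] at hclose
  have htranslate : polePot h 0 (‖x‖⁻¹ • x - ‖x‖⁻¹ • b) =
      polePot h (‖x‖⁻¹ • b) (‖x‖⁻¹ • x) := by simp only [polePot, sub_zero]
  rw [polePot_eq_inv_norm_sq_mul h b (norm_pos_iff.1 hx0),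
    polePot_eq_inv_norm_sq_mul h 0 (norm_pos_iff.1 hx0), smul_zero, ← mul_sub, abs_mul,
    abs_of_nonneg (by positivity : 0 ≤ (‖x‖ ^ 2)⁻¹), mul_comm, ← htranslate]
  gcongr

theorem leModLocal_polePot_zero {h : Sph N → ℝ} (hc : Continuous h) (b : Eucl N) :
    LEModLocal (polePot h b) (polePot h 0) {x | 1 ≤ ‖x‖ ∧ 1 ≤ ‖x - b‖} := by
  refine LEModLocal.of_exists fun ε hε => ?_
  obtain ⟨C, -, hC⟩ := exists_abs_polePot_le_of_le_norm_sub hc one_pos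
  obtain ⟨R, -, hR⟩ := exists_abs_polePot_sub_polePot_le hc b hε
  refine ⟨2 * C, R, fun x ⟨hx, hxb⟩ => ?_⟩
  by_cases hxR : x ∈ closedBall 0 R
  · rw [Set.indicator_of_mem hxR, mul_one]
    have hb := (abs_le.1 (hC b x hxb)).2
    have h0 := (abs_le.1 (hC 0 x (by rwa [sub_zero]))).1
    have : 0 ≤ ε * (‖x‖ ^ 2)⁻¹ := by positivity
    linarith
  · rw [Set.indicator_of_notMem hxR, mul_zero, add_zero]
    have := (abs_le.1 (hR x (by simpa using hxR))).2
    linarith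

theorem leModLocal_totalPot_polePot_sum {k : ℕ} {h : Fin k → Sph N → ℝ} {a : Fin k → Eucl N}
    (hc : ∀ i, Continuous (h i)) {R : ℝ} (hR : 1 ≤ R) (ha : ∀ i, ‖a i‖ + 1 ≤ R) :
    LEModLocal (totalPot h a) (polePot (∑ j, h j) 0) (closedBall 0 R)ᶜ := by
  rw [funext (polePot_sum Finset.univ h 0)]
  refine LEModLocal.sum fun i _ => (leModLocal_polePot_zero (hc i) (a i)).mono_set fun x hx => ?_
  have hxR : R < ‖x‖ := by simpa using hx
  exact ⟨hR.trans hxR.le, by linarith [ha i, norm_sub_norm_le x (a i)]⟩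

end PolePerturbation

section CutOff

variable {N : ℕ} {k : ℕ} {h : Fin k → Sph N → ℝ} {a : Fin k → Eucl N}

/-- The potential of the poles `a_i`, `i ∈ s`, cut off outside the ball of radius `R`. -/
def cutPot (h : Fin k → Sph N → ℝ) (a : Fin k → Eucl N) (R : ℝ) (s : Finset (Fin k)) :
    Eucl N → ℝ :=
  (closedBall 0 R).indicator fun x => ∑ i ∈ s, polePot (h i) (a i) x

theorem leModLocal_cutPot_insert_compl_closedBall (hc : ∀ i, Continuous (h i)) {s : Finset (Fin k)}
    {i : Fin k} (hi : i ∉ s) (R : ℝ) {r : ℝ} (hr : 0 < r) :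
    LEModLocal (cutPot h a R (insert i s)) (cutPot h a R s) (closedBall (a i) r)ᶜ := by
  obtain ⟨C, -, hC⟩ := exists_abs_polePot_le_of_le_norm_sub (hc i) hr
  refine LEModLocal.of_le_add_indicator (C := C) (R := R) fun x hx => ?_
  rw [Set.mem_compl_iff, mem_closedBall, dist_eq_norm, not_le] at hx
  by_cases hxR : x ∈ closedBall 0 R
  · simp only [cutPot, Set.indicator_of_mem hxR, Finset.sum_insert hi, mul_one]
    linarith [(abs_le.1 (hC (a i) x hx.le)).2]
  · simp only [cutPot, Set.indicator_of_notMem hxR, mul_zero, add_zero, le_refl]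

theorem leModLocal_cutPot_insert_ball (hc : ∀ i, Continuous (h i)) {s : Finset (Fin k)}
    {i : Fin k} (hi : i ∉ s) {R r : ℝ} (hr : 0 < r) (hR : ‖a i‖ + 2 * r ≤ R)
    (hsep : ∀ j ∈ s, 3 * r ≤ ‖a i - a j‖) :
    LEModLocal (cutPot h a R (insert i s)) (polePot (h i) (a i)) (ball (a i) (2 * r)) := by
  choose C _ hC using fun j => exists_abs_polePot_le_of_le_norm_sub (hc j) hr
  refine LEModLocal.of_le_add_indicator (C := ∑ j ∈ s, C j) (R := R) fun x hx => ?_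
  rw [mem_ball, dist_eq_norm] at hx
  have hxR : x ∈ closedBall 0 R := by
    rw [mem_closedBall_zero_iff]
    linarith [norm_sub_norm_le x (a i)]
  rw [cutPot, Set.indicator_of_mem hxR, Set.indicator_of_mem hxR, Finset.sum_insert hi, mul_one]
  gcongr with j hj
  refine (le_abs_self _).trans (hC j (a j) x ?_)
  linarith [hsep j hj, norm_sub_le_norm_sub_add_norm_sub (a i) x (a j), norm_sub_rev (a i) x]

theorem exists_pos_forall_three_mul_le_norm_sub (ha : Function.Injective a) :
    ∃ r : ℝ, 0 < r ∧ r ≤ 1 ∧ ∀ i j, i ≠ j → 3 * r ≤ ‖a i - a j‖ := by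
  have hsep : ∀ᶠ r : ℝ in 𝓝 0, ∀ i j, i ≠ j → 3 * r ≤ ‖a i - a j‖ := by
    simp only [eventually_all]
    intro i j hij
    have hlim : Tendsto (fun r : ℝ => 3 * r) (𝓝 0) (𝓝 (3 * 0)) := tendsto_id.const_mul 3
    refine hlim.eventually_le_const ?_
    rw [mul_zero]
    exact norm_pos_iff.2 (sub_ne_zero.2 (ha.ne hij))
  obtain ⟨r, ⟨hr, hr₁⟩, hr₀⟩ := (((hsep.and (eventually_le_nhds one_pos)).filter_mono
    nhdsWithin_le_nhds).and self_mem_nhdsWithin : ∀ᶠ r in 𝓝[>] (0 : ℝ), _).exists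
  exact ⟨r, hr₀, hr₁, hr⟩

end CutOff

section Localization

theorem Lp_norm_sq_le_of_sq_eq_add {α : Type*} [MeasurableSpace α] {μ : Measure α} {p : ℝ≥0∞}
    (hp : 2 ≤ p) {f g k : Lp ℝ p μ} (h : ∀ᵐ x ∂μ, f x ^ 2 = g x ^ 2 + k x ^ 2) :
    ‖f‖ ^ 2 ≤ ‖g‖ ^ 2 + ‖k‖ ^ 2 := by
  have hone : 1 ≤ p / 2 := by
    rwa [ENNReal.le_div_iff_mul_le (by norm_num) (by norm_num), one_mul]
  have hsq (r : Lp ℝ p μ) :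
      eLpNorm (fun x => r x ^ 2) (p / 2) μ = ENNReal.ofReal (‖r‖ ^ 2) := by
    have h2 := eLpNorm_norm_rpow (μ := μ) (p := p / 2) r (two_pos : (0 : ℝ) < 2)
    rw [ENNReal.ofReal_ofNat, ENNReal.div_mul_cancel (by norm_num) (by norm_num)] at h2
    simp only [Real.rpow_ofNat, Real.norm_eq_abs, sq_abs] at h2
    rw [h2, Lp.norm_def, ENNReal.ofReal_pow ENNReal.toReal_nonneg,
      ENNReal.ofReal_toReal (Lp.eLpNorm_ne_top r), ENNReal.rpow_ofNat]
  rw [← ENNReal.ofReal_le_ofReal_iff (by positivity),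
    ENNReal.ofReal_add (by positivity) (by positivity), ← hsq, ← hsq, ← hsq, eLpNorm_congr_ae h]
  exact eLpNorm_add_le ((Lp.aestronglyMeasurable g).pow 2) ((Lp.aestronglyMeasurable k).pow 2) hone

section Pointwise

variable {N : ℕ} {φ θ : Eucl N → ℝ}

theorem IsTest.const_mul (hφ : IsTest φ) (c : ℝ) : IsTest (fun x => c * φ x) :=
  hφ.mul_smooth contDiff_const

theorem IsTest.cos_mul (hφ : IsTest φ) (hθ : IsTest θ) :
    IsTest (fun x => Real.cos (θ x) * φ x) :=
  hφ.mul_smooth (Real.contDiff_cos.comp hθ.smooth)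

theorem IsTest.sin_mul (hφ : IsTest φ) (hθ : IsTest θ) :
    IsTest (fun x => Real.sin (θ x) * φ x) :=
  hφ.mul_smooth (Real.contDiff_sin.comp hθ.smooth)

theorem gradient_comp_mul {f : ℝ → ℝ} {f' : ℝ} {x : Eucl N} (hf : HasDerivAt f f' (θ x))
    (hθ : DifferentiableAt ℝ θ x) (hφ : DifferentiableAt ℝ φ x) :
    gradient (fun x => f (θ x) * φ x) x = f (θ x) • gradient φ x + (φ x * f') • gradient θ x := by
  refine ext_inner_right ℝ fun v => ?_
  have hderiv : HasFDerivAt (fun x => f (θ x) * φ x) _ x :=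
    (hf.comp_hasFDerivAt x hθ.hasFDerivAt).fun_mul hφ.hasFDerivAt
  simp only [inner_add_left, real_inner_smul_left, inner_gradient_left]
  rw [hderiv.fderiv]
  simp [mul_assoc]

theorem norm_sq_gradient_cos_add_sin (hφ : IsTest φ) (hθ : IsTest θ) (x : Eucl N) :
    ‖gradient (fun x => Real.cos (θ x) * φ x) x‖ ^ 2 +
      ‖gradient (fun x => Real.sin (θ x) * φ x) x‖ ^ 2 =
      ‖gradient φ x‖ ^ 2 + ‖gradient θ x‖ ^ 2 * φ x ^ 2 := by
  rw [gradient_comp_mul (Real.hasDerivAt_cos _) (hθ.differentiable x) (hφ.differentiable x),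
    gradient_comp_mul (Real.hasDerivAt_sin _) (hθ.differentiable x) (hφ.differentiable x),
    norm_add_sq_real, norm_add_sq_real]
  simp only [norm_smul, real_inner_smul_left, real_inner_smul_right, mul_pow, Real.norm_eq_abs,
    sq_abs]
  linear_combination (‖gradient φ x‖ ^ 2 + ‖gradient θ x‖ ^ 2 * φ x ^ 2) *
    Real.sin_sq_add_cos_sq (θ x)

theorem IsTest.exists_norm_sq_gradient_le (hθ : IsTest θ) :
    ∃ K R : ℝ, 0 ≤ K ∧ ∀ x, ‖gradient θ x‖ ^ 2 ≤
      K * (closedBall 0 R).indicator (fun _ => (1 : ℝ)) x := by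
  obtain ⟨C, hC⟩ := hθ.hasCompactSupport_gradient.exists_bound_of_continuous hθ.continuous_gradient
  obtain ⟨R, hR⟩ := hθ.hasCompactSupport_gradient.isCompact.isBounded.subset_closedBall 0
  refine ⟨C ^ 2, R, sq_nonneg C, fun x => ?_⟩
  by_cases hx : x ∈ closedBall 0 R
  · rw [Set.indicator_of_mem hx, mul_one]
    gcongr
    exact hC x
  · rw [Set.indicator_of_notMem hx, image_eq_zero_of_notMem_tsupport fun h => hx (hR h), norm_zero]
    simp

theorem IsTest.integrable_norm_sq_gradient (hφ : IsTest φ) :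
    Integrable fun x => ‖gradient φ x‖ ^ 2 :=
  (hφ.memLp_gradient 2).integrable_norm_pow two_ne_zero

end Pointwise

section Gluing

variable {N : ℕ} [hN : Fact (3 ≤ N)]

theorem ballTerm_mono {R R' : ℝ} (hR : R ≤ R') (u : D12 N) : ballTerm R u ≤ ballTerm R' u :=
  setIntegral_mono_set (integrableOn_fn_sq R' u) (Eventually.of_forall fun _ => sq_nonneg _)
    (closedBall_subset_closedBall hR).eventuallyLE

variable {V W φ θ : Eucl N → ℝ}

theorem norm_fn_sq_le_cos_add_sin (hφ : IsTest φ) (hθ : IsTest θ) :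
    ‖(ofTest hφ).fn‖ ^ 2 ≤ ‖(ofTest (hφ.cos_mul hθ)).fn‖ ^ 2 +
      ‖(ofTest (hφ.sin_mul hθ)).fn‖ ^ 2 := by
  refine Lp_norm_sq_le_of_sq_eq_add (two_le_critE N) ?_
  filter_upwards [ofTest_fn hφ, ofTest_fn (hφ.cos_mul hθ), ofTest_fn (hφ.sin_mul hθ)]
    with x h hcos hsin
  rw [h, hcos, hsin]
  linear_combination -(φ x ^ 2) * Real.sin_sq_add_cos_sq (θ x)

theorem HardyPot.potTerm_cos_add_sin (hV : HardyPot V) (hφ : IsTest φ) (hθ : IsTest θ) :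
    potTerm V (ofTest (hφ.cos_mul hθ)) + potTerm V (ofTest (hφ.sin_mul hθ)) =
      potTerm V (ofTest hφ) := by
  rw [potTerm_ofTest, potTerm_ofTest, potTerm_ofTest,
    ← integral_add (hV.integrable_mul_test_sq _) (hV.integrable_mul_test_sq _)]
  · refine integral_congr_ae (.of_forall fun x => ?_)
    linear_combination V x * φ x ^ 2 * Real.sin_sq_add_cos_sq (θ x)
  · exact hφ.cos_mul hθ
  · exact hφ.sin_mul hθ

theorem IsTest.exists_norm_sq_cos_add_sin_le (hθ : IsTest θ) :
    ∃ K R : ℝ, 0 ≤ K ∧ ∀ (φ : Eucl N → ℝ) (hφ : IsTest φ),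
      ‖ofTest (hφ.cos_mul hθ)‖ ^ 2 + ‖ofTest (hφ.sin_mul hθ)‖ ^ 2 ≤
        ‖ofTest hφ‖ ^ 2 + K * ballTerm R (ofTest hφ) := by
  obtain ⟨K, R, hK, hgrad⟩ := hθ.exists_norm_sq_gradient_le
  refine ⟨K, R, hK, fun φ hφ => ?_⟩
  have hball := ((hardyPot_indicator_closedBall (N := N) R).integrable_mul_test_sq hφ).const_mul K
  have hcos := (hφ.cos_mul hθ).integrable_norm_sq_gradient
  have hsin := (hφ.sin_mul hθ).integrable_norm_sq_gradient
  rw [ballTerm_eq_potTerm, potTerm_ofTest, ofTest_norm_sq, ofTest_norm_sq, ofTest_norm_sq,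
    ← integral_add hcos hsin, ← integral_const_mul,
    ← integral_add hφ.integrable_norm_sq_gradient hball]
  refine integral_mono (hcos.add hsin) (hφ.integrable_norm_sq_gradient.add hball) fun x => ?_
  simp only [norm_sq_gradient_cos_add_sin hφ hθ, ← mul_assoc]
  gcongr
  exact hgrad x

theorem HardyPot.potTerm_ofTest_le (hV : HardyPot V) (hW : HardyPot W) {R δ : ℝ}
    (hφ : IsTest φ) (h : ∀ x ∈ Function.support φ,
      V x ≤ W x + R * (closedBall 0 R).indicator (fun _ => (1 : ℝ)) x + δ * (‖x‖ ^ 2)⁻¹) :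
    potTerm V (ofTest hφ) ≤ potTerm W (ofTest hφ) + R * ballTerm R (ofTest hφ) +
      δ * potTerm (fun x => (‖x - 0‖ ^ 2)⁻¹) (ofTest hφ) := by
  have hball := ((hardyPot_indicator_closedBall (N := N) R).integrable_mul_test_sq hφ).const_mul R
  have hinv := ((hardyPot_inv_sq (N := N) 0).integrable_mul_test_sq hφ).const_mul δ
  have hWball := (hW.integrable_mul_test_sq hφ).add hball
  rw [ballTerm_eq_potTerm]
  simp only [potTerm_ofTest]
  rw [← integral_const_mul, ← integral_const_mul,
    ← integral_add (hW.integrable_mul_test_sq hφ) hball]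
  refine (integral_mono (hV.integrable_mul_test_sq hφ) (hWball.add hinv) fun x => ?_).trans_eq
    (integral_add hWball hinv)
  by_cases hx : φ x = 0
  · simp [hx]
  · calc V x * φ x ^ 2 ≤ _ * φ x ^ 2 := mul_le_mul_of_nonneg_right (h x hx) (sq_nonneg _)
      _ = _ := by simp only [Pi.add_apply, sub_zero]; ring

/-- The Sobolev-type inequality `m ‖u‖²_{L^{2*}} ≤ ∫ |∇u|² - ∫ V u²` for test functions living on
`A`, up to errors which are negligible along bounded weakly null sequences. As in `LEModLocal`,
a single parameter `R` bounds both the coefficient and the radius in the compact error term. -/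
def SobolevModLocal (m : ℝ) (V : Eucl N → ℝ) (A : Set (Eucl N)) : Prop :=
  ∀ ε > 0, ∀ᶠ R in atTop, ∀ (φ : Eucl N → ℝ) (hφ : IsTest φ), Function.support φ ⊆ A →
    m * ‖(ofTest hφ).fn‖ ^ 2 ≤ ‖ofTest hφ‖ ^ 2 - potTerm V (ofTest hφ) +
      R * ballTerm R (ofTest hφ) + ε * ‖ofTest hφ‖ ^ 2

namespace SobolevModLocal

variable {m : ℝ} {A B : Set (Eucl N)}

theorem of_exists (h : ∀ ε > 0, ∃ C R : ℝ, ∀ (φ : Eucl N → ℝ) (hφ : IsTest φ),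
    Function.support φ ⊆ A → m * ‖(ofTest hφ).fn‖ ^ 2 ≤ ‖ofTest hφ‖ ^ 2 - potTerm V (ofTest hφ) +
      C * ballTerm R (ofTest hφ) + ε * ‖ofTest hφ‖ ^ 2) : SobolevModLocal m V A := fun ε hε => by
  obtain ⟨C, R, hCR⟩ := h ε hε
  filter_upwards [eventually_ge_atTop C, eventually_ge_atTop R, eventually_ge_atTop 0]
    with S hC hR hS φ hφ hφA
  have := ballTerm_nonneg R (ofTest hφ)
  have hmono := ballTerm_mono hR (ofTest hφ)
  exact (hCR φ hφ hφA).trans (by gcongr)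

theorem of_forall_le (h : ∀ (φ : Eucl N → ℝ) (hφ : IsTest φ),
    m * ‖(ofTest hφ).fn‖ ^ 2 ≤ ‖ofTest hφ‖ ^ 2 - potTerm V (ofTest hφ)) : SobolevModLocal m V A :=
  of_exists fun ε hε => ⟨0, 0, fun φ hφ _ => by
    rw [zero_mul, add_zero]
    exact (h φ hφ).trans (le_add_of_nonneg_right (by positivity))⟩

theorem mono_set (h : SobolevModLocal m V B) (hAB : A ⊆ B) : SobolevModLocal m V A :=
  fun ε hε => (h ε hε).mono fun _ hR φ hφ hφA => hR φ hφ (hφA.trans hAB)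

theorem of_leModLocal (h : SobolevModLocal m W A) (hV : HardyPot V) (hW : HardyPot W)
    (hVW : LEModLocal V W A) : SobolevModLocal m V A := by
  refine of_exists fun ε hε => ?_
  obtain ⟨H, hH, hardy⟩ := (hardyPot_inv_sq (N := N) 0).exists_abs_potTerm_le
  obtain ⟨R, hR, hle⟩ :=
    ((h (ε / 2) (by positivity)).and (hVW (ε / 2 / (H + 1)) (by positivity))).exists
  refine ⟨2 * R, R, fun φ hφ hφA => ?_⟩
  have hpot := hV.potTerm_ofTest_le hW hφ fun x hx => hle x (hφA hx)
  have hsmall : ε / 2 / (H + 1) * potTerm (fun x => (‖x - 0‖ ^ 2)⁻¹) (ofTest hφ) ≤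
      ε / 2 * ‖ofTest hφ‖ ^ 2 := by
    rw [div_mul_eq_mul_div, div_le_iff₀ (by positivity), mul_assoc]
    gcongr
    linarith [le_of_abs_le (hardy (ofTest hφ)), sq_nonneg ‖ofTest hφ‖]
  linarith [hR φ hφ hφA]

/-- The IMS localization formula with the partition of unity `cos² θ + sin² θ = 1`: the
error `|∇θ|²` has compact support. -/
theorem of_cos_of_sin (hm : 0 ≤ m) (hV : HardyPot V) (hθ : IsTest θ)
    (hcos : SobolevModLocal m V {x | Real.cos (θ x) ≠ 0})
    (hsin : SobolevModLocal m V {x | Real.sin (θ x) ≠ 0}) : SobolevModLocal m V Set.univ := by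
  refine of_exists fun ε hε => ?_
  obtain ⟨K, R₀, hK, hIMS⟩ := hθ.exists_norm_sq_cos_add_sin_le
  obtain ⟨R, hR, hR'⟩ := ((((hcos ε hε).and (hsin ε hε)).and (eventually_ge_atTop R₀))).exists
  refine ⟨(1 + ε) * K + R, R, fun φ hφ _ => ?_⟩
  have hc := hR.1 _ (hφ.cos_mul hθ) fun x hx => left_ne_zero_of_mul hx
  have hs := hR.2 _ (hφ.sin_mul hθ) fun x hx => left_ne_zero_of_mul hx
  have hpot := hV.potTerm_cos_add_sin hφ hθ
  have hball := (hardyPot_indicator_closedBall (N := N) R).potTerm_cos_add_sin hφ hθ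
  simp only [← ballTerm_eq_potTerm] at hball
  have hgrad : ‖ofTest (hφ.cos_mul hθ)‖ ^ 2 + ‖ofTest (hφ.sin_mul hθ)‖ ^ 2 ≤
      ‖ofTest hφ‖ ^ 2 + K * ballTerm R (ofTest hφ) :=
    (hIMS φ hφ).trans (by gcongr; exact ballTerm_mono hR' _)
  calc m * ‖(ofTest hφ).fn‖ ^ 2
      ≤ m * (‖(ofTest (hφ.cos_mul hθ)).fn‖ ^ 2 + ‖(ofTest (hφ.sin_mul hθ)).fn‖ ^ 2) := by
        gcongr
        exact norm_fn_sq_le_cos_add_sin hφ hθ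
    _ ≤ (1 + ε) * (‖ofTest (hφ.cos_mul hθ)‖ ^ 2 + ‖ofTest (hφ.sin_mul hθ)‖ ^ 2) -
          potTerm V (ofTest hφ) + R * ballTerm R (ofTest hφ) := by
        rw [← hpot, ← hball]
        linarith
    _ ≤ (1 + ε) * (‖ofTest hφ‖ ^ 2 + K * ballTerm R (ofTest hφ)) -
          potTerm V (ofTest hφ) + R * ballTerm R (ofTest hφ) := by gcongr
    _ = _ := by ring

theorem of_compl_closedBall_of_ball (hm : 0 ≤ m) (hV : HardyPot V) {c : Eucl N} {r r' : ℝ}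
    (hr : 0 < r) (hr' : r < r') (hout : SobolevModLocal m V (closedBall c r)ᶜ)
    (hin : SobolevModLocal m V (ball c r')) : SobolevModLocal m V Set.univ := by
  let b : ContDiffBump c := ⟨r, r', hr, hr'⟩
  have hb : IsTest (b : Eucl N → ℝ) := ⟨b.contDiff, b.hasCompactSupport⟩
  refine of_cos_of_sin hm hV (hb.const_mul (Real.pi / 2)) (hout.mono_set fun x hx hxr => hx ?_)
    (hin.mono_set fun x hx => ?_)
  · rw [b.one_of_mem_closedBall hxr, mul_one, Real.cos_pi_div_two]
  · by_contra hxr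
    refine hx ?_
    rw [b.zero_of_le_dist (not_lt.1 hxr), mul_zero, Real.sin_zero]

end SobolevModLocal

end Gluing

section Poles

variable {N : ℕ} [hN : Fact (3 ≤ N)] {k : ℕ} {h : Fin k → Sph N → ℝ} {a : Fin k → Eucl N}

theorem sobolevModLocal_zero {m : ℝ} (hm : m ≤ SSob N) (A : Set (Eucl N)) :
    SobolevModLocal m (fun _ => 0) A := by
  refine SobolevModLocal.of_forall_le fun φ hφ => ?_
  simp only [potTerm, zero_mul, integral_zero, sub_zero]
  exact (mul_le_mul_of_nonneg_right hm (sq_nonneg _)).trans (SSob_mul_le _)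

theorem sobolevModLocal_polePot {g : Sph N → ℝ} {m : ℝ} (hm : m ≤ SOne g)
    (hg : ∀ u : D12 N, potTerm (polePot g 0) u ≤ ‖u‖ ^ 2) (b : Eucl N) (A : Set (Eucl N)) :
    SobolevModLocal m (polePot g b) A := by
  refine SobolevModLocal.of_forall_le fun φ hφ => ?_
  have hsob := SOne_mul_le hg (ofTest (hφ.dilate one_ne_zero (-b)))
  rw [norm_fn_translate hφ, norm_sq_dilate hφ one_pos, potTerm_dilate g hφ one_pos] at hsob
  simp only [one_pow, inv_one, mul_one, one_mul, one_smul, zero_sub, neg_neg] at hsob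
  exact (mul_le_mul_of_nonneg_right hm (sq_nonneg _)).trans hsob

theorem hardyPot_cutPot (hc : ∀ i, Continuous (h i)) (a : Fin k → Eucl N) (R : ℝ)
    (s : Finset (Fin k)) : HardyPot (cutPot h a R s) :=
  (HardyPot.sum s fun i _ => hardyPot_polePot (hc i) (a i)).indicator measurableSet_closedBall

theorem sobolevModLocal_cutPot (hc : ∀ i, Continuous (h i)) (ha : Function.Injective a)
    (hpos : 0 < mu h a) {R : ℝ} (hR : ∀ i, ‖a i‖ + 2 ≤ R) (s : Finset (Fin k)) :
    SobolevModLocal (minLevel h) (cutPot h a R s) Set.univ := by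
  obtain ⟨r, hr, hr₁, hsep⟩ := exists_pos_forall_three_mul_le_norm_sub ha
  induction s using Finset.induction_on with
  | empty =>
    have hempty : cutPot h a R ∅ = fun _ => 0 := by
      simp only [cutPot, Finset.sum_empty, Set.indicator_zero]
    rw [hempty]
    exact sobolevModLocal_zero (minLevel_le_SSob h) _
  | insert i s hi ih =>
    have hins := hardyPot_cutPot hc a R (insert i s)
    refine SobolevModLocal.of_compl_closedBall_of_ball (minLevel_nonneg hc ha hpos) hins
      (c := a i) hr (by linarith : r < 2 * r) ?_ ?_
    · exact (ih.mono_set (Set.subset_univ _)).of_leModLocal hins (hardyPot_cutPot hc a R s)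
        (leModLocal_cutPot_insert_compl_closedBall hc hi R hr)
    · exact (sobolevModLocal_polePot (minLevel_le_SOne h i)
        (potTerm_le_of_concentration hc ha hpos i) (a i) _).of_leModLocal hins
        (hardyPot_polePot (hc i) (a i)) (leModLocal_cutPot_insert_ball hc hi hr
          (by linarith [hR i]) fun j hj => hsep i j (ne_of_mem_of_not_mem hj hi).symm)

theorem sobolevModLocal_totalPot (hc : ∀ i, Continuous (h i)) (ha : Function.Injective a)
    (hpos : 0 < mu h a) : SobolevModLocal (minLevel h) (totalPot h a) Set.univ := by
  set R := ∑ i, ‖a i‖ + 2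
  have hsum : 0 ≤ ∑ i, ‖a i‖ := Finset.sum_nonneg fun i _ => norm_nonneg _
  have hR (i) : ‖a i‖ + 2 ≤ R := by
    have := Finset.single_le_sum (fun j _ => norm_nonneg (a j)) (Finset.mem_univ i)
    linarith
  have htot := hardyPot_totalPot hc a
  refine SobolevModLocal.of_compl_closedBall_of_ball (minLevel_nonneg hc ha hpos) htot
    (c := 0) (r := R) (r' := R + 1) (by positivity) (lt_add_one R) ?_ ?_
  · exact (sobolevModLocal_polePot (minLevel_le_SOne_sum h)
      (potTerm_sum_le_of_spreading hc hpos) 0 _).of_leModLocal htot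
      (hardyPot_polePot_sum hc 0)
      (leModLocal_totalPot_polePot_sum hc (by linarith) fun i => by linarith [hR i])
  · refine ((sobolevModLocal_cutPot hc ha hpos (R := R + 1) (fun i => by linarith [hR i])
      Finset.univ).mono_set (Set.subset_univ _)).of_leModLocal htot (hardyPot_cutPot hc a _ _)
      (LEModLocal.of_le_add_indicator (C := 0) (R := 0) fun x hx => ?_)
    rw [cutPot, Set.indicator_of_mem (ball_subset_closedBall hx), zero_mul, add_zero, totalPot]

theorem exists_minLevel_mul_le (hc : ∀ i, Continuous (h i)) (ha : Function.Injective a)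
    (hpos : 0 < mu h a) {ε : ℝ} (hε : 0 < ε) : ∃ R : ℝ, ∀ u : D12 N,
      minLevel h * ‖u.fn‖ ^ 2 ≤ Q h a u + R * ballTerm R u + ε * ‖u‖ ^ 2 := by
  obtain ⟨R, hR⟩ := (sobolevModLocal_totalPot hc ha hpos ε hε).exists
  refine ⟨R, fun u => ?_⟩
  rw [Q_eq hc, ballTerm_eq_potTerm]
  induction u using D12.induction_on_test with
  | hclosed =>
    have := (hardyPot_totalPot hc a).continuous_potTerm
    have := (hardyPot_indicator_closedBall (N := N) R).continuous_potTerm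
    have := (continuous_fn (N := N))
    exact isClosed_le (by fun_prop) (by fun_prop)
  | htest φ hφ =>
    rw [← ballTerm_eq_potTerm]
    exact hR φ hφ (Set.subset_univ _)

end Poles

end Localization

section PalaisSmale

theorem le_div_add_one_of_mul_sq_le {α A D t : ℝ} (hα : 0 < α) (hA : 0 ≤ A) (hD : 0 ≤ D)
    (h : α * t ^ 2 ≤ A + D * t) : t ≤ (A + D) / α + 1 := by
  obtain ht | ht := le_total t 1
  · have : 0 ≤ (A + D) / α := by positivity
    linarith
  · have : t ≤ (A + D) / α := by
      rw [le_div_iff₀ hα]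
      nlinarith [mul_le_mul_of_nonneg_left ht hA]
    linarith

variable {N : ℕ} [hN : Fact (3 ≤ N)]

theorem rpow_mul_rpow_le_of_mul_rpow_le {m Λ l : ℝ} (hm : 0 ≤ m) (hΛ : 0 < Λ) (hl : 0 < l)
    (h : m * (l / Λ) ^ (2 / crit N) ≤ l) :
    Λ ^ (1 - (N : ℝ) / 2) * m ^ ((N : ℝ) / 2) ≤ l := by
  have hN₀ : (0 : ℝ) < N := by linarith [three_le_cast N]
  have hexp : 2 / crit N * ((N : ℝ) / 2) = N / 2 - 1 := by
    rw [two_div_crit]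
    field_simp
  have hpow : m ^ ((N : ℝ) / 2) * (l ^ ((N : ℝ) / 2 - 1) / Λ ^ ((N : ℝ) / 2 - 1))
      ≤ l ^ ((N : ℝ) / 2 - 1) * l := by
    have hrpow := Real.rpow_le_rpow (by positivity) h (by positivity : (0 : ℝ) ≤ N / 2)
    rwa [Real.mul_rpow hm (by positivity), ← Real.rpow_mul (by positivity), hexp,
      Real.div_rpow hl.le hΛ.le, ← sub_add_cancel ((N : ℝ) / 2) 1, Real.rpow_add_one hl.ne',
      sub_add_cancel] at hrpow
  have hΛpow : Λ ^ (1 - (N : ℝ) / 2) = (Λ ^ ((N : ℝ) / 2 - 1))⁻¹ := by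
    rw [← Real.rpow_neg hΛ.le, neg_sub]
  have : 0 < l ^ ((N : ℝ) / 2 - 1) := by positivity
  refine le_of_mul_le_mul_left ?_ this
  calc l ^ ((N : ℝ) / 2 - 1) * (Λ ^ (1 - (N : ℝ) / 2) * m ^ ((N : ℝ) / 2))
      = m ^ ((N : ℝ) / 2) * (l ^ ((N : ℝ) / 2 - 1) / Λ ^ ((N : ℝ) / 2 - 1)) := by
        rw [hΛpow]
        ring
    _ ≤ l ^ ((N : ℝ) / 2 - 1) * l := hpow

variable {k : ℕ} {h : Fin k → Sph N → ℝ} {a : Fin k → Eucl N}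

theorem Q_sub (hc : ∀ i, Continuous (h i)) (u v : D12 N) :
    Q h a (u - v) = Q h a u - 2 * (hardyPot_totalPot hc a).form v u + Q h a v := by
  simp only [Q_eq hc, ← HardyPot.form_self (hardyPot_totalPot hc a), map_sub, sub_apply,
    HardyPot.form_comm _ u v]
  ring

theorem fderiv_J_add_apply (hc : ∀ i, Continuous (h i)) (u w : D12 N) :
    fderiv ℝ (J h a) (u + w) w = Q h a w + (hardyPot_totalPot hc a).form u w -
      SMulti h a * ∫ x, dualPow (crit N) ((u + w).fn x) * w.fn x := by
  rw [fderiv_J_apply hc, map_add, add_apply, HardyPot.form_self, ← Q_eq hc]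
  ring

theorem J_sub_fderiv_J_self (hc : ∀ i, Continuous (h i)) (u : D12 N) :
    J h a u - (crit N)⁻¹ * fderiv ℝ (J h a) u u = (N : ℝ)⁻¹ * Q h a u := by
  have hself : ∫ x, dualPow (crit N) (u.fn x) * u.fn x = critTerm u := by
    simp only [dualPow_mul_self (crit_pos N).ne', critTerm]
  have hQ : Q h a u = dirichlet u - ∑ i, poleTerm (h i) (a i) u := rfl
  rw [fderiv_J_apply hc, hself, HardyPot.form_self, ← Q_eq hc, J, div_eq_mul_inv]
  linear_combination (-1 / 2 : ℝ) * hQ - Q h a u * crit_inv N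

theorem tendsto_zero_of_tendsto_Q (hpos : 0 < mu h a) {w : ℕ → D12 N}
    (hw : Tendsto (fun n => Q h a (w n)) atTop (𝓝 0)) : Tendsto w atTop (𝓝 0) := by
  have hsq : Tendsto (fun n => ‖w n‖ ^ 2) atTop (𝓝 0) := by
    refine squeeze_zero (fun n => sq_nonneg _) (fun n => ?_) (by simpa using hw.div_const (mu h a))
    rw [le_div_iff₀ hpos, mul_comm]
    exact mu_mul_le_Q hpos (w n)
  rw [tendsto_zero_iff_norm_tendsto_zero]
  simpa only [Real.sqrt_sq (norm_nonneg _), Real.sqrt_zero] using hsq.sqrt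

theorem minLevel_mul_rpow_le (hc : ∀ i, Continuous (h i)) (ha : Function.Injective a)
    (hpos : 0 < mu h a) {w : ℕ → D12 N} {K l κ : ℝ} (hK : ∀ n, ‖w n‖ ≤ K)
    (hball : ∀ R, Tendsto (fun n => ballTerm R (w n)) atTop (𝓝 0))
    (hQ : Tendsto (fun n => Q h a (w n)) atTop (𝓝 l))
    (hcrit : Tendsto (fun n => critTerm (w n)) atTop (𝓝 κ)) :
    minLevel h * κ ^ (2 / crit N) ≤ l := by
  have hnorm : Tendsto (fun n => ‖(w n).fn‖ ^ 2) atTop (𝓝 (κ ^ (2 / crit N))) := by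
    simpa only [critTerm_rpow] using
      hcrit.rpow_const (p := 2 / crit N) (Or.inr (div_nonneg zero_le_two (crit_pos N).le))
  have hε (ε : ℝ) (hε : 0 < ε) : minLevel h * κ ^ (2 / crit N) ≤ l + ε * K ^ 2 := by
    obtain ⟨R, hR⟩ := exists_minLevel_mul_le hc ha hpos hε
    have hlim := (hQ.add ((hball R).const_mul R)).add_const (ε * K ^ 2)
    rw [mul_zero, add_zero] at hlim
    refine le_of_tendsto_of_tendsto' (hnorm.const_mul _) hlim fun n => (hR (w n)).trans ?_
    gcongr
    exact hK n
  have hlim : Tendsto (fun ε : ℝ => l + ε * K ^ 2) (𝓝[>] 0) (𝓝 l) :=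
    tendsto_nhdsWithin_of_tendsto_nhds (Continuous.tendsto' (by fun_prop) _ _ (by simp))
  exact ge_of_tendsto hlim (eventually_mem_nhdsWithin.mono hε)

namespace IsPalaisSmale

variable {u : ℕ → D12 N} {c K : ℝ} {s : ℕ → ℕ} {u₀ : D12 N}

theorem exists_norm_le (hu : IsPalaisSmale h a u c) (hc : ∀ i, Continuous (h i))
    (hpos : 0 < mu h a) : ∃ K, ∀ n, ‖u n‖ ≤ K := by
  obtain ⟨A, hA⟩ := hu.1.norm.bddAbove_range
  obtain ⟨D, hD⟩ := hu.2.norm.bddAbove_range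
  have : (0 : ℝ) < N := by linarith [three_le_cast N]
  have := crit_pos N
  refine ⟨(|A| + (crit N)⁻¹ * |D|) / ((N : ℝ)⁻¹ * mu h a) + 1, fun n =>
    le_div_add_one_of_mul_sq_le (by positivity) (abs_nonneg A) (by positivity) ?_⟩
  have hJ : J h a (u n) ≤ |A| :=
    (le_abs_self _).trans ((hA ⟨n, rfl⟩).trans (le_abs_self A))
  have hJ' : -(fderiv ℝ (J h a) (u n) (u n)) ≤ |D| * ‖u n‖ := by
    refine (neg_le_abs _).trans (((fderiv ℝ (J h a) (u n)).le_opNorm (u n)).trans ?_)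
    gcongr
    exact (hD ⟨n, rfl⟩).trans (le_abs_self D)
  calc (N : ℝ)⁻¹ * mu h a * ‖u n‖ ^ 2 = (N : ℝ)⁻¹ * (mu h a * ‖u n‖ ^ 2) := mul_assoc _ _ _
    _ ≤ (N : ℝ)⁻¹ * Q h a (u n) := by
      gcongr
      exact mu_mul_le_Q hpos (u n)
    _ = J h a (u n) + (crit N)⁻¹ * -(fderiv ℝ (J h a) (u n) (u n)) := by
      rw [← J_sub_fderiv_J_self hc]
      ring
    _ ≤ |A| + (crit N)⁻¹ * (|D| * ‖u n‖) := by gcongr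
    _ = |A| + (crit N)⁻¹ * |D| * ‖u n‖ := by rw [mul_assoc]

theorem tendsto_fderiv_apply (hu : IsPalaisSmale h a u c) (hs : StrictMono s) {v : ℕ → D12 N}
    (hv : ∀ n, ‖v n‖ ≤ K) : Tendsto (fun n => fderiv ℝ (J h a) (u (s n)) (v n)) atTop (𝓝 0) := by
  have hlim := (hu.2.norm.comp hs.tendsto_atTop).mul_const K
  rw [norm_zero, zero_mul] at hlim
  exact squeeze_zero_norm (fun n => ((fderiv ℝ (J h a) (u (s n))).le_opNorm (v n)).trans
    (mul_le_mul_of_nonneg_left (hv n) (norm_nonneg _))) hlim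

theorem tendsto_Q (hu : IsPalaisSmale h a u c) (hc : ∀ i, Continuous (h i)) (hs : StrictMono s)
    (hK : ∀ n, ‖u n‖ ≤ K) : Tendsto (fun n => Q h a (u (s n))) atTop (𝓝 (N * c)) := by
  have hN₀ : (N : ℝ) ≠ 0 := by linarith [three_le_cast N]
  have hlim := ((hu.1.comp hs.tendsto_atTop).sub ((hu.tendsto_fderiv_apply hs
    (v := fun n => u (s n)) fun n => hK (s n)).const_mul (crit N)⁻¹)).const_mul (N : ℝ)
  rw [mul_zero, sub_zero] at hlim
  refine hlim.congr fun n => ?_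
  rw [Function.comp_apply, J_sub_fderiv_J_self hc, mul_inv_cancel_left₀ hN₀]

theorem tendsto_Q_sub (hu : IsPalaisSmale h a u c) (hc : ∀ i, Continuous (h i))
    (hs : StrictMono s) (hK : ∀ n, ‖u n‖ ≤ K)
    (hweak : ∀ f : D12 N →L[ℝ] ℝ, Tendsto (fun n => f (u (s n))) atTop (𝓝 (f u₀))) :
    Tendsto (fun n => Q h a (u (s n) - u₀)) atTop (𝓝 (N * c - Q h a u₀)) := by
  have hlim := ((hu.tendsto_Q hc hs hK).sub
    ((hweak ((hardyPot_totalPot hc a).form u₀)).const_mul 2)).add_const (Q h a u₀)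
  simp only [← Q_sub hc, HardyPot.form_self, ← Q_eq hc] at hlim
  convert hlim using 2
  ring

theorem tendsto_critTerm_sub (hu : IsPalaisSmale h a u c) (hc : ∀ i, Continuous (h i))
    (hpos : 0 < mu h a) (hs : StrictMono s) {l : ℝ} (hK : ∀ n, ‖u (s n) - u₀‖ ≤ K)
    (hweak : ∀ f : D12 N →L[ℝ] ℝ, Tendsto (fun n => f (u (s n) - u₀)) atTop (𝓝 0))
    (hQ : Tendsto (fun n => Q h a (u (s n) - u₀)) atTop (𝓝 l)) :
    Tendsto (fun n => critTerm (u (s n) - u₀)) atTop (𝓝 (l / SMulti h a)) := by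
  have hlim := (((hQ.add (hweak ((hardyPot_totalPot hc a).form u₀))).sub
    (hu.tendsto_fderiv_apply hs hK)).div_const (SMulti h a)).sub
    (tendsto_dualPow_sub_critTerm u₀ hK (tendsto_ballTerm hK hweak))
  simp only [add_zero, sub_zero] at hlim
  refine hlim.congr fun n => ?_
  have hderiv := fderiv_J_add_apply (a := a) hc u₀ (u (s n) - u₀)
  simp only [add_sub_cancel] at hderiv ⊢
  have := (SMulti_pos hpos).ne'
  rw [hderiv]
  field_simp
  ring

end IsPalaisSmale

end PalaisSmale

end MultiSing

end

open MultiSing in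
theorem mainTheorem4_general {N : ℕ} [Fact (3 ≤ N)] {k : ℕ}
    (h : Fin k → Sph N → ℝ) (hcont : ∀ i, Continuous (h i))
    (a : Fin k → Eucl N) (ha : Function.Injective a) (hpos : 0 < mu h a)
    (u : ℕ → D12 N) (c : ℝ) (hu : IsPalaisSmale h a u c)
    (hc : c < 1 / (N : ℝ) * SMulti h a ^ (1 - (N : ℝ) / 2) * minLevel h ^ ((N : ℝ) / 2)) :
    ∃ s : ℕ → ℕ, StrictMono s ∧ ∃ u₀ : D12 N, Tendsto (fun n => u (s n)) atTop (𝓝 u₀) := by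
  obtain ⟨K, hK⟩ := hu.exists_norm_le hcont hpos
  obtain ⟨s, u₀, hs, hweak⟩ := exists_weakly_convergent_subseq hK
  refine ⟨s, hs, u₀, tendsto_sub_nhds_zero_iff.1 (tendsto_zero_of_tendsto_Q hpos ?_)⟩
  have hwK (n : ℕ) : ‖u (s n) - u₀‖ ≤ K + ‖u₀‖ := (norm_sub_le _ _).trans (by gcongr; exact hK _)
  have hw (f : D12 N →L[ℝ] ℝ) : Tendsto (fun n => f (u (s n) - u₀)) atTop (𝓝 0) := by
    simpa only [map_sub, sub_self] using (hweak f).sub_const (f u₀)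
  have hQ := hu.tendsto_Q_sub hcont hs hK hweak
  have hcrit := hu.tendsto_critTerm_sub hcont hpos hs hwK hw hQ
  have hlevel := minLevel_mul_rpow_le hcont ha hpos hwK (tendsto_ballTerm hwK hw) hQ hcrit
  have hlimit : 0 ≤ N * c - Q h a u₀ := ge_of_tendsto' hQ fun n => Q_nonneg hpos _
  obtain hzero | hlimit := hlimit.eq_or_lt
  · rwa [← hzero] at hQ
  · have hN : (0 : ℝ) < N := by linarith [three_le_cast N]
    have hge := rpow_mul_rpow_le_of_mul_rpow_le (minLevel_nonneg hcont ha hpos)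
      (SMulti_pos hpos) hlimit hlevel
    rw [mul_assoc, one_div, ← div_eq_inv_mul, lt_div_iff₀ hN] at hc
    linarith [Q_nonneg hpos u₀]

theorem mainTheorem4 {N : ℕ} [Fact (3 ≤ N)] {k : ℕ}
    (h : Fin k → MultiSing.Sph N → ℝ) (hh : ∀ i, ContMDiff (𝓡 (N - 1)) 𝓘(ℝ, ℝ) 1 (h i))
    (a : Fin k → MultiSing.Eucl N) (ha : Function.Injective a)
    (hpos : 0 < MultiSing.mu h a)
    (u : ℕ → MultiSing.D12 N) (c : ℝ) (hu : MultiSing.IsPalaisSmale h a u c)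
    (hc : c < 1 / (N : ℝ) * MultiSing.SMulti h a ^ (1 - (N : ℝ) / 2)
      * MultiSing.minLevel h ^ ((N : ℝ) / 2)) :
    ∃ s : ℕ → ℕ, StrictMono s ∧
      ∃ u₀ : MultiSing.D12 N, Tendsto (fun n => u (s n)) atTop (𝓝 u₀) :=
  mainTheorem4_general h (fun i => (hh i).continuous) a ha hpos u c hu hc
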